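/- Let $\Omega\subseteq\mathbb R^d$ be a Borel set (for instance an open domain, its closure, or a compact domain) and $1<p<\infty$. Let $\mathcal P(\Omega)$ be the set of Borel probability measures on $\Omega$ and $\mathcal W_p(\Omega)=\{\mu\in\mathcal P(\Omega):\int_\Omega|x|^p\,d\mu<\infty\}$, with the distance $W_p(\mu,\nu)=\big(\min_\gamma\int_{\Omega\times\Omega}|x-y|^p\,d\gamma\big)^{1/p}$, where $\gamma$ runs over the probability measures on $\Omega\times\Omega$ with marginals $\mu$ and $\nu$. For a curve $\mu=(\mu_t)_{t\in[0,1]}$ put $|\mu'|(t)=\lim_{s\to t,\ s\in[0,1]}W_p(\mu_s,\mu_t)/|s-t|$ whenever this limit exists and is finite. For a curve $(\mu_t)_{t\in[0,1]}$ in $\mathcal P(\Omega)$, a velocity field of $\mu$ is a Borel vector field $v:[0,1]\times\Omega\to\mathbb R^d$ with $v_t=v(t,\cdot)\in L^p(\mu_t)^d$ for a.e. $t$ that solves the continuity equation $\partial_t\mu+\nabla\cdot(v\mu)=0$ in the following sense: for every function $\phi\in C^1_c(\mathbb R^d)$, the function $s\mapsto\int_\Omega\nabla\phi\cdot v_s\,d\mu_s$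 is integrable on $[0,1]$ and, for all $t_1<t_2$ in $[0,1]$, $$\int_\Omega\phi\,d\mu_{t_2}-\int_\Omega\phi\,d\mu_{t_1}=\int_{t_1}^{t_2}\int_\Omega\nabla\phi\cdot v_s\,d\mu_s\,ds .$$ (1) If $\mu:[0,1]\to\mathcal W_p(\Omega)$ is Lipschitz with respect to $W_p$, then there is a velocity field $v$ of $\mu$ such that, for a.e. $t\in[0,1]$, $|\mu'|(t)$ exists and $\|v_t\|_{L^p(\mu_t)}\le|\mu'|(t)$. It is unique: if $w$ is another velocity field of $\mu$ with this property, then for a.e. $t\in[0,1]$ one has $w_t=v_t$ $\mu_t$-a.e. (2) Conversely, let $(\mu_t)_{t\in[0,1]}$ be a curve in $\mathcal P(\Omega)$ with $\mu_0\in\mathcal W_p(\Omega)$, and let $v$ be a velocity field of $\mu$ such that, for some constant $C$, $\|v_t\|_{L^p(\mu_t)}\le C$ for a.e. $t\in[0,1]$. Then $\mu_t\in\mathcal W_p(\Omega)$ for all $t\in[0,1]$, the curve $\mu:[0,1]\to\mathcal W_p(\Omega)$ is Lipschitz with respect to $W_p$, and for a.e. $t\in[0,1]$ the metric derivative $|\mu'|(t)$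 exists and $|\mu'|(t)\le\|v_t\|_{L^p(\mu_t)}$. -/

import Mathlib

open MeasureTheory Set Filter
open scoped ENNReal NNReal Topology

namespace Wasserstein

/-- Transport plans between `μ` and `ν`: measures on the product with marginals `μ` and `ν`
(automatically probability measures when `μ` is one, and automatically concentrated on `Ω × Ω`
when `μ` and `ν` are concentrated on `Ω`). -/
def transportPlans {d : ℕ} (μ ν : Measure (EuclideanSpace ℝ (Fin d))) :
    Set (Measure (EuclideanSpace ℝ (Fin d) × EuclideanSpace ℝ (Fin d))) :=
  {γ | γ.map Prod.fst = μ ∧ γ.map Prod.snd = ν}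

/-- The Wasserstein distance of order `p`, with values in `[0, ∞]`: the `p`-th root of the infimum
of `∫ |x - y| ^ p dγ` over the transport plans `γ`. -/
noncomputable def Wp {d : ℕ} (p : ℝ) (μ ν : Measure (EuclideanSpace ℝ (Fin d))) : ℝ≥0∞ :=
  (⨅ γ ∈ transportPlans μ ν, ∫⁻ z, edist z.1 z.2 ^ p ∂γ) ^ (1 / p)

/-- The probability measures on `Ω`, seen as probability measures on `ℝᵈ` concentrated on `Ω`. -/
def probOn {d : ℕ} (Ω : Set (EuclideanSpace ℝ (Fin d))) :
    Set (Measure (EuclideanSpace ℝ (Fin d))) :=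
  {μ | IsProbabilityMeasure μ ∧ μ Ωᶜ = 0}

/-- The set of probability measures on `Ω` with finite `p`-th moment. -/
def space {d : ℕ} (p : ℝ) (Ω : Set (EuclideanSpace ℝ (Fin d))) :
    Set (Measure (EuclideanSpace ℝ (Fin d))) :=
  {μ | μ ∈ probOn Ω ∧ ∫⁻ x, ‖x‖ₑ ^ p ∂μ < ∞}

/-- `μ`, restricted to the time interval `[0, 1]`, is a Lipschitz curve in the Wasserstein space of
order `p` over `Ω`. -/
def IsLipschitzCurve {d : ℕ} (p : ℝ) (Ω : Set (EuclideanSpace ℝ (Fin d)))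
    (μ : ℝ → Measure (EuclideanSpace ℝ (Fin d))) : Prop :=
  (∀ t ∈ Icc (0 : ℝ) 1, μ t ∈ space p Ω) ∧
    ∃ L : ℝ≥0, ∀ s ∈ Icc (0 : ℝ) 1, ∀ t ∈ Icc (0 : ℝ) 1, Wp p (μ s) (μ t) ≤ L * edist s t

/-- The curve `μ : [0, 1] → (measures, Wp)` has a metric derivative at `t`, equal to `m`. -/
def HasMetricDerivAt {d : ℕ} (p : ℝ) (μ : ℝ → Measure (EuclideanSpace ℝ (Fin d)))
    (t : ℝ) (m : ℝ≥0) : Prop :=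
  Tendsto (fun s => Wp p (μ s) (μ t) / edist s t) (𝓝[Icc (0 : ℝ) 1 \ {t}] t) (𝓝 (m : ℝ≥0∞))

/-- The continuity equation `∂ₜμ + ∇ · (v μ) = 0` on `[0, 1]` in the sense of distributions, tested
against the restrictions of the `C¹` functions with compact support in `ℝᵈ` (`C¹` up to the
boundary of the domain carrying the measures, so that there is no flux through that boundary).
The integrability of `s ↦ ∫ ∇φ · vₛ dμₛ`, implicit in the equation, is part of the definition. -/
def ContinuityEquation {d : ℕ} (μ : ℝ → Measure (EuclideanSpace ℝ (Fin d)))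
    (v : ℝ → EuclideanSpace ℝ (Fin d) → EuclideanSpace ℝ (Fin d)) : Prop :=
  ∀ φ : EuclideanSpace ℝ (Fin d) → ℝ, ContDiff ℝ 1 φ → HasCompactSupport φ →
    IntervalIntegrable (fun s => ∫ x, inner ℝ (gradient φ x) (v s x) ∂(μ s)) volume 0 1 ∧
    ∀ t₁ ∈ Icc (0 : ℝ) 1, ∀ t₂ ∈ Icc (0 : ℝ) 1, t₁ < t₂ →
      ∫ x, φ x ∂(μ t₂) - ∫ x, φ x ∂(μ t₁) =
        ∫ s in t₁..t₂, ∫ x, inner ℝ (gradient φ x) (v s x) ∂(μ s)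

/-- `v` is a velocity field of the curve `μ`: a Borel time-dependent vector field with
`vₜ ∈ L^p(μₜ)` for a.e. `t`, solving the continuity equation. Its values off `[0, 1] × Ω` are
irrelevant (a Borel field on `[0, 1] × Ω` may be extended by `0`). -/
structure IsVelocityField {d : ℕ} (p : ℝ) (μ : ℝ → Measure (EuclideanSpace ℝ (Fin d)))
    (v : ℝ → EuclideanSpace ℝ (Fin d) → EuclideanSpace ℝ (Fin d)) : Prop where
  measurable : Measurable (Function.uncurry v)
  memLp : ∀ᵐ t ∂(volume.restrict (Icc (0 : ℝ) 1)), MemLp (v t) (ENNReal.ofReal p) (μ t)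
  continuityEquation : ContinuityEquation μ v

/-- `v` is a velocity field of `μ` with `‖vₜ‖_{L^p(μₜ)} ≤ |μ'|(t)` for a.e. `t ∈ [0, 1]`
(in particular the metric derivative exists at a.e. `t`). -/
def IsMinimalVelocityField {d : ℕ} (p : ℝ) (μ : ℝ → Measure (EuclideanSpace ℝ (Fin d)))
    (v : ℝ → EuclideanSpace ℝ (Fin d) → EuclideanSpace ℝ (Fin d)) : Prop :=
  IsVelocityField p μ v ∧
    ∀ᵐ t ∂(volume.restrict (Icc (0 : ℝ) 1)),
      ∃ m : ℝ≥0, HasMetricDerivAt p μ t m ∧ eLpNorm (v t) (ENNReal.ofReal p) (μ t) ≤ m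

end Wasserstein

/-! Both directions rest on how the integrals `∫ φ dμ_t` of test functions vary in time; write `q`
for the conjugate exponent.

From curve to velocity. Where the metric derivative exists, the derivative of `t ↦ ∫ φ dμ_t` is at
most `|μ'|(t) ‖∇φ‖_{L^q(μ_t)}` (`abs_deriv_integral_le`): a nearly optimal plan between close times
moves most mass only a little, so the slope of `φ` along it is almost its gradient. Hence sending
`1_A(t) ∇φ(x)` to the integral over `A` of this derivative is a linear functional bounded by `∫
|μ'|(t) ‖·‖_{L^q(μ_t)} dt`. Hahn-Banach extends it to bounded measurable fields, Radon-Nikodym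
represents it by a density `v`, and testing with truncations of `|v|^(p-2) v` on arbitrary sets of
times gives `‖v_t‖ ≤ |μ'|(t)` (`exists_field_of_le_fiberNorm`). Taking an interval for `A` gives
back the continuity equation.

From velocity to curve. The key inequality `W_p(μ_s, μ_t)^p ≤ (t-s)^(p-1) ∫_s^t ∫ |v|^p`
(`Wp_rpow_le_of_continuityEquation`) is proved on the dual side, without any flow of `v`. For a dual
pair `φ, ψ`, the Hopf-Lax evolution `u` of `φ` satisfies `∂_t u + |∇u|^q / q ≤ 0` and ends above
`ψ`. Along the curve, Young's inequality for `∇u · v` then bounds the growth of `∫ u dμ_r` by `(1/p)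
∫ |v_r|^p dμ_r`. Discretizing in time and mollifying in space makes `u` an admissible test function,
with errors that vanish in the limit (`exists_mollified_hopfLax`, `integral_sub_integral_le`).
`exists_plan_of_dual` turns the dual bound into a transport plan, and Lebesgue differentiation
yields `|μ'|(t) ≤ ‖v_t‖`.

Uniqueness combines the two: the midpoint of two minimal fields is again a velocity field, so its
norm is at least `|μ'|(t)`, and strict convexity of the `L^p` norm forces the fields to coincide. -/

namespace Wasserstein

/-! ### The Wasserstein distance: symmetry and triangle inequality. -/

section Distance

open ProbabilityTheory

variable {d : ℕ} {p : ℝ} {μ ν σ : Measure (EuclideanSpace ℝ (Fin d))}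

theorem Wp_le_of_mem_transportPlans
    {γ : Measure (EuclideanSpace ℝ (Fin d) × EuclideanSpace ℝ (Fin d))} (hp : 0 < p)
    (hγ : γ ∈ transportPlans μ ν) : Wp p μ ν ≤ (∫⁻ z, edist z.1 z.2 ^ p ∂γ) ^ (1 / p) :=
  ENNReal.rpow_le_rpow (iInf₂_le γ hγ) (by positivity)

theorem exists_transportPlan_lt {r : ℝ≥0∞} (hp : 0 < p) (h : Wp p μ ν < r) :
    ∃ γ ∈ transportPlans μ ν, ∫⁻ z, edist z.1 z.2 ^ p ∂γ < r ^ p := by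
  have h1 : (⨅ γ ∈ transportPlans μ ν, ∫⁻ z, edist z.1 z.2 ^ p ∂γ) < r ^ p := by
    have := ENNReal.rpow_lt_rpow h hp
    rwa [Wp, ← ENNReal.rpow_mul, one_div_mul_cancel hp.ne', ENNReal.rpow_one] at this
  simpa [iInf_lt_iff] using h1

theorem isProbabilityMeasure_of_mem_transportPlans [IsProbabilityMeasure μ]
    {γ : Measure (EuclideanSpace ℝ (Fin d) × EuclideanSpace ℝ (Fin d))}
    (hγ : γ ∈ transportPlans μ ν) : IsProbabilityMeasure γ := by
  have h : IsProbabilityMeasure (γ.map Prod.fst) := by rw [hγ.1]; infer_instance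
  exact Measure.isProbabilityMeasure_of_map Prod.fst

theorem Wp_comm_le (hp : 0 < p) : Wp p ν μ ≤ Wp p μ ν := by
  refine le_of_forall_gt fun r hr => ?_
  obtain ⟨γ, hγ, hlt⟩ := exists_transportPlan_lt hp hr
  have hmem : γ.map Prod.swap ∈ transportPlans ν μ := by
    refine ⟨?_, ?_⟩
    · rw [Measure.map_map measurable_fst measurable_swap]; exact hγ.2
    · rw [Measure.map_map measurable_snd measurable_swap]; exact hγ.1
  refine (Wp_le_of_mem_transportPlans hp hmem).trans_lt ?_
  rw [lintegral_map (by fun_prop) measurable_swap]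
  simp only [Prod.fst_swap, Prod.snd_swap]
  simp_rw [edist_comm] at hlt ⊢
  rw [one_div, ENNReal.rpow_inv_lt_iff hp]
  exact hlt

theorem Wp_comm (hp : 0 < p) : Wp p μ ν = Wp p ν μ :=
  le_antisymm (Wp_comm_le hp) (Wp_comm_le hp)

/-- Gluing of transport plans along their common marginal. -/
theorem exists_gluing [IsProbabilityMeasure μ] [IsProbabilityMeasure ν]
    {γ γ' : Measure (EuclideanSpace ℝ (Fin d) × EuclideanSpace ℝ (Fin d))}
    (h : γ ∈ transportPlans μ ν) (h' : γ' ∈ transportPlans ν σ) :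
    ∃ π : Measure ((EuclideanSpace ℝ (Fin d) × EuclideanSpace ℝ (Fin d)) ×
      EuclideanSpace ℝ (Fin d)), π.map Prod.fst = γ ∧ π.map (fun z => (z.1.2, z.2)) = γ' := by
  have := isProbabilityMeasure_of_mem_transportPlans h
  have := isProbabilityMeasure_of_mem_transportPlans h'
  -- Given a pair drawn from `γ`, the third point is drawn from the conditional law of `γ'` given
  -- the middle point.
  refine ⟨γ ⊗ₘ (γ'.condKernel.comap Prod.snd measurable_snd), Measure.fst_compProd _ _, ?_⟩
  have hd := γ'.disintegrate γ'.condKernel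
  ext s hs
  rw [Measure.map_apply (by fun_prop) hs, Measure.compProd_apply (by measurability)]
  conv_rhs => rw [← hd, Measure.compProd_apply hs]
  have e : γ'.fst = γ.map Prod.snd := by rw [h.2]; exact h'.1
  rw [e, lintegral_map (Kernel.measurable_kernel_prodMk_left hs) measurable_snd]
  rfl

/-- Minkowski's inequality in `L^p` of a gluing. Plans that are optimal up to `ε / 2` suffice, so
the existence of minimizers plays no role. -/
theorem Wp_triangle (hp : 1 ≤ p) [IsProbabilityMeasure μ] [IsProbabilityMeasure ν] :
    Wp p μ σ ≤ Wp p μ ν + Wp p ν σ := by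
  have hp0 : 0 < p := by linarith
  refine ENNReal.le_of_forall_pos_le_add fun ε hε hfin => ?_
  have hf1 : Wp p μ ν ≠ ∞ := (ENNReal.add_lt_top.1 hfin).1.ne
  have hf2 : Wp p ν σ ≠ ∞ := (ENNReal.add_lt_top.1 hfin).2.ne
  have hε2 : (ε / 2 : ℝ≥0∞) ≠ 0 := by simp [hε.ne']
  obtain ⟨γ, hγ, hlt⟩ := exists_transportPlan_lt hp0 (ENNReal.lt_add_right hf1 hε2)
  obtain ⟨γ', hγ', hlt'⟩ := exists_transportPlan_lt hp0 (ENNReal.lt_add_right hf2 hε2)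
  obtain ⟨π, h1, h2⟩ := exists_gluing hγ hγ'
  have hmem : π.map (fun z => (z.1.1, z.2)) ∈ transportPlans μ σ := by
    refine ⟨?_, ?_⟩
    · rw [Measure.map_map measurable_fst (by fun_prop), ← hγ.1, ← h1,
        Measure.map_map measurable_fst measurable_fst]
      rfl
    · rw [Measure.map_map measurable_snd (by fun_prop), ← hγ'.2, ← h2,
        Measure.map_map measurable_snd (by fun_prop)]
      rfl
  refine (Wp_le_of_mem_transportPlans hp0 hmem).trans ?_
  rw [lintegral_map (by fun_prop) (by fun_prop)]
  have hA : (∫⁻ z, edist z.1.1 z.1.2 ^ p ∂π) ^ (1 / p) ≤ Wp p μ ν + ε / 2 := by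
    rw [one_div, ENNReal.rpow_inv_le_iff hp0]
    rw [← h1, lintegral_map (by fun_prop) measurable_fst] at hlt
    exact hlt.le
  have hB : (∫⁻ z, edist z.1.2 z.2 ^ p ∂π) ^ (1 / p) ≤ Wp p ν σ + ε / 2 := by
    rw [one_div, ENNReal.rpow_inv_le_iff hp0]
    rw [← h2, lintegral_map (by fun_prop) (by fun_prop)] at hlt'
    exact hlt'.le
  calc (∫⁻ z, edist z.1.1 z.2 ^ p ∂π) ^ (1 / p)
      ≤ (∫⁻ z, (edist z.1.1 z.1.2 + edist z.1.2 z.2) ^ p ∂π) ^ (1 / p) := by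
        gcongr with z
        exact edist_triangle _ _ _
    _ ≤ (∫⁻ z, edist z.1.1 z.1.2 ^ p ∂π) ^ (1 / p) +
          (∫⁻ z, edist z.1.2 z.2 ^ p ∂π) ^ (1 / p) :=
        ENNReal.lintegral_Lp_add_le (by fun_prop) (by fun_prop) hp
    _ ≤ (Wp p μ ν + ε / 2) + (Wp p ν σ + ε / 2) := add_le_add hA hB
    _ = Wp p μ ν + Wp p ν σ + ε := by
        rw [add_add_add_comm, ENNReal.add_halves]

end Distance

/-! ### Metric derivatives of Lipschitz curves. -/

theorem _root_.LipschitzWith.integral_deriv_eq_sub {f : ℝ → ℝ} {K : ℝ≥0} (hf : LipschitzWith K f)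
    (a b : ℝ) : ∫ t in a..b, deriv f t = f b - f a :=
  (hf.lipschitzOnWith (s := uIcc a b)).absolutelyContinuousOnInterval.integral_deriv_eq_sub

/-- A Lipschitz curve in a pseudometric space, given by the distances `D s t` between its points,
has a metric derivative at almost every time. -/
theorem exists_metric_derivative {D : ℝ → ℝ → ℝ} {K : ℝ≥0} (symm : ∀ s t, D s t = D t s)
    (tri : ∀ r s t, D r t ≤ D r s + D s t) (lip : ∀ s t, D s t ≤ K * |s - t|) :
    ∃ m : ℝ → ℝ, Measurable m ∧ (∀ t, 0 ≤ m t) ∧ (∀ t, m t ≤ K) ∧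
      ∀ᵐ t, Tendsto (fun s => D s t / |s - t|) (𝓝[≠] t) (𝓝 (m t)) := by
  have hsub : ∀ r s t, |D r s - D r t| ≤ D s t := fun r s t => by
    rw [abs_le]
    constructor
    · linarith [tri r s t]
    · linarith [tri r t s, symm s t]
  have hlip : ∀ r, LipschitzWith K (D r) := fun r =>
    LipschitzWith.of_dist_le_mul fun s t => by
      rw [Real.dist_eq, Real.dist_eq]
      exact (hsub r s t).trans (lip s t)
  have hbd : ∀ r t, |deriv (D r) t| ≤ K := fun r t => norm_deriv_le_of_lipschitz (hlip r)
  -- The candidate is the fastest rate of change of the distance to a point of the curve, with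
  -- rational times as a countable dense family of base points. Countability keeps `m` measurable
  -- and lets the exceptional null sets be united.
  set m : ℝ → ℝ := fun t => ⨆ q : ℚ, |deriv (D q) t| with hm
  have hbdd : ∀ t, BddAbove (range fun q : ℚ => |deriv (D q) t|) := fun t =>
    ⟨K, by rintro _ ⟨q, rfl⟩; exact hbd q t⟩
  have hle : ∀ (q : ℚ) t, |deriv (D q) t| ≤ m t := fun q t => le_ciSup (hbdd t) q
  have hmeas : Measurable m := Measurable.iSup fun q => (measurable_deriv _).abs
  have hm0 : ∀ t, 0 ≤ m t := fun t => (abs_nonneg _).trans (hle 0 t)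
  have hmK : ∀ t, m t ≤ K := fun t => ciSup_le fun q => hbd q t
  have hloc : LocallyIntegrable m volume := by
    refine (locallyIntegrable_const (K : ℝ)).mono hmeas.aestronglyMeasurable (ae_of_all _ fun t => ?_)
    rw [Real.norm_of_nonneg (hm0 t)]
    exact (hmK t).trans (le_abs_self _)
  have hint : ∀ a b, IntervalIntegrable m volume a b := fun a b =>
    intervalIntegrable_iff.2 <|
      (hloc.integrableOn_isCompact isCompact_uIcc).mono_set uIoc_subset_uIcc
  -- A rational `q` just after `s` serves as base point: `D q s` is negligible, and `D q t - D q s`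
  -- is the integral of a derivative bounded by `m`.
  have hupper : ∀ s t, s ≤ t → D s t ≤ ∫ r in s..t, m r := by
    intro s t hst
    refine le_of_forall_pos_le_add fun ε hε => ?_
    obtain ⟨q, hq1, hq2⟩ := exists_rat_btwn (show s < s + ε / (2 * (K + 1)) by
      have : 0 < ε / (2 * ((K : ℝ) + 1)) := by positivity
      linarith)
    have h1 : D q t - D q s ≤ ∫ r in s..t, m r := by
      rw [← (hlip q).integral_deriv_eq_sub s t]
      refine intervalIntegral.integral_mono_on hst ?_ (hint s t) fun r _ =>
        (le_abs_self _).trans (hle q r)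
      exact ((hlip q).lipschitzOnWith (s := uIcc s t)).absolutelyContinuousOnInterval
        |>.intervalIntegrable_deriv
    have h2 : D q s ≤ ε / 2 := by
      refine (lip q s).trans ?_
      rw [abs_of_pos (by linarith)]
      have h3 : (q : ℝ) - s ≤ ε / (2 * (K + 1)) := by linarith
      calc (K : ℝ) * (q - s) ≤ (K + 1) * (ε / (2 * (K + 1))) := by
            gcongr
            linarith
        _ = ε / 2 := by field_simp
    linarith [tri s q t, symm s q]
  refine ⟨m, hmeas, hm0, hmK, ?_⟩
  have hdiff : ∀ᵐ t, ∀ q : ℚ, DifferentiableAt ℝ (D q) t :=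
    ae_all_iff.2 fun q => (hlip q).ae_differentiableAt_of_real
  filter_upwards [hdiff, LocallyIntegrable.ae_hasDerivAt_integral hloc] with t hq hF
  have hF' := (hF 0).tendsto_slope.abs
  rw [abs_of_nonneg (hm0 t)] at hF'
  have hslope : ∀ (f : ℝ → ℝ) (s : ℝ), |slope f t s| = |f s - f t| / |s - t| := fun f s => by
    rw [slope_def_field, abs_div]
  -- The lower bound comes from one base point almost attaining the supremum at `t`, the upper bound
  -- from Lebesgue differentiation of the primitive of `m`.
  refine tendsto_order.2 ⟨fun a ha => ?_, fun a ha => ?_⟩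
  · obtain ⟨q, hq'⟩ := exists_lt_of_lt_ciSup ha
    have := (hq q).hasDerivAt.tendsto_slope.abs
    filter_upwards [(tendsto_order.1 this).1 a hq'] with s hs
    refine hs.trans_le ?_
    rw [hslope]
    exact div_le_div_of_nonneg_right (hsub _ _ _) (abs_nonneg _)
  · filter_upwards [(tendsto_order.1 hF').2 a ha] with s hs
    refine lt_of_le_of_lt ?_ hs
    rw [hslope]
    refine div_le_div_of_nonneg_right ?_ (abs_nonneg _)
    rw [intervalIntegral.integral_interval_sub_left (hint _ _) (hint _ _)]
    rcases le_total s t with h | h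
    · rw [intervalIntegral.integral_symm, abs_neg]
      exact (hupper s t h).trans (le_abs_self _)
    · rw [symm]
      exact (hupper t s h).trans (le_abs_self _)

/-! ### Kantorovich duality by Hahn-Banach and Riesz-Markov. -/

section Duality

open BoundedContinuousFunction CompactlySupported

variable {X : Type*} [MetricSpace X]

/-- Bounded Lipschitz real functions. -/
structure IsBoundedLipschitz (f : X → ℝ) : Prop where
  lipschitz : ∃ K, LipschitzWith K f
  bounded : ∃ C, ∀ x, |f x| ≤ C

namespace IsBoundedLipschitz

variable {f g : X → ℝ}

theorem continuous (hf : IsBoundedLipschitz f) : Continuous f := by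
  obtain ⟨K, hK⟩ := hf.lipschitz
  exact hK.continuous

theorem const (a : ℝ) : IsBoundedLipschitz (fun _ : X => a) :=
  ⟨⟨0, LipschitzWith.const a⟩, ⟨|a|, fun _ => le_rfl⟩⟩

theorem add (hf : IsBoundedLipschitz f) (hg : IsBoundedLipschitz g) :
    IsBoundedLipschitz (fun x => f x + g x) := by
  obtain ⟨⟨K, hK⟩, C, hC⟩ := hf
  obtain ⟨⟨K', hK'⟩, C', hC'⟩ := hg
  exact ⟨⟨_, hK.add hK'⟩, C + C', fun x => (abs_add_le _ _).trans (add_le_add (hC x) (hC' x))⟩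

theorem const_mul (hf : IsBoundedLipschitz f) (a : ℝ) :
    IsBoundedLipschitz (fun x => a * f x) := by
  obtain ⟨⟨K, hK⟩, C, hC⟩ := hf
  refine ⟨⟨‖a‖₊ * K, LipschitzWith.of_dist_le_mul fun x y => ?_⟩, |a| * C, fun x => ?_⟩
  · rw [Real.dist_eq, ← mul_sub, abs_mul, NNReal.coe_mul, coe_nnnorm, mul_assoc, Real.norm_eq_abs]
    exact mul_le_mul_of_nonneg_left (hK.dist_le_mul x y) (abs_nonneg a)
  · rw [abs_mul]
    exact mul_le_mul_of_nonneg_left (hC x) (abs_nonneg a)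

theorem neg (hf : IsBoundedLipschitz f) : IsBoundedLipschitz (fun x => -f x) := by
  simpa using hf.const_mul (-1)

theorem integrable [MeasurableSpace X] [BorelSpace X] (hf : IsBoundedLipschitz f)
    (μ : Measure X) [IsFiniteMeasure μ] : Integrable f μ := by
  obtain ⟨C, hC⟩ := hf.bounded
  exact .of_bound hf.continuous.measurable.aestronglyMeasurable C (ae_of_all _ hC)

end IsBoundedLipschitz

/-- The function with value `1` on the ball of radius `n` and `0` off the ball of radius `n + 1`,
affine in the distance to the centre in between. -/
noncomputable def ballCutoff (x₀ : X) (n : ℕ) (x : X) : ℝ := max 0 (min 1 (n + 1 - dist x x₀))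

section ballCutoff

variable (x₀ : X) (n : ℕ)

theorem ballCutoff_nonneg (x : X) : 0 ≤ ballCutoff x₀ n x := le_max_left _ _

theorem ballCutoff_le_one (x : X) : ballCutoff x₀ n x ≤ 1 :=
  max_le zero_le_one (min_le_left _ _)

theorem isBoundedLipschitz_ballCutoff : IsBoundedLipschitz (ballCutoff x₀ n) := by
  refine ⟨⟨1, ?_⟩, 1, fun x => ?_⟩
  · have h : LipschitzWith 1 fun x : X => (n + 1 : ℝ) - dist x x₀ :=
      LipschitzWith.of_dist_le_mul fun x y => by
        rw [Real.dist_eq, sub_sub_sub_cancel_left, NNReal.coe_one, one_mul, dist_comm x y]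
        exact abs_dist_sub_le _ _ _
    exact (h.const_min 1).const_max 0
  · rw [abs_of_nonneg (ballCutoff_nonneg x₀ n x)]
    exact ballCutoff_le_one x₀ n x

theorem tendsto_ballCutoff (x : X) :
    Tendsto (fun n => ballCutoff x₀ n x) atTop (𝓝 1) := by
  obtain ⟨N, hN⟩ := exists_nat_gt (dist x x₀)
  refine tendsto_const_nhds.congr' ?_
  filter_upwards [eventually_ge_atTop N] with n hn
  have : (N : ℝ) ≤ n := by exact_mod_cast hn
  rw [ballCutoff, min_eq_left (by linarith), max_eq_right zero_le_one]

theorem ballCutoff_eq_zero {x : X} (hx : x ∉ Metric.closedBall x₀ (n + 1)) :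
    ballCutoff x₀ n x = 0 := by
  rw [Metric.mem_closedBall, not_le] at hx
  exact max_eq_left ((min_le_right _ _).trans (by linarith))

theorem hasCompactSupport_ballCutoff_mul [ProperSpace X] :
    HasCompactSupport fun z : X × X => ballCutoff x₀ n z.1 * ballCutoff x₀ n z.2 := by
  refine HasCompactSupport.intro
    ((isCompact_closedBall x₀ (n + 1 : ℝ)).prod (isCompact_closedBall x₀ (n + 1 : ℝ)))
    fun z hz => ?_
  rw [mem_prod, not_and_or] at hz
  rcases hz with h | h
  · rw [ballCutoff_eq_zero x₀ n h, zero_mul]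
  · rw [ballCutoff_eq_zero x₀ n h, mul_zero]

theorem tendsto_integral_one_sub_ballCutoff [MeasurableSpace X] [BorelSpace X] (μ : Measure X)
    [IsFiniteMeasure μ] :
    Tendsto (fun n => ∫ x, (1 - ballCutoff x₀ n x) ∂μ) atTop (𝓝 0) := by
  have := tendsto_integral_of_dominated_convergence (μ := μ)
    (F := fun n x => 1 - ballCutoff x₀ n x) (f := fun _ => 0) (fun _ => 1)
    (fun n => ((continuous_const.sub
      (isBoundedLipschitz_ballCutoff x₀ n).continuous).measurable.aestronglyMeasurable))
    (integrable_const _)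
    (fun n => ae_of_all _ fun x => by
      have h1 := ballCutoff_nonneg x₀ n x
      have h2 := ballCutoff_le_one x₀ n x
      rw [Real.norm_eq_abs, abs_le]
      constructor <;> linarith)
    (ae_of_all _ fun x => by simpa using (tendsto_ballCutoff x₀ x).const_sub 1)
  simpa using this

end ballCutoff

variable [MeasurableSpace X] [BorelSpace X]

/-- Indicators of closed sets are limits of Lipschitz thickened indicators, and closed sets form a
generating π-system. The constant test function supplies the finiteness of `μ`, which is not known
in advance for the marginals of a Riesz measure. -/
theorem ext_of_forall_isBoundedLipschitz {μ ν : Measure X} [IsProbabilityMeasure ν]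
    (h : ∀ f : X → ℝ, IsBoundedLipschitz f → (∀ x, 0 ≤ f x) →
      ∫⁻ x, ENNReal.ofReal (f x) ∂μ = ∫⁻ x, ENNReal.ofReal (f x) ∂ν) : μ = ν := by
  have h1 : μ univ = ν univ := by
    simpa using h _ (IsBoundedLipschitz.const 1) fun _ => zero_le_one
  have : IsFiniteMeasure μ := ⟨by rw [h1]; exact measure_lt_top _ _⟩
  refine ext_of_generate_finite _ (BorelSpace.measurable_eq.trans borel_eq_generateFrom_isClosed)
    isPiSystem_isClosed (fun F hF => ?_) h1
  have hF : IsClosed F := hF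
  have hδ : ∀ n : ℕ, 0 < 1 / ((n : ℝ) + 1) := fun n => by positivity
  have t1 := tendsto_lintegral_thickenedIndicator_of_isClosed μ hF hδ
    tendsto_one_div_add_atTop_nhds_zero_nat
  have t2 := tendsto_lintegral_thickenedIndicator_of_isClosed ν hF hδ
    tendsto_one_div_add_atTop_nhds_zero_nat
  refine tendsto_nhds_unique t1 (t2.congr fun n => ?_)
  have hb : IsBoundedLipschitz fun x => (thickenedIndicator (hδ n) F x : ℝ) := by
    refine ⟨⟨_, fun x y => lipschitzWith_thickenedIndicator (hδ n) F x y⟩, 1, fun x => ?_⟩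
    rw [NNReal.abs_eq]
    exact_mod_cast thickenedIndicator_le_one (hδ n) F x
  simpa using (h _ hb fun _ => NNReal.coe_nonneg _).symm

/-- The linear functional produced by the Hahn-Banach theorem in the proof of duality. -/
theorem exists_linear_of_dual {c : X × X → ℝ} (hc0 : ∀ z, 0 ≤ c z)
    (μ ν : Measure X) [IsProbabilityMeasure μ] [IsProbabilityMeasure ν] {A : ℝ}
    (H : ∀ φ ψ : X → ℝ, IsBoundedLipschitz φ → IsBoundedLipschitz ψ →
      (∀ x y, ψ y - φ x ≤ c (x, y)) → ∫ y, ψ y ∂ν - ∫ x, φ x ∂μ ≤ A) :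
    ∃ Λ : (X × X →ᵇ ℝ) →ₗ[ℝ] ℝ, ∀ (h : X × X →ᵇ ℝ) (φ ψ : X → ℝ) (l : ℝ),
      IsBoundedLipschitz φ → IsBoundedLipschitz ψ → 0 ≤ l →
      (∀ x y, h (x, y) ≤ φ x + ψ y + l * c (x, y)) →
      Λ h ≤ ∫ x, φ x ∂μ + ∫ y, ψ y ∂ν + l * A := by
  -- The sublinear functional is the infimum of `∫ φ dμ + ∫ ψ dν + l A` over the majorants `φ ⊕ ψ +
  -- l c` of `h`. Keeping `l` positive allows division by `l` to reach the dual hypothesis `H`; the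
  -- case `l = 0` is recovered by a limit at the end.
  let S : (X × X →ᵇ ℝ) → Set ℝ := fun h => {r | ∃ (φ ψ : X → ℝ) (l : ℝ),
    IsBoundedLipschitz φ ∧ IsBoundedLipschitz ψ ∧ 0 < l ∧
      (∀ x y, h (x, y) ≤ φ x + ψ y + l * c (x, y)) ∧
      r = ∫ x, φ x ∂μ + ∫ y, ψ y ∂ν + l * A}
  have hne : ∀ h, (S h).Nonempty := fun h =>
    ⟨_, fun _ => ‖h‖, fun _ => 0, 1, .const _, .const _, one_pos, fun x y => by
      have h1 := (le_abs_self _).trans (h.norm_coe_le_norm (x, y))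
      have h2 := hc0 (x, y)
      linarith, rfl⟩
  have hbd : ∀ h, BddBelow (S h) := by
    refine fun h => ⟨-‖h‖, ?_⟩
    rintro _ ⟨φ, ψ, l, hφ, hψ, hl, hle, rfl⟩
    -- Since `h ≥ -‖h‖`, the majorant, with `ψ` sent to the other side and scaled by `l⁻¹`, is a
    -- competitor in the dual problem; finiteness of the infimum is thus the dual bound itself.
    have h1 := H (fun x => l⁻¹ * (φ x + ‖h‖)) (fun y => l⁻¹ * (-ψ y))
      ((hφ.add (.const _)).const_mul _) (hψ.neg.const_mul _) fun x y => by
        have h2 := (neg_abs_le _).trans' (neg_le_neg (h.norm_coe_le_norm (x, y)))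
        have h3 := hle x y
        rw [← mul_sub, inv_mul_le_iff₀ hl]
        linarith
    rw [integral_const_mul, integral_const_mul, integral_neg,
      integral_add (hφ.integrable μ) (integrable_const _), ← mul_sub, inv_mul_le_iff₀ hl] at h1
    simp only [integral_const, probReal_univ, one_smul] at h1
    linarith
  have hom : ∀ a : ℝ, 0 < a → ∀ h, sInf (S (a • h)) = a * sInf (S h) := by
    have hle : ∀ a : ℝ, 0 < a → ∀ h, sInf (S (a • h)) ≤ a * sInf (S h) := by
      intro a ha h
      rw [← div_le_iff₀' ha]
      refine le_csInf (hne h) ?_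
      rintro _ ⟨φ, ψ, l, hφ, hψ, hl, hle, rfl⟩
      rw [div_le_iff₀' ha]
      refine csInf_le (hbd _) ⟨fun x => a * φ x, fun x => a * ψ x, a * l, hφ.const_mul _,
        hψ.const_mul _, by positivity, fun x y => ?_, ?_⟩
      · have := mul_le_mul_of_nonneg_left (hle x y) ha.le
        simp only [BoundedContinuousFunction.coe_smul, smul_eq_mul]
        linarith
      · rw [integral_const_mul, integral_const_mul]; ring
    intro a ha h
    refine le_antisymm (hle a ha h) ?_
    have := hle a⁻¹ (inv_pos.2 ha) (a • h)
    rwa [smul_smul, inv_mul_cancel₀ ha.ne', one_smul, ← div_eq_inv_mul, le_div_iff₀' ha] at this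
  have hadd : ∀ h h', sInf (S (h + h')) ≤ sInf (S h) + sInf (S h') := by
    intro h h'
    rw [← sub_le_iff_le_add]
    refine le_csInf (hne h) ?_
    rintro _ ⟨φ, ψ, l, hφ, hψ, hl, hle, rfl⟩
    rw [sub_le_comm]
    refine le_csInf (hne h') ?_
    rintro _ ⟨φ', ψ', l', hφ', hψ', hl', hle', rfl⟩
    rw [sub_le_iff_le_add']
    refine csInf_le (hbd _) ⟨_, _, l + l', hφ.add hφ', hψ.add hψ', by positivity, fun x y => ?_, ?_⟩
    · have h1 := hle x y
      have h2 := hle' x y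
      simp only [BoundedContinuousFunction.coe_add, Pi.add_apply]
      linarith
    · rw [integral_add (hφ.integrable _) (hφ'.integrable _),
        integral_add (hψ.integrable _) (hψ'.integrable _)]
      ring
  have hzero : ∀ h : (⊥ : Submodule ℝ (X × X →ᵇ ℝ)), (0 : ℝ) ≤ sInf (S h) := by
    rintro ⟨h, hh⟩
    obtain rfl : h = 0 := by simpa using hh
    refine le_csInf (hne 0) fun r hr => ?_
    obtain ⟨φ, ψ, l, hφ, hψ, hl, hle, rfl⟩ := hr
    have h1 := H (fun x => l⁻¹ * φ x) (fun y => l⁻¹ * (-ψ y))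
      (hφ.const_mul _) (hψ.neg.const_mul _) fun x y => by
        have h3 := hle x y
        simp only [BoundedContinuousFunction.coe_zero, Pi.zero_apply] at h3
        rw [← mul_sub, inv_mul_le_iff₀ hl]
        linarith
    rw [integral_const_mul, integral_const_mul, integral_neg, ← mul_sub,
      inv_mul_le_iff₀ hl] at h1
    linarith
  obtain ⟨Λ, -, hΛ⟩ := exists_extension_of_le_sublinear
    (⟨⊥, 0⟩ : (X × X →ᵇ ℝ) →ₗ.[ℝ] ℝ) (fun h => sInf (S h)) hom hadd hzero
  refine ⟨Λ, fun h φ ψ l hφ hψ hl hle => ?_⟩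
  -- As `c ≥ 0`, raising `l` to `l + ε` preserves the majorization and makes the coefficient
  -- positive.
  have key : ∀ ε : ℝ, 0 < ε → Λ h ≤ ∫ x, φ x ∂μ + ∫ y, ψ y ∂ν + (l + ε) * A := fun ε hε =>
    (hΛ h).trans (csInf_le (hbd h) ⟨φ, ψ, l + ε, hφ, hψ, by positivity, fun x y => by
      have := hle x y
      have := mul_nonneg hε.le (hc0 (x, y))
      linarith, rfl⟩)
  have ht : Tendsto (fun ε : ℝ => ∫ x, φ x ∂μ + ∫ y, ψ y ∂ν + (l + ε) * A) (𝓝[>] 0)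
      (𝓝 (∫ x, φ x ∂μ + ∫ y, ψ y ∂ν + (l + 0) * A)) := by
    refine Tendsto.mono_left ?_ nhdsWithin_le_nhds
    exact Continuous.tendsto (by fun_prop) 0
  rw [add_zero] at ht
  exact ge_of_tendsto ht (by filter_upwards [self_mem_nhdsWithin] with ε hε using key ε hε)

variable [ProperSpace X]

/-- Kantorovich duality, in the form needed here: an upper bound for the dual problem over bounded
Lipschitz functions gives a transport plan whose cost satisfies the same bound. -/
theorem exists_plan_of_dual {c : X × X → ℝ} (hc : Continuous c) (hc0 : ∀ z, 0 ≤ c z)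
    (μ ν : Measure X) [IsProbabilityMeasure μ] [IsProbabilityMeasure ν] {A : ℝ}
    (H : ∀ φ ψ : X → ℝ, IsBoundedLipschitz φ → IsBoundedLipschitz ψ →
      (∀ x y, ψ y - φ x ≤ c (x, y)) → ∫ y, ψ y ∂ν - ∫ x, φ x ∂μ ≤ A) :
    ∃ γ : Measure (X × X), γ.map Prod.fst = μ ∧ γ.map Prod.snd = ν ∧
      ∫⁻ z, ENNReal.ofReal (c z) ∂γ ≤ ENNReal.ofReal A := by
  obtain ⟨Λ, hΛ⟩ := exists_linear_of_dual hc0 μ ν H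
  obtain ⟨x₀⟩ : Nonempty X := nonempty_of_isProbabilityMeasure μ
  let j : C_c(X × X, ℝ) →ₗ[ℝ] (X × X →ᵇ ℝ) :=
    { toFun := fun f => f.toBoundedContinuousFunction
      map_add' := fun f g => by ext; rfl
      map_smul' := fun a f => by ext; rfl }
  -- Zero majorizes `-f`, so `Λ (-f) ≤ 0`. This is where `l = 0` is indispensable, since with `l >
  -- 0` a term in `A` would remain.
  have hpos : ∀ f : C_c(X × X, ℝ), 0 ≤ f → 0 ≤ (Λ ∘ₗ j) f := fun f hf => by
    have := hΛ (-(j f)) (fun _ => 0) (fun _ => 0) 0 (.const 0) (.const 0) le_rfl fun x y => by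
      have : 0 ≤ f (x, y) := hf (x, y)
      simpa [j] using this
    simpa using this
  let γ := RealRMK.rieszMeasure (PositiveLinearMap.mk₀ (Λ ∘ₗ j) hpos)
  have hγ : ∀ f : C_c(X × X, ℝ), ∫ z, f z ∂γ = Λ (j f) := fun f =>
    RealRMK.integral_rieszMeasure _ f
  let χ : ℕ → X × X → ℝ := fun n z => ballCutoff x₀ n z.1 * ballCutoff x₀ n z.2
  have hχc : ∀ n, Continuous (χ n) := fun n =>
    ((isBoundedLipschitz_ballCutoff x₀ n).continuous.comp continuous_fst).mul
      ((isBoundedLipschitz_ballCutoff x₀ n).continuous.comp continuous_snd)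
  have hχ0 : ∀ n z, 0 ≤ χ n z := fun n z =>
    mul_nonneg (ballCutoff_nonneg x₀ n _) (ballCutoff_nonneg x₀ n _)
  have hχ1 : ∀ n z, χ n z ≤ 1 := fun n z =>
    mul_le_one₀ (ballCutoff_le_one x₀ n _) (ballCutoff_nonneg x₀ n _) (ballCutoff_le_one x₀ n _)
  have hχt : ∀ z, Tendsto (fun n => χ n z) atTop (𝓝 1) := fun z => by
    simpa using (tendsto_ballCutoff x₀ z.1).mul (tendsto_ballCutoff x₀ z.2)
  -- The Riesz measure is only controlled on compactly supported functions, so unbounded or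
  -- non-decaying integrands are cut off in height and in space.
  let trunc : (X × X → ℝ) → ℕ → X × X → ℝ := fun g n z => min (g z) n * χ n z
  have htc : ∀ {g : X × X → ℝ}, Continuous g → ∀ n, ∃ F : C_c(X × X, ℝ), ⇑F = trunc g n :=
    fun hg n => ⟨⟨⟨trunc _ n, (hg.min continuous_const).mul (hχc n)⟩,
      (hasCompactSupport_ballCutoff_mul x₀ n).mul_left⟩, rfl⟩
  have htt : ∀ (g : X × X → ℝ) z, Tendsto (fun n => trunc g n z) atTop (𝓝 (g z)) := fun g z => by
    have h1 : Tendsto (fun n : ℕ => min (g z) n) atTop (𝓝 (g z)) := by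
      refine tendsto_const_nhds.congr' ?_
      filter_upwards [eventually_ge_atTop ⌈g z⌉₊] with n hn
      exact (min_eq_left ((Nat.le_ceil _).trans (by exact_mod_cast hn))).symm
    simpa using h1.mul (hχt z)
  have htle : ∀ {g : X × X → ℝ}, (∀ z, 0 ≤ g z) → ∀ n z, trunc g n z ≤ g z := fun hg n z =>
    (mul_le_of_le_one_right (le_min (hg z) n.cast_nonneg) (hχ1 n z)).trans (min_le_left _ _)
  have ht0 : ∀ {g : X × X → ℝ}, (∀ z, 0 ≤ g z) → ∀ n z, 0 ≤ trunc g n z := fun hg n z =>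
    mul_nonneg (le_min (hg z) n.cast_nonneg) (hχ0 n z)
  have hlin : ∀ {g : X × X → ℝ}, (∀ z, 0 ≤ g z) → ∀ n (F : C_c(X × X, ℝ)), ⇑F = trunc g n →
      ∫⁻ z, ENNReal.ofReal (trunc g n z) ∂γ = ENNReal.ofReal (Λ (j F)) := by
    intro g hg n F hF
    rw [← hγ F, ofReal_integral_eq_lintegral_ofReal F.integrable
      (ae_of_all _ fun z => by rw [hF]; exact ht0 hg n z), hF]
  have fatou : ∀ {g : X × X → ℝ}, Continuous g → (∀ z, 0 ≤ g z) → ∀ B : ℝ,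
      (∀ n (F : C_c(X × X, ℝ)), ⇑F = trunc g n → Λ (j F) ≤ B) →
      ∫⁻ z, ENNReal.ofReal (g z) ∂γ ≤ ENNReal.ofReal B := by
    intro g hg hg0 B hB
    calc ∫⁻ z, ENNReal.ofReal (g z) ∂γ
        = ∫⁻ z, liminf (fun n => ENNReal.ofReal (trunc g n z)) atTop ∂γ :=
          lintegral_congr fun z => ((ENNReal.tendsto_ofReal (htt g z)).liminf_eq).symm
      _ ≤ liminf (fun n => ∫⁻ z, ENNReal.ofReal (trunc g n z) ∂γ) atTop := by
          refine lintegral_liminf_le fun n => ?_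
          exact (((hg.min continuous_const).mul (hχc n)).measurable).ennreal_ofReal
      _ ≤ ENNReal.ofReal B := by
          refine liminf_le_of_le (by isBoundedDefault) fun b hb => ?_
          obtain ⟨n, hn⟩ := hb.exists
          obtain ⟨F, hF⟩ := htc hg n
          rw [hlin hg0 n F hF] at hn
          exact hn.trans (ENNReal.ofReal_le_ofReal (hB n F hF))
  have hmarg : ∀ φ ψ : X → ℝ, IsBoundedLipschitz φ → IsBoundedLipschitz ψ → (∀ x, 0 ≤ φ x) →
      (∀ x, 0 ≤ ψ x) → ∫⁻ z, ENNReal.ofReal (φ z.1 + ψ z.2) ∂γ =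
        ENNReal.ofReal (∫ x, φ x ∂μ + ∫ y, ψ y ∂ν) := by
    intro φ ψ hφ hψ hφ0 hψ0
    let g : X × X → ℝ := fun z => φ z.1 + ψ z.2
    have hg : Continuous g :=
      (hφ.continuous.comp continuous_fst).add (hψ.continuous.comp continuous_snd)
    have hg0 : ∀ z, 0 ≤ g z := fun z => add_nonneg (hφ0 _) (hψ0 _)
    refine le_antisymm (fatou hg hg0 _ fun n F hF => ?_) ?_
    · have := hΛ (j F) φ ψ 0 hφ hψ le_rfl fun x y => by
        rw [zero_mul, add_zero]
        change F (x, y) ≤ _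
        rw [hF]
        exact htle hg0 n (x, y)
      simpa using this
    · obtain ⟨C, hC⟩ := (hφ.bounded)
      obtain ⟨C', hC'⟩ := (hψ.bounded)
      obtain ⟨N, hN⟩ := exists_nat_ge (C + C')
      have hgN : ∀ z, g z ≤ N := fun z =>
        (add_le_add ((le_abs_self _).trans (hC _)) ((le_abs_self _).trans (hC' _))).trans hN
      -- No mass escapes to infinity. With `N` above `φ ⊕ ψ`, what the cutoff removes is at most `N
      -- (1 - χ(x)) + N (1 - χ(y))`, a sum of functions of one variable whose integrals against `μ`
      -- and `ν` tend to `0`.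
      have hlow : ∀ n, N ≤ n → ENNReal.ofReal (∫ x, φ x ∂μ + ∫ y, ψ y ∂ν -
          N * (∫ x, (1 - ballCutoff x₀ n x) ∂μ + ∫ x, (1 - ballCutoff x₀ n x) ∂ν)) ≤
            ∫⁻ z, ENNReal.ofReal (g z) ∂γ := by
        intro n hn
        obtain ⟨F, hF⟩ := htc hg n
        refine le_trans ?_ (lintegral_mono fun z => ENNReal.ofReal_le_ofReal (htle hg0 n z))
        rw [hlin hg0 n F hF]
        refine ENNReal.ofReal_le_ofReal ?_
        have hb : IsBoundedLipschitz fun x => (N : ℝ) * (1 + -ballCutoff x₀ n x) :=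
          ((IsBoundedLipschitz.const 1).add (isBoundedLipschitz_ballCutoff x₀ n).neg).const_mul _
        have := hΛ (-(j F)) (fun x => -φ x + N * (1 + -ballCutoff x₀ n x))
          (fun x => -ψ x + N * (1 + -ballCutoff x₀ n x)) 0 (hφ.neg.add hb) (hψ.neg.add hb) le_rfl
          fun x y => by
            change -F (x, y) ≤ _
            rw [hF]
            have e1 : min (g (x, y)) n = g (x, y) :=
              min_eq_left ((hgN _).trans (by exact_mod_cast hn))
            simp only [trunc, χ, e1]
            have hx0 := ballCutoff_nonneg x₀ n x
            have hy0 := ballCutoff_nonneg x₀ n y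
            have hx1 := ballCutoff_le_one x₀ n x
            have hy1 := ballCutoff_le_one x₀ n y
            have h1 : 0 ≤ 1 - ballCutoff x₀ n x * ballCutoff x₀ n y := by
              have := mul_le_one₀ hx1 hy0 hy1
              linarith
            have h2 := mul_le_mul_of_nonneg_right (hgN (x, y)) h1
            have h3 : 0 ≤ (1 - ballCutoff x₀ n x) * (1 - ballCutoff x₀ n y) :=
              mul_nonneg (by linarith) (by linarith)
            have h4 : 0 ≤ (N : ℝ) * ((1 - ballCutoff x₀ n x) * (1 - ballCutoff x₀ n y)) :=
              mul_nonneg N.cast_nonneg h3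
            have h5 : g (x, y) = φ x + ψ y := rfl
            rw [h5] at h2 ⊢
            nlinarith
        rw [integral_add (hφ.neg.integrable _) (hb.integrable _),
          integral_add (hψ.neg.integrable _) (hb.integrable _), integral_neg, integral_neg,
          integral_const_mul, integral_const_mul, map_neg] at this
        simp only [← sub_eq_add_neg] at this
        linarith
      have ht : Tendsto (fun n => ENNReal.ofReal (∫ x, φ x ∂μ + ∫ y, ψ y ∂ν -
          N * (∫ x, (1 - ballCutoff x₀ n x) ∂μ + ∫ x, (1 - ballCutoff x₀ n x) ∂ν))) atTop
          (𝓝 (ENNReal.ofReal (∫ x, φ x ∂μ + ∫ y, ψ y ∂ν))) := by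
        refine ENNReal.tendsto_ofReal ?_
        have := (((tendsto_integral_one_sub_ballCutoff x₀ μ).add
          (tendsto_integral_one_sub_ballCutoff x₀ ν)).const_mul (N : ℝ)).const_sub
            (∫ x, φ x ∂μ + ∫ y, ψ y ∂ν)
        simpa using this
      exact le_of_tendsto ht (by filter_upwards [eventually_ge_atTop N] with n hn using hlow n hn)
  refine ⟨γ, ?_, ?_, fatou hc hc0 A fun n F hF => ?_⟩
  · refine ext_of_forall_isBoundedLipschitz fun f hf hf0 => ?_
    rw [lintegral_map (hf.continuous.measurable.ennreal_ofReal) measurable_fst,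
      ← ofReal_integral_eq_lintegral_ofReal (hf.integrable μ) (ae_of_all _ hf0)]
    simpa using hmarg f (fun _ => 0) hf (.const 0) hf0 fun _ => le_rfl
  · refine ext_of_forall_isBoundedLipschitz fun f hf hf0 => ?_
    rw [lintegral_map (hf.continuous.measurable.ennreal_ofReal) measurable_snd,
      ← ofReal_integral_eq_lintegral_ofReal (hf.integrable ν) (ae_of_all _ hf0)]
    simpa using hmarg (fun _ => 0) f (.const 0) hf (fun _ => le_rfl) hf0
  -- The truncated cost is majorized by the cost itself, that is by `φ = ψ = 0` and `l = 1`.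
  · have := hΛ (j F) (fun _ => 0) (fun _ => 0) 1 (.const 0) (.const 0) zero_le_one fun x y => by
      change F (x, y) ≤ _
      rw [hF]
      simpa using htle hc0 n (x, y)
    simpa using this

end Duality

/-! ### The discrete Hopf-Lax semigroup and its mollification. -/

section HopfLax

variable {E : Type*} [NormedAddCommGroup E]

/-- The infimal convolution of two real functions. -/
noncomputable def infConv (f a : E → ℝ) (y : E) : ℝ := ⨅ z, f (y - z) + a z

section infConv

variable {f a : E → ℝ} {C : ℝ}

theorem bddBelow_infConv (hf : ∀ x, |f x| ≤ C) (ha : ∀ z, 0 ≤ a z) (y : E) :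
    BddBelow (range fun z => f (y - z) + a z) :=
  ⟨-C, by
    rintro _ ⟨z, rfl⟩
    have := neg_le_of_abs_le (hf (y - z))
    have := ha z
    simp only
    linarith⟩

theorem infConv_add_le (hf : ∀ x, |f x| ≤ C) (ha : ∀ z, 0 ≤ a z) (x b : E) :
    infConv f a (x + b) ≤ f x + a b := by
  have h : infConv f a (x + b) ≤ f (x + b - b) + a b :=
    ciInf_le (bddBelow_infConv hf ha (x + b)) b
  rwa [add_sub_cancel_right] at h

theorem infConv_le_self (hf : ∀ x, |f x| ≤ C) (ha : ∀ z, 0 ≤ a z) (ha0 : a 0 = 0) (x : E) :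
    infConv f a x ≤ f x := by
  simpa [ha0] using infConv_add_le hf ha x 0

theorem abs_infConv_le (hf : ∀ x, |f x| ≤ C) (ha : ∀ z, 0 ≤ a z) (ha0 : a 0 = 0) (x : E) :
    |infConv f a x| ≤ C := by
  refine abs_le.2 ⟨le_ciInf fun z => ?_, (infConv_le_self hf ha ha0 x).trans (le_of_abs_le (hf x))⟩
  have := neg_le_of_abs_le (hf (x - z))
  have := ha z
  linarith

theorem lipschitzWith_infConv {K : ℝ≥0} (hf : ∀ x, |f x| ≤ C) (ha : ∀ z, 0 ≤ a z)
    (hK : LipschitzWith K f) : LipschitzWith K (infConv f a) := by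
  refine LipschitzWith.of_le_add_mul K fun x y => ?_
  rw [← sub_le_iff_le_add]
  refine le_ciInf fun z => ?_
  have h1 := ciInf_le (bddBelow_infConv hf ha x) z
  have h2 := hK.le_add_mul (x - z) (y - z)
  rw [dist_sub_right] at h2
  have : infConv f a x ≤ f (x - z) + a z := h1
  linarith

theorem sub_le_infConv {K : ℝ≥0} {B : ℝ} (hK : LipschitzWith K f)
    (hB : ∀ z, K * ‖z‖ - a z ≤ B) (x : E) : f x - B ≤ infConv f a x := by
  refine le_ciInf fun z => ?_
  have h1 := hK.le_add_mul x (x - z)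
  rw [dist_self_sub_right] at h1
  have := hB z
  linarith

end infConv

/-- The Lagrangian action `h L(z / h)`, for `L = |·| ^ p / p`, of the constant speed motion along `z`
in time `h`. -/
noncomputable def action (p h : ℝ) (z : E) : ℝ := h * ((‖z‖ / h) ^ p / p)

section action

variable {p q h : ℝ}

theorem action_nonneg (hp : 0 < p) (hh : 0 < h) (z : E) : 0 ≤ action p h z := by
  unfold action; positivity

theorem action_zero (hp : 0 < p) : action p h (0 : E) = 0 := by
  simp [action, Real.zero_rpow hp.ne']

theorem continuous_action (hp : 0 < p) : Continuous (action p h : E → ℝ) := by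
  unfold action
  have : Continuous fun z : E => (‖z‖ / h) ^ p :=
    (continuous_norm.div_const h).rpow_const fun _ => Or.inr hp.le
  fun_prop

/-- Young's inequality, read as a bound on the Legendre transform of the action. It limits how far
one Hopf-Lax step lowers a `K`-Lipschitz function. -/
theorem mul_norm_sub_action_le (hpq : p.HolderConjugate q) (hh : 0 < h) {K : ℝ} (hK : 0 ≤ K)
    (z : E) : K * ‖z‖ - action p h z ≤ h * (K ^ q / q) := by
  have := Real.young_inequality_of_nonneg (show 0 ≤ ‖z‖ / h by positivity) hK hpq
  have h2 := mul_le_mul_of_nonneg_left this hh.le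
  have e : h * (‖z‖ / h * K) = K * ‖z‖ := by field_simp
  rw [e, mul_add] at h2
  unfold action
  linarith

/-- Convexity of `r ↦ r^p`: moving straight at constant speed costs no more than a motion in two
legs of durations `r` and `s`. -/
theorem action_add_le (hp : 1 ≤ p) {r s : ℝ} (hr : 0 < r) (hs : 0 < s) (x y : E) :
    action p (r + s) (x + y) ≤ action p r x + action p s y := by
  have hrs : 0 < r + s := add_pos hr hs
  have hp0 : 0 < p := by linarith
  have hconv := (convexOn_rpow hp).2 (show 0 ≤ ‖x‖ / r by positivity)
    (show 0 ≤ ‖y‖ / s by positivity) (show 0 ≤ r / (r + s) by positivity)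
    (show 0 ≤ s / (r + s) by positivity) (by field_simp)
  simp only [smul_eq_mul] at hconv
  have e : r / (r + s) * (‖x‖ / r) + s / (r + s) * (‖y‖ / s) = (‖x‖ + ‖y‖) / (r + s) := by
    field_simp
  rw [e] at hconv
  have h1 : (‖x + y‖ / (r + s)) ^ p ≤ ((‖x‖ + ‖y‖) / (r + s)) ^ p := by
    gcongr
    exact norm_add_le x y
  have h2 := mul_le_mul_of_nonneg_left (h1.trans hconv) (show 0 ≤ (r + s) / p by positivity)
  unfold action
  calc (r + s) * ((‖x + y‖ / (r + s)) ^ p / p) = (r + s) / p * (‖x + y‖ / (r + s)) ^ p := by ring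
    _ ≤ _ := h2
    _ = _ := by field_simp

end action

/-- The discrete Hopf-Lax semigroup with time step `h`. -/
noncomputable def hopfLax (p h : ℝ) (φ : E → ℝ) : ℕ → E → ℝ
  | 0 => φ
  | k + 1 => infConv (hopfLax p h φ k) (action p h)

section hopfLax

variable {p q h C : ℝ} {K : ℝ≥0} {φ : E → ℝ}

theorem abs_hopfLax_le (hp : 0 < p) (hh : 0 < h) (hC : ∀ x, |φ x| ≤ C) (k : ℕ) (x : E) :
    |hopfLax p h φ k x| ≤ C := by
  induction k generalizing x with
  | zero => exact hC x
  | succ k ih => exact abs_infConv_le ih (action_nonneg hp hh) (action_zero hp) x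

theorem lipschitzWith_hopfLax (hp : 0 < p) (hh : 0 < h) (hC : ∀ x, |φ x| ≤ C)
    (hK : LipschitzWith K φ) (k : ℕ) : LipschitzWith K (hopfLax p h φ k) := by
  induction k with
  | zero => exact hK
  | succ k ih => exact lipschitzWith_infConv (abs_hopfLax_le hp hh hC k) (action_nonneg hp hh) ih

theorem hopfLax_succ_add_le (hp : 0 < p) (hh : 0 < h) (hC : ∀ x, |φ x| ≤ C) (k : ℕ) (x b : E) :
    hopfLax p h φ (k + 1) (x + b) ≤ hopfLax p h φ k x + action p h b :=
  infConv_add_le (abs_hopfLax_le hp hh hC k) (action_nonneg hp hh) x b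

theorem abs_hopfLax_succ_sub_le (hpq : p.HolderConjugate q) (hh : 0 < h) (hC : ∀ x, |φ x| ≤ C)
    (hK : LipschitzWith K φ) (k : ℕ) (x : E) :
    |hopfLax p h φ (k + 1) x - hopfLax p h φ k x| ≤ h * ((K : ℝ) ^ q / q) := by
  have h1 := infConv_le_self (abs_hopfLax_le hpq.pos hh hC k) (action_nonneg hpq.pos hh)
    (action_zero hpq.pos) x
  have h2 := sub_le_infConv (lipschitzWith_hopfLax hpq.pos hh hC hK k)
    (mul_norm_sub_action_le hpq hh K.coe_nonneg) x
  rw [abs_le]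
  simp only [hopfLax]
  have : 0 ≤ h * ((K : ℝ) ^ q / q) :=
    mul_nonneg hh.le (div_nonneg (Real.rpow_nonneg K.coe_nonneg _) hpq.symm.nonneg)
  constructor <;> linarith

/-- Each step of the semigroup adds one leg of a path, and `action_add_le` merges the legs; so `k`
short steps never go below one step of duration `k h`. -/
theorem le_hopfLax (hp : 1 ≤ p) (hh : 0 < h) {k : ℕ} (hk : 1 ≤ k) {y : E} {a : ℝ}
    (ha : ∀ x, a ≤ φ x + action p (k * h) (y - x)) : a ≤ hopfLax p h φ k y := by
  induction k, hk using Nat.le_induction generalizing y a with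
  | base =>
    refine le_ciInf fun z => ?_
    simpa [hopfLax] using ha (y - z)
  | succ k hk ih =>
    refine le_ciInf fun z => ?_
    rw [← sub_le_iff_le_add]
    refine ih fun x => ?_
    have hk0 : 0 < (k : ℝ) * h := mul_pos (by exact_mod_cast hk) hh
    have h1 := action_add_le hp hk0 hh (y - z - x) z
    have h2 := ha x
    have e : (((k + 1 : ℕ) : ℝ)) * h = k * h + h := by push_cast; ring
    have e' : y - z - x + z = y - x := by abel
    rw [e'] at h1
    rw [e] at h2
    linarith

end hopfLax

variable [InnerProductSpace ℝ E] [FiniteDimensional ℝ E] [MeasurableSpace E] [BorelSpace E]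

/-- Mollification by a normalized bump function. -/
noncomputable def mollify (ρ : ContDiffBump (0 : E)) (f : E → ℝ) (x : E) : ℝ :=
  ∫ z, ρ.normed Measure.addHaar z * f (x - z) ∂Measure.addHaar

section mollify

variable (ρ : ContDiffBump (0 : E)) {f g : E → ℝ}

theorem integrable_bump_mul {C : ℝ} (hf : Continuous f) (hC : ∀ x, |f x| ≤ C) (x : E) :
    Integrable (fun z => ρ.normed Measure.addHaar z * f (x - z)) Measure.addHaar :=
  ρ.integrable_normed.mul_bdd (c := C) (by fun_prop) (ae_of_all _ fun z => hC (x - z))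

theorem contDiff_mollify (hf : Continuous f) : ContDiff ℝ 1 (mollify ρ f) :=
  ρ.hasCompactSupport_normed.contDiff_convolution_left (ContinuousLinearMap.lsmul ℝ ℝ)
    (ρ.contDiff_normed (n := 1)) (hf.locallyIntegrable (μ := Measure.addHaar))

/-- Mollification averages translates, so a pointwise inequality with one displacement `b` for all
points survives. In the Hamilton-Jacobi estimate the velocity is therefore frozen before mollifying.
-/
theorem mollify_add_le {C C' : ℝ} (hf : Continuous f) (hC : ∀ x, |f x| ≤ C) (hg : Continuous g)
    (hC' : ∀ x, |g x| ≤ C') {a : ℝ} {b : E} (h : ∀ x, f (x + b) ≤ g x + a) (x : E) :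
    mollify ρ f (x + b) ≤ mollify ρ g x + a := by
  have h1 : mollify ρ g x + a =
      ∫ z, ρ.normed Measure.addHaar z * (g (x - z) + a) ∂Measure.addHaar := by
    simp_rw [mul_add]
    rw [integral_add (integrable_bump_mul ρ hg hC' x) (ρ.integrable_normed.mul_const a),
      integral_mul_const, ρ.integral_normed, one_mul]
    rfl
  rw [h1]
  refine integral_mono (integrable_bump_mul ρ hf hC _) ?_ fun z => ?_
  · simp_rw [mul_add]
    exact (integrable_bump_mul ρ hg hC' x).add (ρ.integrable_normed.mul_const a)
  · refine mul_le_mul_of_nonneg_left ?_ (ρ.nonneg_normed z)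
    have := h (x - z)
    rwa [sub_add_eq_add_sub] at this

theorem mollify_comp_add (b x : E) :
    mollify ρ (fun y => f (y + b)) x = mollify ρ f (x + b) := by
  simp only [mollify, sub_add_eq_add_sub]

theorem lipschitzWith_mollify {C : ℝ} {K : ℝ≥0} (hK : LipschitzWith K f) (hC : ∀ x, |f x| ≤ C) :
    LipschitzWith K (mollify ρ f) := by
  refine LipschitzWith.of_le_add_mul K fun x y => ?_
  have := mollify_add_le ρ hK.continuous hC hK.continuous hC (a := K * dist x y) (b := x - y)
    (fun z => by
      have := hK.le_add_mul (z + (x - y)) z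
      rwa [dist_self_add_left, ← dist_eq_norm] at this) y
  rwa [add_sub_cancel] at this

theorem abs_mollify_sub_le {K : ℝ≥0} (hK : LipschitzWith K f) (x : E) :
    |mollify ρ f x - f x| ≤ K * ρ.rOut := by
  refine ρ.dist_normed_convolution_le (μ := Measure.addHaar) (g := f) (x₀ := x)
    hK.continuous.aestronglyMeasurable fun y hy => ?_
  exact (hK.dist_le_mul y x).trans
    (mul_le_mul_of_nonneg_left (Metric.mem_ball.1 hy).le K.coe_nonneg)

theorem abs_mollify_le {C : ℝ} (hf : Continuous f) (hC : ∀ x, |f x| ≤ C) (x : E) :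
    |mollify ρ f x| ≤ C := by
  have h0 : mollify ρ (fun _ => (0 : ℝ)) x = 0 := by simp [mollify]
  have hC0 : 0 ≤ C := (abs_nonneg _).trans (hC x)
  have h1 := mollify_add_le ρ hf hC (continuous_const (y := (0 : ℝ))) (C' := 0) (by simp)
    (a := C) (b := 0) (fun y => by simpa using le_of_abs_le (hC y)) x
  have h2 := mollify_add_le ρ (continuous_const (y := (0 : ℝ))) (C := 0) (by simp) hf hC
    (a := C) (b := 0) (fun y => by linarith [neg_le_of_abs_le (hC y)]) x
  rw [add_zero, h0] at h1
  rw [add_zero, h0] at h2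
  exact abs_le.2 ⟨by linarith, by linarith⟩

/-- The derivative falls on the kernel, so `B` is the `L¹` norm of its derivative and depends on
nothing else. The lemma trades a sup bound for a Lipschitz bound; it serves for translates of one
function, which controls second differences, and for consecutive time steps. -/
theorem exists_abs_mollify_sub_sub_le : ∃ B : ℝ, 0 ≤ B ∧ ∀ (f g : E → ℝ) (C C' M : ℝ),
    Continuous f → (∀ x, |f x| ≤ C) → Continuous g → (∀ x, |g x| ≤ C') →
    (∀ x, |f x - g x| ≤ M) → ∀ x y,
      |(mollify ρ f x - mollify ρ g x) - (mollify ρ f y - mollify ρ g y)| ≤ B * M * ‖x - y‖ := by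
  let B : ℝ := ∫ z, ‖fderiv ℝ (ρ.normed (Measure.addHaar : Measure E)) z‖ ∂Measure.addHaar
  have hcs : HasCompactSupport (fderiv ℝ (ρ.normed (Measure.addHaar : Measure E))) :=
    ρ.hasCompactSupport_normed.fderiv ℝ
  have hcd : Continuous (fderiv ℝ (ρ.normed (Measure.addHaar : Measure E))) :=
    (ρ.contDiff_normed (n := 1)).continuous_fderiv one_ne_zero
  refine ⟨B, integral_nonneg fun _ => norm_nonneg _, fun f g C C' M hf hC hg hC' hM x y => ?_⟩
  have hM0 : 0 ≤ M := (abs_nonneg _).trans (hM x)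
  let w : E → ℝ := fun x => mollify ρ f x - mollify ρ g x
  have hw : w = mollify ρ (fun x => f x - g x) := by
    ext x
    simp only [w, mollify, mul_sub]
    rw [integral_sub (integrable_bump_mul ρ hf hC x) (integrable_bump_mul ρ hg hC' x)]
  have hd : ∀ x, HasFDerivAt w ((convolution (fderiv ℝ (ρ.normed Measure.addHaar))
      (fun x => f x - g x) ((ContinuousLinearMap.lsmul ℝ ℝ : ℝ →L[ℝ] ℝ →L[ℝ] ℝ).precompL E)
      Measure.addHaar) x) x := fun x => by
    rw [hw]
    exact ρ.hasCompactSupport_normed.hasFDerivAt_convolution_left (𝕜 := ℝ)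
      (ContinuousLinearMap.lsmul ℝ ℝ : ℝ →L[ℝ] ℝ →L[ℝ] ℝ) (ρ.contDiff_normed (n := 1))
      ((hf.sub hg).locallyIntegrable (μ := Measure.addHaar)) x
  have hb : ∀ x, ‖(convolution (fderiv ℝ (ρ.normed Measure.addHaar))
      (fun x => f x - g x) ((ContinuousLinearMap.lsmul ℝ ℝ : ℝ →L[ℝ] ℝ →L[ℝ] ℝ).precompL E)
      Measure.addHaar) x‖ ≤ B * M := fun x => by
    rw [convolution_def, ← integral_mul_const]
    refine norm_integral_le_of_norm_le ((hcd.integrable_of_hasCompactSupport hcs).norm.mul_const M)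
      (ae_of_all _ fun z => ?_)
    refine ContinuousLinearMap.opNorm_le_bound _ (by positivity) fun v => ?_
    rw [ContinuousLinearMap.precompL_apply, ContinuousLinearMap.lsmul_apply, smul_eq_mul, norm_mul]
    have h1 := (fderiv ℝ (ρ.normed (Measure.addHaar : Measure E)) z).le_opNorm v
    have h2 : ‖f (x - z) - g (x - z)‖ ≤ M := hM _
    calc _ ≤ (‖fderiv ℝ (ρ.normed (Measure.addHaar : Measure E)) z‖ * ‖v‖) * M := by gcongr
      _ = _ := by ring
  exact convex_univ.norm_image_sub_le_of_norm_hasFDerivWithin_le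
    (fun x _ => (hd x).hasFDerivWithinAt) (fun x _ => hb x) (mem_univ y) (mem_univ x)

end mollify

/-- The mollified discrete Hopf-Lax evolution of a bounded Lipschitz function consists of smooth
approximate subsolutions of the Hamilton-Jacobi equation. -/
theorem exists_mollified_hopfLax {p q : ℝ} (hpq : p.HolderConjugate q) {φ : E → ℝ} {K : ℝ≥0}
    {C : ℝ} (hK : LipschitzWith K φ) (hC : ∀ x, |φ x| ≤ C) {ε : ℝ} (hε : 0 < ε) :
    ∃ M : ℝ, 0 ≤ M ∧ ∀ h : ℝ, 0 < h → ∃ u : ℕ → E → ℝ,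
      (∀ k, ContDiff ℝ 1 (u k)) ∧ (∀ k x, |u k x| ≤ C) ∧ (∀ k, LipschitzWith K (u k)) ∧
      (∀ k x, u (k + 1) x - u k x ≤ h * (-(‖gradient (u (k + 1)) x‖ ^ q / q) + M * h)) ∧
      (∀ k x y, |(u (k + 1) x - u k x) - (u (k + 1) y - u k y)| ≤ M * h * ‖x - y‖) ∧
      (∀ x, u 0 x ≤ φ x + K * ε) ∧
      (∀ ψ : E → ℝ, ∀ k : ℕ, 1 ≤ k → (∀ x y, ψ y - φ x ≤ action p (k * h) (y - x)) →
        ∀ y, ψ y - K * ε ≤ u k y) := by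
  have hp := hpq.pos
  have hq := hpq.symm.pos
  let ρ : ContDiffBump (0 : E) := ⟨ε / 2, ε, half_pos hε, half_lt_self hε⟩
  obtain ⟨B, hB0, hB⟩ := exists_abs_mollify_sub_sub_le ρ
  -- `M₁` is the Taylor error: `B K` is a Lipschitz constant of the derivative and `K^(q-1)` bounds
  -- the speed. `M₂` comes from the size `h K^q / q` of one time increment. Neither depends on `h`.
  let M₁ : ℝ := B * K * ((K : ℝ) ^ (q - 1)) ^ 2
  let M₂ : ℝ := B * ((K : ℝ) ^ q / q)
  have hM₁ : 0 ≤ M₁ := by positivity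
  have hM₂ : 0 ≤ M₂ := by positivity
  refine ⟨M₁ + M₂, by positivity, fun h hh => ⟨fun k => mollify ρ (hopfLax p h φ k), ?_⟩⟩
  have hb := abs_hopfLax_le hp hh hC
  have hl := lipschitzWith_hopfLax hp hh hC hK
  have hc := fun k => (hl k).continuous
  have hCD : ∀ k, ContDiff ℝ 1 (mollify ρ (hopfLax p h φ k)) := fun k => contDiff_mollify ρ (hc k)
  have hLm : ∀ k, LipschitzWith K (mollify ρ (hopfLax p h φ k)) := fun k =>
    lipschitzWith_mollify ρ (hl k) (hb k)
  refine ⟨hCD, fun k => abs_mollify_le ρ (hc k) (hb k), hLm, fun k x => ?_, fun k x y => ?_,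
    fun x => ?_, fun ψ k hk hψ y => ?_⟩
  · set u := mollify ρ (hopfLax p h φ (k + 1)) with hu
    set G := gradient u x with hG
    have hGK : ‖G‖ ≤ K := by
      rw [hG, gradient, LinearIsometryEquiv.norm_map]
      exact norm_fderiv_le_of_lipschitz ℝ (hLm (k + 1))
    -- This velocity maximizes `⟨G, w⟩ - ‖w‖^p / p`. It is used at the arrival point `x + h w`, so
    -- that the gradient in the final inequality is that of the new function `u`.
    let w : E := ‖G‖ ^ (q - 2) • G
    have hinner : inner ℝ G w = ‖G‖ ^ q := by
      rw [inner_smul_right, real_inner_self_eq_norm_sq]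
      rcases eq_or_ne G 0 with h0 | h0
      · simp [h0, Real.zero_rpow hq.ne']
      · rw [← Real.rpow_natCast ‖G‖ 2, ← Real.rpow_add (norm_pos_iff.2 h0)]
        norm_num
    have hnw : ‖w‖ = ‖G‖ ^ (q - 1) := by
      rw [norm_smul, Real.norm_of_nonneg (by positivity)]
      rcases eq_or_ne G 0 with h0 | h0
      · rw [h0, norm_zero, mul_zero, Real.zero_rpow hpq.symm.sub_one_ne_zero]
      · rw [← Real.rpow_add_one (norm_ne_zero_iff.2 h0)]
        congr 1; ring
    have hact : action p h (h • w) = h * (‖G‖ ^ q / p) := by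
      rw [action, norm_smul, Real.norm_of_nonneg hh.le, mul_div_cancel_left₀ _ hh.ne', hnw,
        ← Real.rpow_mul (norm_nonneg _), hpq.symm.sub_one_mul_conj]
    have h1 : u (x + h • w) ≤ mollify ρ (hopfLax p h φ k) x + action p h (h • w) :=
      mollify_add_le ρ (hc _) (hb _) (hc _) (hb _)
        (fun x => hopfLax_succ_add_le hp hh hC k x _) x
    have hdiff : ∀ z, DifferentiableAt ℝ u z := fun z =>
      (hCD (k + 1)).differentiable one_ne_zero z
    -- Translating a `K`-Lipschitz function by `a` changes it by at most `K ‖a‖`, and mollification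
    -- turns this into a bound on the change of the derivative.
    have hlipd : ∀ a, ‖fderiv ℝ u (x + a) - fderiv ℝ u x‖ ≤ B * K * ‖a‖ := by
      intro a
      have hd : HasFDerivAt (fun z => u (z + a) - u z) (fderiv ℝ u (x + a) - fderiv ℝ u x) x :=
        ((hasFDerivAt_comp_add_right a).2 (hdiff (x + a)).hasFDerivAt).sub (hdiff x).hasFDerivAt
      refine hd.le_of_lip' (by positivity) (Eventually.of_forall fun z => ?_)
      have := hB (fun z => hopfLax p h φ (k + 1) (z + a)) (hopfLax p h φ (k + 1)) C C (K * ‖a‖)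
        ((hc _).comp (continuous_id.add continuous_const)) (fun z => hb _ _) (hc _) (hb _)
        (fun z => by
          have := (hl (k + 1)).dist_le_mul (z + a) z
          rwa [dist_self_add_left] at this) z x
      rw [mollify_comp_add, mollify_comp_add] at this
      rw [mul_assoc B]
      exact this
    have h2 : ‖u (x + h • w) - u x - fderiv ℝ u x (x + h • w - x)‖ ≤
        B * K * ‖h • w‖ * ‖x + h • w - x‖ := by
      refine (convex_segment x (x + h • w)).norm_image_sub_le_of_norm_hasFDerivWithin_le'
        (fun z _ => (hdiff z).hasFDerivAt.hasFDerivWithinAt) (fun z hz => ?_)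
        (left_mem_segment ℝ _ _) (right_mem_segment ℝ _ _)
      rw [segment_eq_image'] at hz
      obtain ⟨θ, hθ, rfl⟩ := hz
      simp only
      refine (hlipd _).trans ?_
      rw [add_sub_cancel_left]
      gcongr
      rw [norm_smul θ, Real.norm_of_nonneg hθ.1]
      exact mul_le_of_le_one_left (norm_nonneg _) hθ.2
    have h3 : fderiv ℝ u x (x + h • w - x) = h * ‖G‖ ^ q := by
      rw [add_sub_cancel_left, map_smul, smul_eq_mul, ← hinner, hG, inner_gradient_left]
    rw [h3, add_sub_cancel_left, norm_smul, Real.norm_of_nonneg hh.le, hnw] at h2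
    have h4 : ‖G‖ ^ (q - 1) ≤ (K : ℝ) ^ (q - 1) :=
      Real.rpow_le_rpow (norm_nonneg _) hGK hpq.symm.sub_one_pos.le
    have h5 : B * K * (h * ‖G‖ ^ (q - 1)) * (h * ‖G‖ ^ (q - 1)) ≤ M₁ * h * h := by
      calc _ = B * K * (‖G‖ ^ (q - 1)) ^ 2 * h * h := by ring
        _ ≤ B * K * ((K : ℝ) ^ (q - 1)) ^ 2 * h * h := by gcongr
    have h6 := (neg_le_of_abs_le h2)
    rw [hact] at h1
    have h7 : ‖G‖ ^ q / p = ‖G‖ ^ q - ‖G‖ ^ q / q := by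
      have := hpq.inv_add_inv_eq_one
      rw [div_eq_mul_inv, div_eq_mul_inv]
      linear_combination ‖G‖ ^ q * this
    rw [h7] at h1
    have h8 : 0 ≤ M₂ * h * h := by positivity
    linarith
  · have := hB (hopfLax p h φ (k + 1)) (hopfLax p h φ k) C C (h * ((K : ℝ) ^ q / q)) (hc _) (hb _)
      (hc _) (hb _) (abs_hopfLax_succ_sub_le hpq hh hC hK k) x y
    refine this.trans (mul_le_mul_of_nonneg_right ?_ (norm_nonneg _))
    have e : B * (h * ((K : ℝ) ^ q / q)) = M₂ * h := by ring
    rw [e]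
    exact mul_le_mul_of_nonneg_right (le_add_of_nonneg_left hM₁) hh.le
  · have := le_of_abs_le (abs_mollify_sub_le ρ (hl 0) x)
    change mollify ρ φ x - φ x ≤ K * ε at this
    change mollify ρ φ x ≤ _
    linarith
  · have h1 := neg_le_of_abs_le (abs_mollify_sub_le ρ (hl k) y)
    have h2 : ψ y ≤ hopfLax p h φ k y := le_hopfLax hpq.lt.le hh hk fun x => by
      have := hψ x y
      linarith
    change -(K * ε) ≤ _ at h1
    linarith

end HopfLax

/-! ### Measurability in time of the curve. -/

section Curves

variable {d : ℕ} {μ : ℝ → Measure (EuclideanSpace ℝ (Fin d))}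

/-- The functions `1 - (1 - f)^k` increase to the indicator of the support. As polynomials in `f`
without constant term, they inherit its smoothness and vanish where it does. -/
theorem tendsto_integral_one_sub_pow {X : Type*} [MeasurableSpace X] (ν : Measure X)
    [IsFiniteMeasure ν] {f : X → ℝ} (hf : Measurable f) (h : ∀ x, f x ∈ Icc (0 : ℝ) 1) :
    Tendsto (fun k : ℕ => ENNReal.ofReal (∫ x, (1 - (1 - f x) ^ k) ∂ν)) atTop
      (𝓝 (ν (Function.support f))) := by
  have hms : MeasurableSet (Function.support f) := measurableSet_support hf
  have h1 := tendsto_integral_of_dominated_convergence (μ := ν)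
    (F := fun (k : ℕ) x => 1 - (1 - f x) ^ k) (f := (Function.support f).indicator 1) (fun _ => 1)
    (fun k => by fun_prop) (integrable_const _)
    (fun k => ae_of_all _ fun x => by
      have h1 : 0 ≤ (1 - f x) ^ k := pow_nonneg (by linarith [(h x).2]) k
      have h2 : (1 - f x) ^ k ≤ 1 := pow_le_one₀ (by linarith [(h x).2]) (by linarith [(h x).1])
      rw [Real.norm_eq_abs, abs_le]
      constructor <;> linarith)
    (ae_of_all _ fun x => by
      by_cases hx : f x = 0
      · simp [hx]
      · rw [indicator_of_mem (by exact hx), Pi.one_apply]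
        have := tendsto_pow_atTop_nhds_zero_of_lt_one (r := 1 - f x) (by linarith [(h x).2])
          (by linarith [lt_of_le_of_ne (h x).1 (Ne.symm hx)])
        simpa using this.const_sub 1)
  rw [integral_indicator_one hms] at h1
  have := ENNReal.tendsto_ofReal h1
  rwa [ofReal_measureReal] at this

/-- A curve of probability measures on `[0, 1]`, continuous against `C¹` compactly supported test
functions, is a measurable family of measures. -/
theorem measurable_projIcc_of_continuousOn
    (hμ : ∀ t ∈ Icc (0 : ℝ) 1, IsProbabilityMeasure (μ t))
    (hc : ∀ φ : EuclideanSpace ℝ (Fin d) → ℝ, ContDiff ℝ 1 φ → HasCompactSupport φ →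
      ContinuousOn (fun t => ∫ x, φ x ∂(μ t)) (Icc 0 1)) :
    Measurable fun t : ℝ => μ (projIcc 0 1 zero_le_one t : ℝ) := by
  have hprob : ∀ t : ℝ, IsProbabilityMeasure (μ (projIcc 0 1 zero_le_one t : ℝ)) :=
    fun t => hμ _ (projIcc 0 1 zero_le_one t).2
  refine Measurable.measure_of_isPiSystem_of_isProbabilityMeasure (S := {s | IsOpen s})
    BorelSpace.measurable_eq isPiSystem_isOpen fun U hU => ?_
  have hball : ∀ n : ℕ, Measurable fun t : ℝ =>
      μ (projIcc 0 1 zero_le_one t : ℝ) (U ∩ Metric.ball 0 n) := by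
    intro n
    have hUo : IsOpen U := hU
    -- Every open set is the support of a `C¹` function with values in `[0, 1]`; intersecting with
    -- balls makes the supports compact, so that these functions are admissible tests.
    obtain ⟨f, hf, hfc, hfr⟩ :=
      (hUo.inter (Metric.isOpen_ball (x := (0 : EuclideanSpace ℝ (Fin d))) (ε := n)))
        |>.exists_contDiff_support_eq (n := 1)
    have hfr' : ∀ x, f x ∈ Icc (0 : ℝ) 1 := fun x => hfr ⟨x, rfl⟩
    have hlim : ∀ t : ℝ, Tendsto (fun k : ℕ => ENNReal.ofReal (∫ x, (1 - (1 - f x) ^ k)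
        ∂(μ (projIcc 0 1 zero_le_one t : ℝ)))) atTop
        (𝓝 (μ (projIcc 0 1 zero_le_one t : ℝ) (U ∩ Metric.ball 0 n))) := fun t => by
      rw [← hf]
      exact tendsto_integral_one_sub_pow _ hfc.continuous.measurable hfr'
    refine measurable_of_tendsto_metrizable (fun k => ?_) (tendsto_pi_nhds.2 hlim)
    refine Measurable.ennreal_ofReal (Continuous.measurable ?_)
    refine (hc (fun x => 1 - (1 - f x) ^ k) ?_ ?_).comp_continuous
      (continuous_subtype_val.comp continuous_projIcc) fun t => (projIcc 0 1 zero_le_one t).2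
    · exact contDiff_const.sub ((contDiff_const.sub hfc).pow k)
    · refine HasCompactSupport.intro (isCompact_closedBall (0 : EuclideanSpace ℝ (Fin d)) (n : ℝ))
        fun x hx => ?_
      have : x ∉ Function.support f := by
        rw [hf]
        exact fun h => hx (Metric.ball_subset_closedBall h.2)
      simp [Function.notMem_support.1 this]
  have hUn : ∀ ν : Measure (EuclideanSpace ℝ (Fin d)),
      ν U = ⨆ n : ℕ, ν (U ∩ Metric.ball 0 n) := fun ν => by
    conv_lhs => rw [← inter_univ U, ← Metric.iUnion_ball_nat (0 : EuclideanSpace ℝ (Fin d)),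
      inter_iUnion]
    refine Monotone.measure_iUnion fun m n hmn => ?_
    exact inter_subset_inter_right _ (Metric.ball_subset_ball (by exact_mod_cast hmn))
  simp_rw [hUn]
  exact Measurable.iSup hball

variable {v : ℝ → EuclideanSpace ℝ (Fin d) → EuclideanSpace ℝ (Fin d)}

theorem continuousOn_integral_of_continuityEquation (hce : ContinuityEquation μ v)
    {φ : EuclideanSpace ℝ (Fin d) → ℝ} (hφ : ContDiff ℝ 1 φ) (hφc : HasCompactSupport φ) :
    ContinuousOn (fun t => ∫ x, φ x ∂(μ t)) (Icc 0 1) := by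
  obtain ⟨hi, he⟩ := hce φ hφ hφc
  have h1 := intervalIntegral.continuousOn_primitive_interval' hi left_mem_uIcc
  rw [uIcc_of_le zero_le_one] at h1
  refine ((continuousOn_const (c := ∫ x, φ x ∂(μ 0))).add h1).congr fun t ht => ?_
  rcases eq_or_lt_of_le ht.1 with rfl | h
  · simp
  · have := he 0 (left_mem_Icc.2 zero_le_one) t ht h
    simp only [Pi.add_apply]
    linarith

theorem measurable_integral_rpow_norm
    (hμ : Measurable fun t : ℝ => μ (projIcc 0 1 zero_le_one t : ℝ))
    (hprob : ∀ t ∈ Icc (0 : ℝ) 1, IsProbabilityMeasure (μ t))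
    (hv : Measurable (Function.uncurry v)) (p : ℝ) :
    Measurable fun t : ℝ => ∫⁻ x, ‖v t x‖ₑ ^ p ∂(μ (projIcc 0 1 zero_le_one t : ℝ)) := by
  let κ : ProbabilityTheory.Kernel ℝ (EuclideanSpace ℝ (Fin d)) := ⟨_, hμ⟩
  have : ProbabilityTheory.IsMarkovKernel κ := ⟨fun t => hprob _ (projIcc 0 1 zero_le_one t).2⟩
  exact Measurable.lintegral_kernel_prod_right (κ := κ)
    (f := fun t x => ‖v t x‖ₑ ^ p) (hv.enorm.pow_const p)

end Curves

/-! ### The continuity equation for bounded test functions without compact support. -/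

section BoundedTestFunctions

variable {d : ℕ} {μ : ℝ → Measure (EuclideanSpace ℝ (Fin d))}
  {v : ℝ → EuclideanSpace ℝ (Fin d) → EuclideanSpace ℝ (Fin d)} {C : ℝ}

theorem norm_integral_fderiv_le {u : EuclideanSpace ℝ (Fin d) → ℝ} {K : ℝ}
    {ν : Measure (EuclideanSpace ℝ (Fin d))} {w : EuclideanSpace ℝ (Fin d) → EuclideanSpace ℝ (Fin d)}
    (hw : Integrable w ν) (hC : ∫ x, ‖w x‖ ∂ν ≤ C) (hK0 : 0 ≤ K)
    (hK : ∀ x, ‖fderiv ℝ u x‖ ≤ K) :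
    ‖∫ x, fderiv ℝ u x (w x) ∂ν‖ ≤ K * C := by
  refine (norm_integral_le_of_norm_le (hw.norm.const_mul K) (ae_of_all _ fun x => ?_)).trans ?_
  · exact ((fderiv ℝ u x).le_opNorm _).trans
      (mul_le_mul_of_nonneg_right (hK x) (norm_nonneg _))
  · rw [integral_const_mul]
    exact mul_le_mul_of_nonneg_left hC hK0

theorem integrable_fderiv_apply {u : EuclideanSpace ℝ (Fin d) → ℝ} (hu : ContDiff ℝ 1 u) {K : ℝ}
    {ν : Measure (EuclideanSpace ℝ (Fin d))} {w : EuclideanSpace ℝ (Fin d) → EuclideanSpace ℝ (Fin d)}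
    (hw : Integrable w ν) (hK : ∀ x, ‖fderiv ℝ u x‖ ≤ K) :
    Integrable (fun x => fderiv ℝ u x (w x)) ν := by
  refine (hw.norm.const_mul K).mono' ?_ (ae_of_all _ fun x => ?_)
  · exact isBoundedBilinearMap_apply.continuous.comp_aestronglyMeasurable₂
      (hu.continuous_fderiv one_ne_zero).aestronglyMeasurable hw.aestronglyMeasurable
  · exact ((fderiv ℝ u x).le_opNorm _).trans
      (mul_le_mul_of_nonneg_right (hK x) (norm_nonneg _))

/-- The continuity equation, with an integrable velocity, holds for bounded `C¹` test functions with
bounded gradient. -/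
theorem ContinuityEquation.of_bounded (hce : ContinuityEquation μ v)
    (hprob : ∀ t ∈ Icc (0 : ℝ) 1, IsProbabilityMeasure (μ t))
    (hv : ∀ᵐ t ∂(volume.restrict (Icc (0 : ℝ) 1)), Integrable (v t) (μ t) ∧
      ∫ x, ‖v t x‖ ∂(μ t) ≤ C)
    {u : EuclideanSpace ℝ (Fin d) → ℝ} (hu : ContDiff ℝ 1 u) {C₀ K : ℝ} (hC₀ : ∀ x, |u x| ≤ C₀)
    (hK : ∀ x, ‖fderiv ℝ u x‖ ≤ K) :
    IntervalIntegrable (fun s => ∫ x, fderiv ℝ u x (v s x) ∂(μ s)) volume 0 1 ∧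
    ∀ t₁ ∈ Icc (0 : ℝ) 1, ∀ t₂ ∈ Icc (0 : ℝ) 1, t₁ ≤ t₂ →
      ∫ x, u x ∂(μ t₂) - ∫ x, u x ∂(μ t₁) =
        ∫ s in t₁..t₂, ∫ x, fderiv ℝ u x (v s x) ∂(μ s) := by
  have hC₀0 : 0 ≤ C₀ := (abs_nonneg _).trans (hC₀ 0)
  have hK0 : 0 ≤ K := (norm_nonneg _).trans (hK 0)
  let χ : ContDiffBump (0 : EuclideanSpace ℝ (Fin d)) := ⟨1, 2, one_pos, one_lt_two⟩
  have hχ1 : ContDiff ℝ 1 χ := χ.contDiff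
  obtain ⟨B, hB⟩ := (hχ1.continuous_fderiv one_ne_zero).bounded_above_of_compact_support
    (χ.hasCompactSupport.fderiv ℝ)
  have hB0 : 0 ≤ B := (norm_nonneg _).trans (hB 0)
  -- Cutoffs dilated by `n + 1`: their gradients tend to `0`, and since `a n ≤ 1` the gradients of
  -- the products keep the bound `C₀ B + K`, which with `‖v‖` gives the domination.
  let a : ℕ → ℝ := fun n => ((n : ℝ) + 1)⁻¹
  have ha0 : ∀ n, 0 < a n := fun n => by positivity
  have ha1 : ∀ n, a n ≤ 1 := fun n => inv_le_one_of_one_le₀ (by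
    have : (0 : ℝ) ≤ n := n.cast_nonneg
    linarith)
  have hat : Tendsto a atTop (𝓝 0) := by
    simpa [a, one_div] using tendsto_one_div_add_atTop_nhds_zero_nat (𝕜 := ℝ)
  let w : ℕ → EuclideanSpace ℝ (Fin d) → ℝ := fun n x => u x * χ (a n • x)
  have hχn : ∀ n, ContDiff ℝ 1 fun x => χ (a n • x) := fun n =>
    hχ1.comp (contDiff_const_smul (a n))
  have hw : ∀ n, ContDiff ℝ 1 (w n) := fun n => hu.mul (hχn n)
  have hwc : ∀ n, HasCompactSupport (w n) := fun n =>
    (χ.hasCompactSupport.comp_smul (ha0 n).ne').mul_left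
  have hdw : ∀ n x, fderiv ℝ (w n) x =
      u x • (a n • fderiv ℝ χ (a n • x)) + χ (a n • x) • fderiv ℝ u x := fun n x => by
    have h1 := (hu.differentiable one_ne_zero x).hasFDerivAt
    have h2 := ((hχ1.differentiable one_ne_zero (a n • x)).hasFDerivAt.comp x
      ((hasFDerivAt_id x).const_smul (a n)))
    rw [ContinuousLinearMap.comp_smul, ContinuousLinearMap.comp_id] at h2
    exact (h1.mul h2).fderiv
  have hχt : ∀ x, Tendsto (fun n => χ (a n • x)) atTop (𝓝 1) := fun x => by
    have h1 : Tendsto (fun n => a n • x) atTop (𝓝 0) := by simpa using hat.smul_const x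
    have h2 := (χ.continuous.tendsto 0).comp h1
    rwa [χ.one_of_mem_closedBall (by simp [χ])] at h2
  have hdbd : ∀ n x, ‖fderiv ℝ (w n) x‖ ≤ C₀ * B + K := fun n x => by
    rw [hdw]
    refine (norm_add_le _ _).trans (add_le_add ?_ ?_)
    · rw [norm_smul, norm_smul, Real.norm_eq_abs, Real.norm_of_nonneg (ha0 n).le]
      refine mul_le_mul (hC₀ x) ?_ (by positivity) hC₀0
      exact (mul_le_of_le_one_left (norm_nonneg _) (ha1 n)).trans (hB _)
    · rw [norm_smul, Real.norm_of_nonneg χ.nonneg]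
      exact (mul_le_of_le_one_left (norm_nonneg _) χ.le_one).trans (hK x)
  have hdt : ∀ x, Tendsto (fun n => fderiv ℝ (w n) x) atTop (𝓝 (fderiv ℝ u x)) := fun x => by
    simp_rw [hdw]
    have h1 : Tendsto (fun n => u x • (a n • fderiv ℝ χ (a n • x))) atTop (𝓝 0) := by
      have h2 : Tendsto (fun n => a n • fderiv ℝ χ (a n • x)) atTop (𝓝 0) :=
        squeeze_zero_norm (a := fun n => a n * B) (fun n => by
          rw [norm_smul, Real.norm_of_nonneg (ha0 n).le]
          exact mul_le_mul_of_nonneg_left (hB _) (ha0 n).le) (by simpa using hat.mul_const B)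
      simpa using h2.const_smul (u x)
    simpa using h1.add ((hχt x).smul_const (fderiv ℝ u x))
  let F : ℕ → ℝ → ℝ := fun n s => ∫ x, fderiv ℝ (w n) x (v s x) ∂(μ s)
  let G : ℝ → ℝ := fun s => ∫ x, fderiv ℝ u x (v s x) ∂(μ s)
  have hce' : ∀ n, IntervalIntegrable (F n) volume 0 1 ∧
      ∀ t₁ ∈ Icc (0 : ℝ) 1, ∀ t₂ ∈ Icc (0 : ℝ) 1, t₁ < t₂ →
      ∫ x, w n x ∂(μ t₂) - ∫ x, w n x ∂(μ t₁) = ∫ s in t₁..t₂, F n s := fun n => by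
    have := hce (w n) (hw n) (hwc n)
    simpa only [inner_gradient_left] using this
  have hFt : ∀ᵐ s ∂(volume.restrict (Icc (0 : ℝ) 1)), Tendsto (fun n => F n s) atTop
      (𝓝 (G s)) := by
    filter_upwards [hv] with s hs
    refine tendsto_integral_of_dominated_convergence (fun x => (C₀ * B + K) * ‖v s x‖)
      (fun n => (integrable_fderiv_apply (hw n) hs.1 (hdbd n)).aestronglyMeasurable)
      (hs.1.norm.const_mul _) (fun n => ae_of_all _ fun x => ?_) (ae_of_all _ fun x => ?_)
    · exact ((fderiv ℝ (w n) x).le_opNorm _).trans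
        (mul_le_mul_of_nonneg_right (hdbd n x) (norm_nonneg _))
    · exact ((ContinuousLinearMap.apply ℝ ℝ (v s x)).continuous.tendsto _).comp (hdt x)
  have hFb : ∀ n, ∀ᵐ s ∂(volume.restrict (Icc (0 : ℝ) 1)), ‖F n s‖ ≤ (C₀ * B + K) * C := fun n => by
    filter_upwards [hv] with s hs
    exact norm_integral_fderiv_le hs.1 hs.2 (by positivity) (hdbd n)
  have hFm : ∀ n, AEStronglyMeasurable (F n) (volume.restrict (Icc (0 : ℝ) 1)) := fun n => by
    have := (hce' n).1
    rw [intervalIntegrable_iff_integrableOn_Icc_of_le zero_le_one] at this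
    exact this.aestronglyMeasurable
  have hG : IntervalIntegrable G volume 0 1 := by
    rw [intervalIntegrable_iff_integrableOn_Icc_of_le zero_le_one]
    refine Integrable.of_bound (aestronglyMeasurable_of_tendsto_ae atTop hFm hFt) (K * C) ?_
    filter_upwards [hv] with s hs
    exact norm_integral_fderiv_le hs.1 hs.2 hK0 hK
  refine ⟨hG, fun t₁ ht₁ t₂ ht₂ hlt => ?_⟩
  rcases eq_or_lt_of_le hlt with rfl | hlt
  · simp
  have hsub : volume.restrict (uIoc t₁ t₂) ≤ volume.restrict (Icc (0 : ℝ) 1) := by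
    refine Measure.restrict_mono ?_ le_rfl
    rw [uIoc_of_le hlt.le]
    exact fun x hx => ⟨ht₁.1.trans hx.1.le, hx.2.trans ht₂.2⟩
  have h1 : Tendsto (fun n => ∫ s in t₁..t₂, F n s) atTop (𝓝 (∫ s in t₁..t₂, G s)) := by
    refine intervalIntegral.tendsto_integral_filter_of_dominated_convergence
      (fun _ => (C₀ * B + K) * C) (Eventually.of_forall fun n => (hFm n).mono_measure hsub)
      (Eventually.of_forall fun n => ?_) intervalIntegrable_const ?_
    · exact (ae_restrict_iff' measurableSet_uIoc).1 (ae_mono hsub (hFb n))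
    · exact (ae_restrict_iff' measurableSet_uIoc).1 (ae_mono hsub hFt)
  have h2 : ∀ t ∈ Icc (0 : ℝ) 1, Tendsto (fun n => ∫ x, w n x ∂(μ t)) atTop
      (𝓝 (∫ x, u x ∂(μ t))) := fun t ht => by
    have := hprob t ht
    refine tendsto_integral_of_dominated_convergence (fun _ => C₀)
      (fun n => (hw n).continuous.aestronglyMeasurable) (integrable_const _)
      (fun n => ae_of_all _ fun x => ?_) (ae_of_all _ fun x => ?_)
    · rw [norm_mul, Real.norm_of_nonneg χ.nonneg]
      exact (mul_le_of_le_one_right (norm_nonneg _) χ.le_one).trans (hC₀ x)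
    · simpa using (hχt x).const_mul (u x)
  refine tendsto_nhds_unique ((h2 t₂ ht₂).sub (h2 t₁ ht₁)) (h1.congr fun n => ?_)
  exact ((hce' n).2 t₁ ht₁ t₂ ht₂ hlt).symm

end BoundedTestFunctions

/-! ### The dual estimate of the distance by the action of the velocity. -/

section DualEstimate

variable {d : ℕ} {μ : ℝ → Measure (EuclideanSpace ℝ (Fin d))}
  {v : ℝ → EuclideanSpace ℝ (Fin d) → EuclideanSpace ℝ (Fin d)} {C p q : ℝ}

/-- Meant for the increment of the Hopf-Lax evolution over one step: its gradient has size `h`, so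
changing the time of the measure within that step costs only order `h²`. -/
theorem abs_integral_sub_le_of_continuityEquation (hce : ContinuityEquation μ v)
    (hprob : ∀ t ∈ Icc (0 : ℝ) 1, IsProbabilityMeasure (μ t))
    (hv : ∀ᵐ t ∂(volume.restrict (Icc (0 : ℝ) 1)), Integrable (v t) (μ t) ∧
      ∫ x, ‖v t x‖ ∂(μ t) ≤ C)
    {u : EuclideanSpace ℝ (Fin d) → ℝ} (hu : ContDiff ℝ 1 u) {C₀ K : ℝ} (hC₀ : ∀ x, |u x| ≤ C₀)
    (hK : ∀ x, ‖fderiv ℝ u x‖ ≤ K) {s t : ℝ} (hs : s ∈ Icc (0 : ℝ) 1) (ht : t ∈ Icc (0 : ℝ) 1)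
    (hst : s ≤ t) : |∫ x, u x ∂(μ t) - ∫ x, u x ∂(μ s)| ≤ K * C * (t - s) := by
  have hK0 : 0 ≤ K := (norm_nonneg _).trans (hK 0)
  rw [(hce.of_bounded hprob hv hu hC₀ hK).2 s hs t ht hst, ← Real.norm_eq_abs]
  refine (intervalIntegral.norm_integral_le_of_norm_le_const_ae (C := K * C) ?_).trans ?_
  · have h1 := (ae_restrict_iff' measurableSet_Icc).1 hv
    filter_upwards [h1] with r hr hr'
    rw [uIoc_of_le hst] at hr'
    have := hr ⟨hs.1.trans hr'.1.le, hr'.2.trans ht.2⟩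
    exact norm_integral_fderiv_le this.1 this.2 hK0 hK
  · rw [abs_of_nonneg (sub_nonneg.2 hst)]

theorem fderiv_apply_le (hpq : p.HolderConjugate q) (u : EuclideanSpace ℝ (Fin d) → ℝ)
    (x w : EuclideanSpace ℝ (Fin d)) :
    fderiv ℝ u x w ≤ ‖w‖ ^ p / p + ‖gradient u x‖ ^ q / q := by
  have h1 : fderiv ℝ u x w ≤ ‖w‖ * ‖gradient u x‖ := by
    rw [← inner_gradient_left, mul_comm]
    exact real_inner_le_norm _ _
  exact h1.trans (Real.young_inequality_of_nonneg (norm_nonneg _) (norm_nonneg _) hpq)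

/-- One time step of the comparison between a curve and an approximate subsolution of the
Hamilton-Jacobi equation. -/
theorem integral_step_le (hpq : p.HolderConjugate q) (hce : ContinuityEquation μ v)
    (hprob : ∀ t ∈ Icc (0 : ℝ) 1, IsProbabilityMeasure (μ t))
    (hv : ∀ᵐ t ∂(volume.restrict (Icc (0 : ℝ) 1)), Integrable (v t) (μ t) ∧
      ∫ x, ‖v t x‖ ∂(μ t) ≤ C)
    (hvp : ∀ᵐ t ∂(volume.restrict (Icc (0 : ℝ) 1)), Integrable (fun x => ‖v t x‖ ^ p) (μ t))
    (hV : IntervalIntegrable (fun t => ∫ x, ‖v t x‖ ^ p ∂(μ t)) volume 0 1)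
    {u₀ u₁ : EuclideanSpace ℝ (Fin d) → ℝ} (hu₀ : ContDiff ℝ 1 u₀) (hu₁ : ContDiff ℝ 1 u₁)
    {C₀ M h : ℝ} {K : ℝ≥0} (hM : 0 ≤ M) (hh : 0 < h)
    (hb₀ : ∀ x, |u₀ x| ≤ C₀) (hb₁ : ∀ x, |u₁ x| ≤ C₀) (hl₁ : LipschitzWith K u₁)
    (hHJ : ∀ x, u₁ x - u₀ x ≤ h * (-(‖gradient u₁ x‖ ^ q / q) + M * h))
    (hg : ∀ x y, |(u₁ x - u₀ x) - (u₁ y - u₀ y)| ≤ M * h * ‖x - y‖)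
    {s : ℝ} (hs : s ∈ Icc (0 : ℝ) 1) (hs' : s + h ∈ Icc (0 : ℝ) 1) :
    ∫ x, u₁ x ∂(μ (s + h)) - ∫ x, u₀ x ∂(μ s) ≤
      ∫ r in s..s + h, ((∫ x, ‖v r x‖ ^ p ∂(μ r)) / p + (1 + C) * M * h) := by
  have hle : s ≤ s + h := by linarith
  have hK₁ : ∀ x, ‖fderiv ℝ u₁ x‖ ≤ K := fun x => norm_fderiv_le_of_lipschitz ℝ hl₁
  have hgd : ContDiff ℝ 1 fun x => u₁ x - u₀ x := hu₁.sub hu₀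
  have hgb : ∀ x, |u₁ x - u₀ x| ≤ C₀ + C₀ := fun x =>
    (abs_sub _ _).trans (add_le_add (hb₁ x) (hb₀ x))
  have hgK : ∀ x, ‖fderiv ℝ (fun x => u₁ x - u₀ x) x‖ ≤ M * h := fun x => by
    refine (hgd.differentiable one_ne_zero x).hasFDerivAt.le_of_lip' (by positivity)
      (Eventually.of_forall fun y => hg y x)
  have hCE := hce.of_bounded hprob hv hu₁ hb₁ hK₁
  have hCEi : IntervalIntegrable (fun r => ∫ x, fderiv ℝ u₁ x (v r x) ∂(μ r)) volume s (s + h) :=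
    hCE.1.mono_set (by
      rw [uIcc_of_le hle, uIcc_of_le zero_le_one]
      exact Icc_subset_Icc hs.1 hs'.2)
  have hVi : IntervalIntegrable (fun t => ∫ x, ‖v t x‖ ^ p ∂(μ t)) volume s (s + h) :=
    hV.mono_set (by
      rw [uIcc_of_le hle, uIcc_of_le zero_le_one]
      exact Icc_subset_Icc hs.1 hs'.2)
  have hint : ∀ t ∈ Icc (0 : ℝ) 1, ∀ w : EuclideanSpace ℝ (Fin d) → ℝ, ContDiff ℝ 1 w →
      (∀ x, |w x| ≤ C₀) → Integrable w (μ t) := fun t ht w hw hw' => by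
    have := hprob t ht
    exact .of_bound hw.continuous.aestronglyMeasurable C₀ (ae_of_all _ hw')
  -- The step is split into transport of `u₁` along the curve and a change of function at the
  -- initial time, the latter spread evenly over `[s, s + h]`.
  have e1 : ∫ x, u₁ x ∂(μ (s + h)) - ∫ x, u₀ x ∂(μ s) =
      ∫ r in s..s + h, ((∫ x, fderiv ℝ u₁ x (v r x) ∂(μ r)) +
        h⁻¹ * ∫ x, (u₁ x - u₀ x) ∂(μ s)) := by
    rw [intervalIntegral.integral_add hCEi intervalIntegrable_const,
      ← hCE.2 s hs _ hs' hle, intervalIntegral.integral_const, add_sub_cancel_left, smul_eq_mul,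
      mul_inv_cancel_left₀ hh.ne', integral_sub (hint s hs _ hu₁ hb₁) (hint s hs _ hu₀ hb₀)]
    ring
  rw [e1]
  refine intervalIntegral.integral_mono_ae_restrict hle (hCEi.add intervalIntegrable_const)
    ((hVi.div_const p).add intervalIntegrable_const) ?_
  have hsub : Icc s (s + h) ⊆ Icc (0 : ℝ) 1 := Icc_subset_Icc hs.1 hs'.2
  filter_upwards [ae_restrict_of_ae_restrict_of_subset hsub hv,
    ae_restrict_of_ae_restrict_of_subset hsub hvp, ae_restrict_mem measurableSet_Icc]
    with r hr hrp hrI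
  have := hprob r (hsub hrI)
  have h1 := neg_le_of_abs_le
    (abs_integral_sub_le_of_continuityEquation hce hprob hv hgd hgb hgK hs (hsub hrI) hrI.1)
  have hC0 : 0 ≤ C := (integral_nonneg fun _ => norm_nonneg _).trans hr.2
  have h2 : M * h * C * (r - s) ≤ M * h * C * h := by
    have : r - s ≤ h := by linarith [hrI.2]
    gcongr
  -- At a common time `r`, the term `‖∇u₁‖^q / q` from Young's inequality is cancelled by the
  -- Hamilton-Jacobi inequality.
  have h3 : (∫ x, fderiv ℝ u₁ x (v r x) ∂(μ r)) + h⁻¹ * ∫ x, (u₁ x - u₀ x) ∂(μ r) ≤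
      (∫ x, ‖v r x‖ ^ p ∂(μ r)) / p + M * h := by
    have hi1 := integrable_fderiv_apply hu₁ hr.1 hK₁
    have hi2 : Integrable (fun x => h⁻¹ * (u₁ x - u₀ x)) (μ r) := ((hint r (hsub hrI) _ hu₁ hb₁).sub
      (hint r (hsub hrI) _ hu₀ hb₀)).const_mul h⁻¹
    have hi3 : Integrable (fun x => ‖v r x‖ ^ p / p + M * h) (μ r) := (hrp.div_const p).add (integrable_const (μ := μ r) (M * h))
    have := integral_mono (f := fun x => fderiv ℝ u₁ x (v r x) + h⁻¹ * (u₁ x - u₀ x))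
      (hi1.add hi2) hi3 fun x => by
      have h4 := fderiv_apply_le hpq u₁ x (v r x)
      have h5 : h⁻¹ * (u₁ x - u₀ x) ≤ -(‖gradient u₁ x‖ ^ q / q) + M * h :=
        (inv_mul_le_iff₀ hh).2 (hHJ x)
      simp only
      linarith
    rw [integral_add hi1 hi2, integral_const_mul, integral_add (hrp.div_const p)
      (integrable_const _), integral_div, integral_const, probReal_univ, one_smul] at this
    exact this
  have h6 : h⁻¹ * ∫ x, (u₁ x - u₀ x) ∂(μ s) ≤ h⁻¹ * ∫ x, (u₁ x - u₀ x) ∂(μ r) + M * h * C := by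
    have : ∫ x, (u₁ x - u₀ x) ∂(μ s) ≤ ∫ x, (u₁ x - u₀ x) ∂(μ r) + M * h * C * h := by linarith
    have := mul_le_mul_of_nonneg_left this (inv_nonneg.2 hh.le)
    rw [mul_add, mul_comm (M * h * C) h, inv_mul_cancel_left₀ hh.ne'] at this
    exact this
  linarith

/-- The dual form of the estimate of the Wasserstein distance by the action of a velocity. -/
theorem integral_sub_integral_le (hpq : p.HolderConjugate q) (hce : ContinuityEquation μ v)
    (hprob : ∀ t ∈ Icc (0 : ℝ) 1, IsProbabilityMeasure (μ t))
    (hv : ∀ᵐ t ∂(volume.restrict (Icc (0 : ℝ) 1)), Integrable (v t) (μ t) ∧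
      ∫ x, ‖v t x‖ ∂(μ t) ≤ C) (hC : 0 ≤ C)
    (hvp : ∀ᵐ t ∂(volume.restrict (Icc (0 : ℝ) 1)), Integrable (fun x => ‖v t x‖ ^ p) (μ t))
    (hV : IntervalIntegrable (fun t => ∫ x, ‖v t x‖ ^ p ∂(μ t)) volume 0 1)
    {φ ψ : EuclideanSpace ℝ (Fin d) → ℝ} (hφ : IsBoundedLipschitz φ) (hψ : IsBoundedLipschitz ψ)
    {s t : ℝ} (hs : s ∈ Icc (0 : ℝ) 1) (ht : t ∈ Icc (0 : ℝ) 1) (hst : s < t)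
    (hφψ : ∀ x y, ψ y - φ x ≤ action p (t - s) (y - x)) :
    ∫ x, ψ x ∂(μ t) - ∫ x, φ x ∂(μ s) ≤ (∫ r in s..t, ∫ x, ‖v r x‖ ^ p ∂(μ r)) / p := by
  obtain ⟨⟨K, hK⟩, C₀, hC₀⟩ := id hφ
  have := hprob s hs
  have := hprob t ht
  refine le_of_forall_pos_le_add fun δ hδ => ?_
  -- The mollification scale makes the errors at both ends at most `δ / 4`; `K + 1` covers `K = 0`.
  -- The constant `M` is fixed before the time step is chosen.
  obtain ⟨M, hM0, hM⟩ := exists_mollified_hopfLax hpq hK hC₀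
    (show 0 < δ / (4 * (K + 1)) by positivity)
  have hKδ : K * (δ / (4 * (K + 1))) ≤ δ / 4 := by
    calc (K : ℝ) * (δ / (4 * (K + 1))) ≤ (K + 1) * (δ / (4 * (K + 1))) := by
          gcongr
          linarith
      _ = δ / 4 := by field_simp
  -- The accumulated error is `(t - s) (1 + C) M h`, and `h ≤ 1 / n` since `t - s ≤ 1`; this `n`
  -- brings it below `δ / 2`.
  obtain ⟨n, hn⟩ := exists_nat_gt ((1 + C) * M / (δ / 2))
  have hn0 : 0 < (n : ℝ) := lt_of_le_of_lt (by positivity) hn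
  set h := (t - s) / n with hh_def
  have hτ : 0 < t - s := sub_pos.2 hst
  have hτ1 : t - s ≤ 1 := by linarith [hs.1, ht.2]
  have hh : 0 < h := div_pos hτ hn0
  have hnh : n * h = t - s := by rw [hh_def]; field_simp
  obtain ⟨u, hu1, hub, hul, hHJ, hg, hu0, hun⟩ := hM h hh
  have htk : ∀ k ≤ n, s + k * h ∈ Icc s t := fun k hk => by
    have : (k : ℝ) * h ≤ n * h := by gcongr
    have : 0 ≤ (k : ℝ) * h := by positivity
    constructor <;> linarith
  have hsub : Icc s t ⊆ Icc (0 : ℝ) 1 := Icc_subset_Icc hs.1 ht.2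
  have hVst : ∀ a ∈ Icc s t, ∀ b ∈ Icc s t,
      IntervalIntegrable (fun r => (∫ x, ‖v r x‖ ^ p ∂(μ r)) / p + (1 + C) * M * h) volume a b :=
    fun a ha b hb => ((hV.mono_set (by
      rw [uIcc_of_le zero_le_one]
      exact uIcc_subset_Icc (hsub ha) (hsub hb))).div_const p).add intervalIntegrable_const
  have main : ∀ k ≤ n, ∫ x, u k x ∂(μ (s + k * h)) - ∫ x, u 0 x ∂(μ s) ≤
      ∫ r in s..s + k * h, ((∫ x, ‖v r x‖ ^ p ∂(μ r)) / p + (1 + C) * M * h) := by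
    intro k
    induction k with
    | zero => intro _; simp
    | succ k ih =>
      intro hk
      have hk' : k ≤ n := (Nat.le_succ k).trans hk
      have e : s + ((k + 1 : ℕ) : ℝ) * h = s + k * h + h := by push_cast; ring
      have hk1 := htk (k + 1) hk
      rw [e] at hk1 ⊢
      have h1 := integral_step_le hpq hce hprob hv hvp hV (hu1 k) (hu1 (k + 1)) hM0 hh (hub k)
        (hub (k + 1)) (hul (k + 1)) (hHJ k) (hg k) (hsub (htk k hk')) (hsub hk1)
      have h2 := ih hk'
      rw [← intervalIntegral.integral_add_adjacent_intervals
        (hVst s (left_mem_Icc.2 hst.le) _ (htk k hk')) (hVst _ (htk k hk') _ hk1)]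
      linarith
  have hfin := main n le_rfl
  have e2 : s + n * h = t := by linarith
  rw [e2, intervalIntegral.integral_add (by
      simpa using (hV.mono_set (by
        rw [uIcc_of_le zero_le_one]; exact uIcc_subset_Icc hs ht)).div_const p)
    intervalIntegrable_const, intervalIntegral.integral_div, intervalIntegral.integral_const,
    smul_eq_mul] at hfin
  have hn1 : 1 ≤ n := by exact_mod_cast hn0
  have h3 : ∫ x, ψ x ∂(μ t) - δ / 4 ≤ ∫ x, u n x ∂(μ t) := by
    have hi : Integrable (u n) (μ t) :=
      .of_bound (hu1 n).continuous.aestronglyMeasurable C₀ (ae_of_all _ (hub n))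
    have := integral_mono ((hψ.integrable (μ t)).sub (integrable_const (δ / 4))) hi fun y => by
      have := hun ψ n hn1 (by rwa [hnh]) y
      simp only [Pi.sub_apply]
      linarith
    rw [integral_sub' (hψ.integrable (μ t)) (integrable_const _), integral_const, probReal_univ,
      one_smul] at this
    exact this
  have h4 : ∫ x, u 0 x ∂(μ s) ≤ ∫ x, φ x ∂(μ s) + δ / 4 := by
    have hi : Integrable (u 0) (μ s) :=
      .of_bound (hu1 0).continuous.aestronglyMeasurable C₀ (ae_of_all _ (hub 0))
    have := integral_mono hi ((hφ.integrable (μ s)).add (integrable_const (δ / 4))) fun y => by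
      have := hu0 y
      simp only [Pi.add_apply]
      linarith
    rw [integral_add' (hφ.integrable (μ s)) (integrable_const _), integral_const, probReal_univ,
      one_smul] at this
    exact this
  have h5 : (t - s) * ((1 + C) * M * h) ≤ δ / 2 := by
    have h6 : (1 + C) * M < n * (δ / 2) := by
      rwa [div_lt_iff₀ (by positivity)] at hn
    calc (t - s) * ((1 + C) * M * h) ≤ 1 * ((1 + C) * M * (1 / n)) := by
          have : h ≤ 1 / n := by rw [hh_def]; gcongr
          gcongr
      _ ≤ δ / 2 := by
          rw [one_mul, mul_one_div, div_le_iff₀ hn0]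
          linarith
  linarith

/-- The Wasserstein distance is bounded by the action of a velocity field. -/
theorem Wp_rpow_le_of_continuityEquation (hpq : p.HolderConjugate q) (hce : ContinuityEquation μ v)
    (hprob : ∀ t ∈ Icc (0 : ℝ) 1, IsProbabilityMeasure (μ t))
    (hv : ∀ᵐ t ∂(volume.restrict (Icc (0 : ℝ) 1)), Integrable (v t) (μ t) ∧
      ∫ x, ‖v t x‖ ∂(μ t) ≤ C) (hC : 0 ≤ C)
    (hvp : ∀ᵐ t ∂(volume.restrict (Icc (0 : ℝ) 1)), Integrable (fun x => ‖v t x‖ ^ p) (μ t))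
    (hV : IntervalIntegrable (fun t => ∫ x, ‖v t x‖ ^ p ∂(μ t)) volume 0 1)
    {s t : ℝ} (hs : s ∈ Icc (0 : ℝ) 1) (ht : t ∈ Icc (0 : ℝ) 1) (hst : s < t) :
    Wp p (μ s) (μ t) ^ p ≤
      ENNReal.ofReal ((t - s) ^ (p - 1) * ∫ r in s..t, ∫ x, ‖v r x‖ ^ p ∂(μ r)) := by
  have hp := hpq.pos
  have hτ : 0 < t - s := sub_pos.2 hst
  have := hprob s hs
  have := hprob t ht
  obtain ⟨γ, h1, h2, h3⟩ := exists_plan_of_dual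
    (c := fun z : EuclideanSpace ℝ (Fin d) × EuclideanSpace ℝ (Fin d) =>
      action p (t - s) (z.2 - z.1))
    ((continuous_action hp).comp (continuous_snd.sub continuous_fst))
    (fun z => action_nonneg hp hτ _) (μ s) (μ t) fun φ ψ hφ hψ h =>
      integral_sub_integral_le hpq hce hprob hv hC hvp hV hφ hψ hs ht hst h
  have h4 := ENNReal.rpow_le_rpow (Wp_le_of_mem_transportPlans hp ⟨h1, h2⟩) hp.le
  rw [← ENNReal.rpow_mul, one_div_mul_cancel hp.ne', ENNReal.rpow_one] at h4
  refine h4.trans ?_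
  -- The action differs from the cost `|x - y|^p` by a constant factor; its `p` cancels the `1 / p`
  -- of the dual bound and `(t - s)^(p-1)` remains.
  have e : ∀ z : EuclideanSpace ℝ (Fin d) × EuclideanSpace ℝ (Fin d), edist z.1 z.2 ^ p =
      ENNReal.ofReal (p * (t - s) ^ (p - 1)) * ENNReal.ofReal (action p (t - s) (z.2 - z.1)) := by
    intro z
    rw [← ENNReal.ofReal_mul (by positivity), edist_dist, ENNReal.ofReal_rpow_of_nonneg dist_nonneg
      hp.le]
    congr 1
    rw [dist_comm, dist_eq_norm, action, Real.div_rpow (norm_nonneg _) hτ.le,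
      Real.rpow_sub_one hτ.ne']
    field_simp
  simp_rw [e]
  rw [lintegral_const_mul' _ _ ENNReal.ofReal_ne_top]
  refine (mul_le_mul_right h3 _).trans ?_
  rw [← ENNReal.ofReal_mul (by positivity)]
  refine ENNReal.ofReal_le_ofReal (le_of_eq ?_)
  field_simp

end DualEstimate

/-! ### Metric derivatives in the Wasserstein space. -/

section LipschitzCurves

variable {d : ℕ} {Ω : Set (EuclideanSpace ℝ (Fin d))}
  {μ : ℝ → Measure (EuclideanSpace ℝ (Fin d))} {p : ℝ}

theorem lintegral_enorm_rpow_lt_top {ν σ : Measure (EuclideanSpace ℝ (Fin d))} (hp : 1 ≤ p)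
    (h : Wp p ν σ < ∞) (hν : ∫⁻ x, ‖x‖ₑ ^ p ∂ν < ∞) : ∫⁻ x, ‖x‖ₑ ^ p ∂σ < ∞ := by
  have hp0 : 0 < p := by linarith
  obtain ⟨γ, hγ, hlt⟩ := exists_transportPlan_lt hp0 h
  rw [ENNReal.top_rpow_of_pos hp0] at hlt
  rw [← hγ.1, lintegral_map (by fun_prop) measurable_fst] at hν
  rw [← hγ.2, lintegral_map (by fun_prop) measurable_snd]
  calc ∫⁻ z, ‖z.2‖ₑ ^ p ∂γ ≤ ∫⁻ z, 2 ^ (p - 1) * (‖z.1‖ₑ ^ p + edist z.1 z.2 ^ p) ∂γ := by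
        refine lintegral_mono fun z => ?_
        refine le_trans ?_ (ENNReal.rpow_add_le_mul_rpow_add_rpow _ _ hp)
        refine ENNReal.rpow_le_rpow ?_ hp0.le
        rw [← edist_zero_right, ← edist_zero_right, add_comm, edist_comm z.1 z.2]
        exact edist_triangle _ _ _
    _ = 2 ^ (p - 1) * (∫⁻ z, ‖z.1‖ₑ ^ p ∂γ + ∫⁻ z, edist z.1 z.2 ^ p ∂γ) := by
        rw [lintegral_const_mul _ (by fun_prop), lintegral_add_left (by fun_prop)]
    _ < ∞ := ENNReal.mul_lt_top (ENNReal.rpow_lt_top_of_nonneg (by linarith) (by simp))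
        (ENNReal.add_lt_top.2 ⟨hν, hlt⟩)

theorem IsLipschitzCurve.isProbabilityMeasure (h : IsLipschitzCurve p Ω μ) {t : ℝ}
    (ht : t ∈ Icc (0 : ℝ) 1) : IsProbabilityMeasure (μ t) := (h.1 t ht).1.1

theorem nhdsWithin_Icc_diff_le (t : ℝ) : 𝓝[Icc (0 : ℝ) 1 \ {t}] t ≤ 𝓝[≠] t :=
  nhdsWithin_mono t fun _ hx => hx.2

/-- A Lipschitz curve has a measurable metric derivative, bounded by its Lipschitz constant. -/
theorem IsLipschitzCurve.exists_hasMetricDerivAt (hp : 1 ≤ p) (h : IsLipschitzCurve p Ω μ) :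
    ∃ (m : ℝ → ℝ) (L : ℝ≥0), Measurable m ∧ (∀ t, 0 ≤ m t) ∧ (∀ t, m t ≤ L) ∧
      ∀ᵐ t ∂(volume.restrict (Icc (0 : ℝ) 1)), HasMetricDerivAt p μ t (m t).toNNReal := by
  have hp0 : 0 < p := by linarith
  obtain ⟨L, hL⟩ := h.2
  -- Clamping times to `[0, 1]` is 1-Lipschitz, so it extends the curve to the whole line with the
  -- same constant.
  let π : ℝ → ℝ := fun t => (projIcc 0 1 zero_le_one t : ℝ)
  have hπ : ∀ t, π t ∈ Icc (0 : ℝ) 1 := fun t => (projIcc 0 1 zero_le_one t).2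
  have hπI : ∀ t ∈ Icc (0 : ℝ) 1, π t = t := fun t ht => by
    simp only [π]; rw [projIcc_of_mem _ ht]
  have hfin : ∀ s t, Wp p (μ (π s)) (μ (π t)) ≠ ∞ := fun s t =>
    ((hL _ (hπ s) _ (hπ t)).trans_lt (ENNReal.mul_lt_top ENNReal.coe_lt_top (edist_lt_top _ _))).ne
  obtain ⟨m, hm1, hm2, hm3, hm4⟩ := exists_metric_derivative (K := L)
    (D := fun s t => (Wp p (μ (π s)) (μ (π t))).toReal) (fun s t => by rw [Wp_comm hp0])
    (fun r s t => by
      have := h.isProbabilityMeasure (hπ r)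
      have := h.isProbabilityMeasure (hπ s)
      rw [← ENNReal.toReal_add (hfin _ _) (hfin _ _)]
      exact ENNReal.toReal_mono (ENNReal.add_ne_top.2 ⟨hfin _ _, hfin _ _⟩) (Wp_triangle hp))
    (fun s t => by
      have h1 := ENNReal.toReal_mono (ENNReal.mul_ne_top ENNReal.coe_ne_top (edist_ne_top _ _))
        (hL _ (hπ s) _ (hπ t))
      rw [ENNReal.toReal_mul, ENNReal.coe_toReal, edist_dist, ENNReal.toReal_ofReal dist_nonneg]
        at h1
      refine h1.trans (mul_le_mul_of_nonneg_left ?_ L.coe_nonneg)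
      rw [Real.dist_eq]
      exact abs_projIcc_sub_projIcc zero_le_one)
  refine ⟨m, L, hm1, hm2, hm3, ?_⟩
  filter_upwards [ae_restrict_of_ae hm4, ae_restrict_mem measurableSet_Icc] with t ht htI
  have h1 := ENNReal.tendsto_ofReal (ht.mono_left (nhdsWithin_Icc_diff_le t))
  refine h1.congr' ?_
  filter_upwards [self_mem_nhdsWithin] with s hs
  have hst : 0 < |s - t| := abs_pos.2 (sub_ne_zero.2 hs.2)
  simp only [hπI s hs.1, hπI t htI]
  have := hfin s t
  rw [hπI s hs.1, hπI t htI] at this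
  rw [ENNReal.ofReal_div_of_pos hst, ENNReal.ofReal_toReal this, edist_dist, Real.dist_eq]

end LipschitzCurves

/-! ### The converse: bounded velocity fields give Lipschitz curves. -/

section BoundedVelocity

variable {d : ℕ} {Ω : Set (EuclideanSpace ℝ (Fin d))}
  {μ : ℝ → Measure (EuclideanSpace ℝ (Fin d))}
  {v : ℝ → EuclideanSpace ℝ (Fin d) → EuclideanSpace ℝ (Fin d)} {p : ℝ} {C : ℝ≥0}

theorem eLpNorm_ofReal_eq {ν : Measure (EuclideanSpace ℝ (Fin d))}
    {w : EuclideanSpace ℝ (Fin d) → EuclideanSpace ℝ (Fin d)} (hp : 0 < p)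
    (hw : MemLp w (ENNReal.ofReal p) ν) :
    eLpNorm w (ENNReal.ofReal p) ν = ENNReal.ofReal ((∫ x, ‖w x‖ ^ p ∂ν) ^ p⁻¹) := by
  rw [hw.eLpNorm_eq_integral_rpow_norm (by simpa using hp) ENNReal.ofReal_ne_top,
    ENNReal.toReal_ofReal hp.le]

theorem integrable_norm_rpow {ν : Measure (EuclideanSpace ℝ (Fin d))}
    {w : EuclideanSpace ℝ (Fin d) → EuclideanSpace ℝ (Fin d)} (hp : 0 < p)
    (hw : MemLp w (ENNReal.ofReal p) ν) : Integrable (fun x => ‖w x‖ ^ p) ν := by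
  have := hw.integrable_norm_rpow (by simpa using hp) ENNReal.ofReal_ne_top
  rwa [ENNReal.toReal_ofReal hp.le] at this

theorem integral_norm_rpow_le {ν : Measure (EuclideanSpace ℝ (Fin d))}
    {w : EuclideanSpace ℝ (Fin d) → EuclideanSpace ℝ (Fin d)} (hp : 0 < p)
    (hw : MemLp w (ENNReal.ofReal p) ν) (hC : eLpNorm w (ENNReal.ofReal p) ν ≤ C) :
    ∫ x, ‖w x‖ ^ p ∂ν ≤ (C : ℝ) ^ p := by
  have h0 : 0 ≤ ∫ x, ‖w x‖ ^ p ∂ν := integral_nonneg fun _ => by positivity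
  rw [eLpNorm_ofReal_eq hp hw, ← ENNReal.ofReal_coe_nnreal,
    ENNReal.ofReal_le_ofReal_iff C.coe_nonneg, Real.rpow_inv_le_iff_of_pos h0 C.coe_nonneg hp] at hC
  exact hC

theorem integral_norm_le {ν : Measure (EuclideanSpace ℝ (Fin d))} [IsProbabilityMeasure ν]
    {w : EuclideanSpace ℝ (Fin d) → EuclideanSpace ℝ (Fin d)} (hp : 1 ≤ p)
    (hw : MemLp w (ENNReal.ofReal p) ν) (hC : eLpNorm w (ENNReal.ofReal p) ν ≤ C) :
    Integrable w ν ∧ ∫ x, ‖w x‖ ∂ν ≤ C := by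
  have h1p : (1 : ℝ≥0∞) ≤ ENNReal.ofReal p := by simpa using ENNReal.ofReal_le_ofReal hp
  have hi : Integrable w ν := hw.integrable h1p
  refine ⟨hi, ?_⟩
  have h1 := (eLpNorm_le_eLpNorm_of_exponent_le h1p hw.1).trans hC
  rw [eLpNorm_one_eq_lintegral_enorm] at h1
  rw [integral_norm_eq_lintegral_enorm hw.1]
  exact ENNReal.toReal_le_of_le_ofReal C.coe_nonneg (by simpa using h1)

theorem intervalIntegrable_integral_norm_rpow (hp : 0 < p)
    (hprob : ∀ t ∈ Icc (0 : ℝ) 1, IsProbabilityMeasure (μ t)) (hv : IsVelocityField p μ v)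
    (hC : ∀ᵐ t ∂(volume.restrict (Icc (0 : ℝ) 1)), eLpNorm (v t) (ENNReal.ofReal p) (μ t) ≤ C) :
    IntervalIntegrable (fun t => ∫ x, ‖v t x‖ ^ p ∂(μ t)) volume 0 1 := by
  have hμ := measurable_projIcc_of_continuousOn hprob fun φ hφ hφc =>
    continuousOn_integral_of_continuityEquation hv.continuityEquation hφ hφc
  have hm := (measurable_integral_rpow_norm hμ hprob hv.measurable p).ennreal_toReal
  rw [intervalIntegrable_iff_integrableOn_Icc_of_le zero_le_one]
  refine Integrable.of_bound (C := (C : ℝ) ^ p) (hm.aestronglyMeasurable.congr ?_) ?_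
  · filter_upwards [ae_restrict_mem measurableSet_Icc] with t ht
    have hvt : Measurable (v t) := hv.measurable.comp measurable_prodMk_left
    rw [projIcc_of_mem _ ht, integral_eq_lintegral_of_nonneg_ae
      (ae_of_all _ fun x => by positivity)
      (hvt.norm.pow_const p).aestronglyMeasurable]
    congr 1
    refine lintegral_congr fun x => ?_
    rw [← ENNReal.ofReal_rpow_of_nonneg (norm_nonneg _) hp.le, ofReal_norm]
  · filter_upwards [hC, hv.memLp] with t ht hvt
    rw [Real.norm_of_nonneg (integral_nonneg fun _ => by positivity)]
    exact integral_norm_rpow_le hp hvt ht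

theorem Wp_rpow_le_of_isVelocityField (hp : 1 < p)
    (hprob : ∀ t ∈ Icc (0 : ℝ) 1, IsProbabilityMeasure (μ t)) (hv : IsVelocityField p μ v)
    (hC : ∀ᵐ t ∂(volume.restrict (Icc (0 : ℝ) 1)), eLpNorm (v t) (ENNReal.ofReal p) (μ t) ≤ C)
    {s t : ℝ} (hs : s ∈ Icc (0 : ℝ) 1) (ht : t ∈ Icc (0 : ℝ) 1) (hst : s < t) :
    Wp p (μ s) (μ t) ^ p ≤
      ENNReal.ofReal ((t - s) ^ (p - 1) * ∫ r in s..t, ∫ x, ‖v r x‖ ^ p ∂(μ r)) := by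
  have hp0 : 0 < p := by linarith
  refine Wp_rpow_le_of_continuityEquation (C := C) (.conjExponent hp) hv.continuityEquation hprob
    ?_ C.coe_nonneg ?_ (intervalIntegrable_integral_norm_rpow hp0 hprob hv hC) hs ht hst
  · filter_upwards [hC, hv.memLp, ae_restrict_mem measurableSet_Icc] with r hr hr' hrI
    have := hprob r hrI
    exact integral_norm_le hp.le hr' hr
  · filter_upwards [hv.memLp] with r hr
    exact integrable_norm_rpow hp0 hr

/-- A curve with a velocity field bounded in `L^p` is Lipschitz in the Wasserstein space. -/
theorem isLipschitzCurve_of_isVelocityField (hp : 1 < p)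
    (hμ : ∀ t ∈ Icc (0 : ℝ) 1, μ t ∈ probOn Ω) (h0 : μ 0 ∈ space p Ω) (hv : IsVelocityField p μ v)
    (hC : ∀ᵐ t ∂(volume.restrict (Icc (0 : ℝ) 1)), eLpNorm (v t) (ENNReal.ofReal p) (μ t) ≤ C) :
    IsLipschitzCurve p Ω μ := by
  have hp0 : 0 < p := by linarith
  have hprob : ∀ t ∈ Icc (0 : ℝ) 1, IsProbabilityMeasure (μ t) := fun t ht => (hμ t ht).1
  have hlt : ∀ s ∈ Icc (0 : ℝ) 1, ∀ t ∈ Icc (0 : ℝ) 1, s < t →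
      Wp p (μ s) (μ t) ≤ C * edist s t := by
    intro s hs t ht hst
    have hτ : 0 < t - s := sub_pos.2 hst
    have h1 := Wp_rpow_le_of_isVelocityField hp hprob hv hC hs ht hst
    rw [← ENNReal.rpow_le_rpow_iff hp0]
    refine h1.trans ?_
    have h2 : ∫ r in s..t, ∫ x, ‖v r x‖ ^ p ∂(μ r) ≤ ∫ r in s..t, (C : ℝ) ^ p := by
      refine intervalIntegral.integral_mono_ae_restrict hst.le
        ((intervalIntegrable_integral_norm_rpow hp0 hprob hv hC).mono_set ?_)
        intervalIntegrable_const ?_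
      · rw [uIcc_of_le zero_le_one]
        exact uIcc_subset_Icc hs ht
      · have hsub : Icc s t ⊆ Icc (0 : ℝ) 1 := Icc_subset_Icc hs.1 ht.2
        filter_upwards [ae_restrict_of_ae_restrict_of_subset hsub hC,
          ae_restrict_of_ae_restrict_of_subset hsub hv.memLp] with r hr hr'
        exact integral_norm_rpow_le hp0 hr' hr
    rw [intervalIntegral.integral_const, smul_eq_mul] at h2
    have e : (C * edist s t : ℝ≥0∞) ^ p = ENNReal.ofReal ((C * (t - s)) ^ p) := by
      rw [edist_comm, edist_dist, Real.dist_eq, abs_of_pos hτ, ← ENNReal.ofReal_coe_nnreal,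
        ← ENNReal.ofReal_mul C.coe_nonneg, ENNReal.ofReal_rpow_of_nonneg (by positivity) hp0.le]
    rw [e]
    refine ENNReal.ofReal_le_ofReal ((mul_le_mul_of_nonneg_left h2 (by positivity)).trans ?_)
    rw [Real.mul_rpow C.coe_nonneg hτ.le, Real.rpow_sub_one hτ.ne']
    refine le_of_eq ?_
    field_simp
  have hall : ∀ s ∈ Icc (0 : ℝ) 1, ∀ t ∈ Icc (0 : ℝ) 1, Wp p (μ s) (μ t) ≤ C * edist s t := by
    intro s hs t ht
    rcases lt_trichotomy s t with h | rfl | h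
    · exact hlt s hs t ht h
    · refine (Wp_le_of_mem_transportPlans hp0 (γ := (μ s).map fun x => (x, x)) ⟨?_, ?_⟩).trans ?_
      · rw [Measure.map_map measurable_fst (by fun_prop)]
        exact Measure.map_id
      · rw [Measure.map_map measurable_snd (by fun_prop)]
        exact Measure.map_id
      · rw [lintegral_map (by fun_prop) (by fun_prop)]
        simp [hp0]
    · rw [Wp_comm hp0, edist_comm]
      exact hlt t ht s hs h
  refine ⟨fun t ht => ⟨hμ t ht, ?_⟩, C, hall⟩
  refine lintegral_enorm_rpow_lt_top hp.le ?_ h0.2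
  exact (hall 0 (left_mem_Icc.2 zero_le_one) t ht).trans_lt
    (ENNReal.mul_lt_top ENNReal.coe_lt_top (edist_lt_top _ _))

/-- The metric derivative is at most the norm of the velocity, at almost every time. -/
theorem hasMetricDerivAt_le_eLpNorm (hp : 1 < p)
    (hprob : ∀ t ∈ Icc (0 : ℝ) 1, IsProbabilityMeasure (μ t)) (hv : IsVelocityField p μ v)
    (hC : ∀ᵐ t ∂(volume.restrict (Icc (0 : ℝ) 1)), eLpNorm (v t) (ENNReal.ofReal p) (μ t) ≤ C) :
    ∀ᵐ t ∂(volume.restrict (Icc (0 : ℝ) 1)), ∀ m : ℝ≥0, HasMetricDerivAt p μ t m →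
      (m : ℝ≥0∞) ≤ eLpNorm (v t) (ENNReal.ofReal p) (μ t) := by
  have hp0 : 0 < p := by linarith
  have hV := intervalIntegrable_integral_norm_rpow hp0 hprob hv hC
  have h1 : ∀ᵐ t : ℝ, t ≠ 1 := by simp [ae_iff, measure_singleton]
  filter_upwards [ae_restrict_of_ae hV.ae_hasDerivAt_integral, ae_restrict_of_ae h1, hv.memLp,
    ae_restrict_mem measurableSet_Icc] with t ht ht1 hvt htI m hm
  have htI' := htI
  rw [← uIcc_of_le zero_le_one] at htI'
  -- At a Lebesgue point of `r ↦ ∫ |v_r|^p dμ_r` with `t < 1`, right difference quotients suffice: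
  -- the estimate bounds `W_p / (s - t)` by the `p`-th root of the mean over `[t, s]`.
  have hd := (ht htI' 0 left_mem_uIcc).tendsto_slope.mono_left
    (nhdsWithin_mono t fun s (hs : s ∈ Ioi t) => ne_of_gt hs)
  have ht1' : t < 1 := lt_of_le_of_ne htI.2 ht1
  have hIoc : ∀ᶠ s in 𝓝[>] t, s ∈ Ioc t 1 := Ioc_mem_nhdsGT ht1'
  have hm' : Tendsto (fun s => Wp p (μ s) (μ t) / edist s t) (𝓝[>] t) (𝓝 (m : ℝ≥0∞)) := by
    refine hm.mono_left (nhdsWithin_le_iff.2 ?_)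
    filter_upwards [hIoc] with s hs
    exact ⟨⟨htI.1.trans hs.1.le, hs.2⟩, ne_of_gt hs.1⟩
  have hd' := ENNReal.tendsto_ofReal (hd.rpow_const (p := p⁻¹) (Or.inr (by positivity)))
  rw [eLpNorm_ofReal_eq hp0 hvt]
  refine le_of_tendsto_of_tendsto hm' hd' ?_
  filter_upwards [hIoc] with s hs
  have hsI : s ∈ Icc (0 : ℝ) 1 := ⟨htI.1.trans hs.1.le, hs.2⟩
  have hτ : 0 < s - t := sub_pos.2 hs.1
  have h2 := Wp_rpow_le_of_isVelocityField hp hprob hv hC htI hsI hs.1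
  have hsub : ∀ a ∈ Icc (0 : ℝ) 1, ∀ b ∈ Icc (0 : ℝ) 1,
      IntervalIntegrable (fun t => ∫ x, ‖v t x‖ ^ p ∂(μ t)) volume a b := fun a ha b hb =>
    hV.mono_set (by rw [uIcc_of_le zero_le_one]; exact uIcc_subset_Icc ha hb)
  have h0I : (0 : ℝ) ∈ Icc (0 : ℝ) 1 := left_mem_Icc.2 zero_le_one
  rw [slope_def_field, intervalIntegral.integral_interval_sub_left (hsub _ h0I _ hsI)
    (hsub _ h0I _ htI), edist_dist, Real.dist_eq, abs_of_pos hτ, ENNReal.div_le_iff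
    (by simpa using hs.1) ENNReal.ofReal_ne_top, ← ENNReal.ofReal_mul
    (Real.rpow_nonneg (div_nonneg (intervalIntegral.integral_nonneg hs.1.le fun _ _ =>
      integral_nonneg fun _ => by positivity) hτ.le) _), Wp_comm hp0,
    ← ENNReal.rpow_le_rpow_iff hp0]
  refine h2.trans ?_
  have hI0 : 0 ≤ ∫ r in t..s, ∫ x, ‖v r x‖ ^ p ∂(μ r) :=
    intervalIntegral.integral_nonneg hs.1.le fun _ _ => integral_nonneg fun _ => by positivity
  rw [ENNReal.ofReal_rpow_of_nonneg (by positivity) hp0.le,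
    Real.mul_rpow (by positivity) hτ.le, ← Real.rpow_mul (by positivity), inv_mul_cancel₀ hp0.ne',
    Real.rpow_one, Real.rpow_sub_one hτ.ne']
  refine ENNReal.ofReal_le_ofReal (le_of_eq ?_)
  field_simp

end BoundedVelocity

/-! ### Variation of test integrals along a Lipschitz curve. -/

section TestFunctions

variable {d : ℕ} {p q : ℝ} {ν σ : Measure (EuclideanSpace ℝ (Fin d))}

/-- Hölder's inequality on the plan, with `g` a bound for the slope of `φ` along each transported
pair. -/
theorem enorm_integral_sub_le (hpq : p.HolderConjugate q) {φ : EuclideanSpace ℝ (Fin d) → ℝ}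
    {γ : Measure (EuclideanSpace ℝ (Fin d) × EuclideanSpace ℝ (Fin d))}
    (hγ : γ ∈ transportPlans ν σ) (hν : Integrable φ ν) (hσ : Integrable φ σ)
    {g : EuclideanSpace ℝ (Fin d) × EuclideanSpace ℝ (Fin d) → ℝ≥0∞} (hg : Measurable g)
    (h : ∀ z, ‖φ z.2 - φ z.1‖ₑ ≤ g z * edist z.1 z.2) :
    ‖∫ x, φ x ∂σ - ∫ x, φ x ∂ν‖ₑ ≤
      (∫⁻ z, g z ^ q ∂γ) ^ (1 / q) * (∫⁻ z, edist z.1 z.2 ^ p ∂γ) ^ (1 / p) := by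
  have h1 : Integrable (fun z => φ z.1) γ := by
    rw [← hγ.1] at hν
    exact hν.comp_measurable measurable_fst
  have h2 : Integrable (fun z => φ z.2) γ := by
    rw [← hγ.2] at hσ
    exact hσ.comp_measurable measurable_snd
  have e1 : ∫ x, φ x ∂ν = ∫ z, φ z.1 ∂γ := by
    conv_lhs => rw [← hγ.1]
    rw [← hγ.1] at hν
    exact integral_map measurable_fst.aemeasurable hν.aestronglyMeasurable
  have e2 : ∫ x, φ x ∂σ = ∫ z, φ z.2 ∂γ := by
    conv_lhs => rw [← hγ.2]
    rw [← hγ.2] at hσ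
    exact integral_map measurable_snd.aemeasurable hσ.aestronglyMeasurable
  rw [e1, e2, ← integral_sub h2 h1]
  refine (enorm_integral_le_lintegral_enorm _).trans ((lintegral_mono h).trans ?_)
  exact ENNReal.lintegral_mul_le_Lp_mul_Lq γ hpq.symm hg.aemeasurable (by fun_prop)

theorem integrable_of_contDiff [IsFiniteMeasure ν] {φ : EuclideanSpace ℝ (Fin d) → ℝ}
    (hφ : ContDiff ℝ 1 φ) (hφc : HasCompactSupport φ) : Integrable φ ν :=
  hφ.continuous.integrable_of_hasCompactSupport hφc

theorem abs_integral_sub_le_of_Wp_lt (hpq : p.HolderConjugate q) [IsProbabilityMeasure ν]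
    [IsProbabilityMeasure σ] {φ : EuclideanSpace ℝ (Fin d) → ℝ} (hφ : ContDiff ℝ 1 φ)
    (hφc : HasCompactSupport φ) {A : ℝ≥0} (hA : LipschitzWith A φ) {W : ℝ}
    (hW : Wp p ν σ < ENNReal.ofReal W) : |∫ x, φ x ∂σ - ∫ x, φ x ∂ν| ≤ A * W := by
  have hW0 : 0 < W := ENNReal.ofReal_pos.1 (pos_of_gt hW)
  obtain ⟨γ, hγ, hlt⟩ := exists_transportPlan_lt hpq.pos hW
  have := isProbabilityMeasure_of_mem_transportPlans hγ
  have h1 := enorm_integral_sub_le hpq hγ (integrable_of_contDiff hφ hφc)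
    (integrable_of_contDiff hφ hφc) (g := fun _ => A) measurable_const fun z => by
      rw [← edist_eq_enorm_sub, edist_comm z.1]
      exact hA z.2 z.1
  rw [lintegral_const, measure_univ, mul_one, ← ENNReal.rpow_mul,
    mul_one_div_cancel hpq.symm.pos.ne', ENNReal.rpow_one] at h1
  have h2 : (∫⁻ z, edist z.1 z.2 ^ p ∂γ) ^ (1 / p) ≤ ENNReal.ofReal W := by
    rw [one_div, ENNReal.rpow_inv_le_iff hpq.pos]
    exact hlt.le
  have h3 := h1.trans (mul_le_mul_right h2 _)
  rwa [← ENNReal.ofReal_coe_nnreal, ← ENNReal.ofReal_mul A.coe_nonneg, Real.enorm_eq_ofReal_abs,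
    ENNReal.ofReal_le_ofReal_iff (by positivity)] at h3

/-- Quantitative form of the first order bound of the variation of the integral of a test
function. -/
theorem abs_integral_sub_le_gradient (hpq : p.HolderConjugate q) [IsProbabilityMeasure ν]
    [IsProbabilityMeasure σ] {φ : EuclideanSpace ℝ (Fin d) → ℝ} (hφ : ContDiff ℝ 1 φ)
    (hφc : HasCompactSupport φ) {A : ℝ≥0} (hA : LipschitzWith A φ) {ε δ : ℝ} (hε : 0 ≤ ε)
    (hδ : 0 < δ)
    (hmod : ∀ x y, dist x y < δ → |φ y - φ x| ≤ (‖gradient φ x‖ + ε) * dist x y) {W : ℝ}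
    (hW : Wp p ν σ < ENNReal.ofReal W) :
    ENNReal.ofReal |∫ x, φ x ∂σ - ∫ x, φ x ∂ν| ≤
      ((∫⁻ x, ‖gradient φ x‖ₑ ^ q ∂ν) ^ (1 / q) + ENNReal.ofReal (ε + A * (W / δ) ^ (p / q))) *
        ENNReal.ofReal W := by
  have hp := hpq.pos
  have hq := hpq.symm.pos
  have hq1 : 1 ≤ q := hpq.symm.lt.le
  have hW0 : 0 < W := ENNReal.ofReal_pos.1 (pos_of_gt hW)
  obtain ⟨γ, hγ, hlt⟩ := exists_transportPlan_lt hp hW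
  have := isProbabilityMeasure_of_mem_transportPlans hγ
  have hgm : Measurable fun x => ‖gradient φ x‖ₑ := by
    have h1 : Continuous fun x => gradient φ x :=
      (InnerProductSpace.toDual ℝ (EuclideanSpace ℝ (Fin d))).symm.continuous.comp
        (hφ.continuous_fderiv one_ne_zero)
    exact h1.measurable.enorm
  -- The slope is at most `‖∇φ‖ + ε` on near pairs and `A` on far ones. The gradient sits at the
  -- first point, so its norm is taken for `ν` alone and no continuity of the curve is needed.
  let S : Set (EuclideanSpace ℝ (Fin d) × EuclideanSpace ℝ (Fin d)) :=
    {z | ENNReal.ofReal δ ≤ edist z.1 z.2}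
  have hS : MeasurableSet S := measurableSet_le measurable_const (by fun_prop)
  let g₁ : EuclideanSpace ℝ (Fin d) × EuclideanSpace ℝ (Fin d) → ℝ≥0∞ := fun z => ‖gradient φ z.1‖ₑ
  let g₂ : EuclideanSpace ℝ (Fin d) × EuclideanSpace ℝ (Fin d) → ℝ≥0∞ := fun _ => ENNReal.ofReal ε
  let g₃ : EuclideanSpace ℝ (Fin d) × EuclideanSpace ℝ (Fin d) → ℝ≥0∞ :=
    S.indicator fun _ => (A : ℝ≥0∞)
  have hg₁ : Measurable g₁ := hgm.comp measurable_fst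
  have hg₂ : Measurable g₂ := measurable_const
  have hg₃ : Measurable g₃ := measurable_const.indicator hS
  have h1 := enorm_integral_sub_le hpq hγ (integrable_of_contDiff hφ hφc)
    (integrable_of_contDiff hφ hφc) (g := g₁ + (g₂ + g₃)) (hg₁.add (hg₂.add hg₃)) fun z => by
      by_cases hz : z ∈ S
      · rw [← edist_eq_enorm_sub]
        refine (hA z.2 z.1).trans ?_
        rw [edist_comm z.2]
        refine mul_le_mul_left ?_ _
        simp only [Pi.add_apply, g₃, indicator_of_mem hz]
        exact le_add_left (le_add_left le_rfl)
      · have hz' : dist z.1 z.2 < δ := by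
          simp only [S, mem_ofPred_eq, not_le, edist_dist] at hz
          exact (ENNReal.ofReal_lt_ofReal_iff hδ).1 hz
        have h2 := ENNReal.ofReal_le_ofReal (hmod z.1 z.2 hz')
        rw [← Real.enorm_eq_ofReal_abs, ENNReal.ofReal_mul (by positivity), ← edist_dist,
          ENNReal.ofReal_add (norm_nonneg _) hε, ofReal_norm] at h2
        simpa only [Pi.add_apply, g₁, g₂, g₃, indicator_of_notMem hz, add_zero] using h2
  have hb1 : (∫⁻ z, g₁ z ^ q ∂γ) ^ (1 / q) = (∫⁻ x, ‖gradient φ x‖ₑ ^ q ∂ν) ^ (1 / q) := by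
    rw [← hγ.1, lintegral_map (hgm.pow_const q) measurable_fst]
  have hb2 : (∫⁻ z, g₂ z ^ q ∂γ) ^ (1 / q) = ENNReal.ofReal ε := by
    simp only [g₂]
    rw [lintegral_const, measure_univ, mul_one, ← ENNReal.rpow_mul, mul_one_div_cancel hq.ne',
      ENNReal.rpow_one]
  -- Markov's inequality. Far pairs thus contribute `A (W / δ)^(p/q)`, which vanishes with `W`.
  have hγS : γ S ≤ ENNReal.ofReal ((W / δ) ^ p) := by
    have h2 := mul_meas_ge_le_lintegral (μ := γ)
      (f := fun z : EuclideanSpace ℝ (Fin d) × EuclideanSpace ℝ (Fin d) => edist z.1 z.2 ^ p)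
      (by fun_prop) (ENNReal.ofReal δ ^ p)
    have h3 : {z : EuclideanSpace ℝ (Fin d) × EuclideanSpace ℝ (Fin d) |
        ENNReal.ofReal δ ^ p ≤ edist z.1 z.2 ^ p} = S := by
      ext z
      exact ENNReal.rpow_le_rpow_iff hp
    rw [h3] at h2
    have h4 := h2.trans hlt.le
    rw [ENNReal.ofReal_rpow_of_pos hδ, ENNReal.ofReal_rpow_of_pos hW0] at h4
    rw [Real.div_rpow hW0.le hδ.le, ENNReal.ofReal_div_of_pos (by positivity)]
    rw [ENNReal.le_div_iff_mul_le (Or.inl (by simpa using Real.rpow_pos_of_pos hδ p))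
      (Or.inl ENNReal.ofReal_ne_top), mul_comm]
    exact h4
  have hb3 : (∫⁻ z, g₃ z ^ q ∂γ) ^ (1 / q) ≤ ENNReal.ofReal (A * (W / δ) ^ (p / q)) := by
    have e : ∀ z, g₃ z ^ q = S.indicator (fun _ => (A : ℝ≥0∞) ^ q) z := fun z => by
      by_cases hz : z ∈ S
      · simp [g₃, hz]
      · simp [g₃, hz, hq]
    simp_rw [e]
    rw [lintegral_indicator_const hS, ENNReal.mul_rpow_of_nonneg _ _ (by positivity),
      ← ENNReal.rpow_mul, mul_one_div_cancel hq.ne', ENNReal.rpow_one,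
      ENNReal.ofReal_mul A.coe_nonneg, ENNReal.ofReal_coe_nnreal]
    refine mul_le_mul_right ?_ _
    refine (ENNReal.rpow_le_rpow hγS (by positivity)).trans (le_of_eq ?_)
    rw [ENNReal.ofReal_rpow_of_nonneg (by positivity) (by positivity),
      ← Real.rpow_mul (by positivity), mul_one_div]
  have h5 : (∫⁻ z, (g₁ + (g₂ + g₃)) z ^ q ∂γ) ^ (1 / q) ≤
      (∫⁻ x, ‖gradient φ x‖ₑ ^ q ∂ν) ^ (1 / q) + ENNReal.ofReal (ε + A * (W / δ) ^ (p / q)) := by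
    refine (ENNReal.lintegral_Lp_add_le hg₁.aemeasurable (hg₂.add hg₃).aemeasurable hq1).trans ?_
    rw [hb1]
    refine add_le_add le_rfl ?_
    refine (ENNReal.lintegral_Lp_add_le hg₂.aemeasurable hg₃.aemeasurable hq1).trans ?_
    rw [hb2, ENNReal.ofReal_add hε (by positivity)]
    exact add_le_add le_rfl hb3
  have h6 : (∫⁻ z, edist z.1 z.2 ^ p ∂γ) ^ (1 / p) ≤ ENNReal.ofReal W := by
    rw [one_div, ENNReal.rpow_inv_le_iff hp]
    exact hlt.le
  rw [← Real.enorm_eq_ofReal_abs]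
  exact h1.trans (mul_le_mul' h5 h6)

/-- The derivative of `φ` is uniformly continuous by compact support; the mean value inequality on
the ball around `x` gives a modulus independent of `x`. -/
theorem exists_gradient_modulus {φ : EuclideanSpace ℝ (Fin d) → ℝ} (hφ : ContDiff ℝ 1 φ)
    (hφc : HasCompactSupport φ) {ε : ℝ} (hε : 0 < ε) :
    ∃ δ > 0, ∀ x y, dist x y < δ → |φ y - φ x| ≤ (‖gradient φ x‖ + ε) * dist x y := by
  have huc : UniformContinuous (fderiv ℝ φ) :=
    (hφ.continuous_fderiv one_ne_zero).uniformContinuous_of_tendsto_cocompact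
      (hφc.fderiv ℝ).is_zero_at_infty
  obtain ⟨δ, hδ, h⟩ := Metric.uniformContinuous_iff.1 huc ε hε
  refine ⟨δ, hδ, fun x y hxy => ?_⟩
  have hn : ‖gradient φ x‖ = ‖fderiv ℝ φ x‖ := by rw [gradient, LinearIsometryEquiv.norm_map]
  rw [hn, dist_comm, dist_eq_norm, ← Real.norm_eq_abs]
  refine (convex_ball x δ).norm_image_sub_le_of_norm_fderiv_le
    (fun z _ => hφ.differentiable one_ne_zero z) (fun z hz => ?_) (Metric.mem_ball_self hδ)
    (Metric.mem_ball'.2 hxy)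
  have h1 : ‖fderiv ℝ φ z - fderiv ℝ φ x‖ < ε := by
    rw [← dist_eq_norm]
    exact h (Metric.mem_ball.1 hz)
  calc ‖fderiv ℝ φ z‖ = ‖fderiv ℝ φ x + (fderiv ℝ φ z - fderiv ℝ φ x)‖ := by
        rw [add_sub_cancel]
    _ ≤ ‖fderiv ℝ φ x‖ + ε := (norm_add_le _ _).trans (by linarith)

/-- At a point of metric differentiability, the derivative of the integral of a test function is
bounded by the metric derivative times the norm of the gradient. -/
theorem abs_deriv_integral_le {Ω : Set (EuclideanSpace ℝ (Fin d))}
    {μ : ℝ → Measure (EuclideanSpace ℝ (Fin d))} (hpq : p.HolderConjugate q)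
    (hμ : IsLipschitzCurve p Ω μ) {φ : EuclideanSpace ℝ (Fin d) → ℝ} (hφ : ContDiff ℝ 1 φ)
    (hφc : HasCompactSupport φ) {t : ℝ} (ht : t ∈ Ico (0 : ℝ) 1) {m : ℝ≥0}
    (hm : HasMetricDerivAt p μ t m) {f : ℝ → ℝ} {f' : ℝ} (hf : HasDerivAt f f' t)
    (hfφ : ∀ s ∈ Icc (0 : ℝ) 1, f s = ∫ x, φ x ∂(μ s)) :
    ENNReal.ofReal |f'| ≤ m * (∫⁻ x, ‖gradient φ x‖ₑ ^ q ∂(μ t)) ^ (1 / q) := by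
  have htI : t ∈ Icc (0 : ℝ) 1 := ⟨ht.1, ht.2.le⟩
  have hpt := hμ.isProbabilityMeasure htI
  obtain ⟨A, hA⟩ := hφ.lipschitzWith_of_hasCompactSupport hφc one_ne_zero
  set G := (∫⁻ x, ‖gradient φ x‖ₑ ^ q ∂(μ t)) ^ (1 / q) with hG
  have hGA : G ≤ A := by
    have hq := hpq.symm.pos
    rw [hG, one_div, ENNReal.rpow_inv_le_iff hq]
    have : ∀ x, ‖gradient φ x‖ₑ ^ q ≤ (A : ℝ≥0∞) ^ q := fun x => by
      refine ENNReal.rpow_le_rpow ?_ hq.le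
      have h1 : ‖gradient φ x‖ ≤ A := by
        rw [gradient, LinearIsometryEquiv.norm_map]
        exact norm_fderiv_le_of_lipschitz ℝ hA
      rw [← ofReal_norm, ← ENNReal.ofReal_coe_nnreal]
      exact ENNReal.ofReal_le_ofReal h1
    refine (lintegral_mono this).trans ?_
    simp
  have hGt : G ≠ ∞ := (hGA.trans_lt ENNReal.coe_lt_top).ne
  have hright : ∀ᶠ s in 𝓝[>] t, s ∈ Ioc t 1 := Ioc_mem_nhdsGT ht.2
  have hm' : Tendsto (fun s => Wp p (μ s) (μ t) / edist s t) (𝓝[>] t) (𝓝 (m : ℝ≥0∞)) := by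
    refine hm.mono_left (nhdsWithin_le_iff.2 ?_)
    filter_upwards [hright] with s hs
    exact ⟨⟨ht.1.trans hs.1.le, hs.2⟩, ne_of_gt hs.1⟩
  have hf' := hf.tendsto_slope.mono_left
    (nhdsWithin_mono t fun s (hs : s ∈ Ioi t) => ne_of_gt hs)
  -- For `s` close to `t`, `W = (m + ε)(s - t)` exceeds the distance. One `ε` beside `G` pays for
  -- the gradient modulus, the other for the far pairs.
  have key : ∀ ε : ℝ, 0 < ε → |f'| ≤ (G.toReal + 2 * ε) * (m + ε) := by
    intro ε hε
    obtain ⟨δ, hδ, hmod⟩ := exists_gradient_modulus hφ hφc hε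
    have hW : Tendsto (fun s => (A : ℝ) * ((m + ε) * (s - t) / δ) ^ (p / q)) (𝓝[>] t) (𝓝 0) := by
      have hc : Continuous fun s : ℝ => (A : ℝ) * ((m + ε) * (s - t) / δ) ^ (p / q) := by
        refine continuous_const.mul (Continuous.rpow_const (by fun_prop) fun s => Or.inr ?_)
        exact div_nonneg hpq.nonneg hpq.symm.nonneg
      have := (hc.tendsto t).mono_left (nhdsWithin_le_nhds (s := Ioi t))
      simpa [Real.zero_rpow (div_pos hpq.pos hpq.symm.pos).ne'] using this
    have hmε : (m : ℝ≥0∞) < ENNReal.ofReal (m + ε) := by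
      rw [← ENNReal.ofReal_coe_nnreal]
      exact (ENNReal.ofReal_lt_ofReal_iff (by positivity)).2 (by linarith)
    refine le_of_tendsto hf'.abs ?_
    filter_upwards [hright, (tendsto_order.1 hW).2 ε hε, (tendsto_order.1 hm').2 _ hmε]
      with s hs h1 h2
    have hsI : s ∈ Icc (0 : ℝ) 1 := ⟨ht.1.trans hs.1.le, hs.2⟩
    have hps := hμ.isProbabilityMeasure hsI
    have hτ : 0 < s - t := sub_pos.2 hs.1
    have h3 : Wp p (μ t) (μ s) < ENNReal.ofReal ((m + ε) * (s - t)) := by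
      rw [Wp_comm hpq.pos, ENNReal.ofReal_mul (by positivity)]
      rw [edist_dist, Real.dist_eq, abs_of_pos hτ] at h2
      exact (ENNReal.div_lt_iff (Or.inl (by simpa using hs.1)) (Or.inl ENNReal.ofReal_ne_top)).1 h2
    have h4 := abs_integral_sub_le_gradient hpq hφ hφc hA hε.le hδ hmod h3
    rw [← hG, ← ENNReal.ofReal_toReal hGt, ← ENNReal.ofReal_add ENNReal.toReal_nonneg
      (by positivity), ← ENNReal.ofReal_mul (by positivity), ENNReal.ofReal_le_ofReal_iff
      (by positivity), ← hfφ s hsI, ← hfφ t htI] at h4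
    rw [slope_def_field, abs_div, abs_of_pos hτ, div_le_iff₀ hτ]
    refine h4.trans ?_
    rw [mul_assoc]
    have : G.toReal + (ε + A * ((m + ε) * (s - t) / δ) ^ (p / q)) ≤ G.toReal + 2 * ε := by linarith
    gcongr
  have hlim : Tendsto (fun ε : ℝ => (G.toReal + 2 * ε) * (m + ε)) (𝓝[>] 0)
      (𝓝 ((G.toReal + 2 * 0) * (m + 0))) :=
    (Continuous.tendsto (by fun_prop) 0).mono_left nhdsWithin_le_nhds
  have hle := ge_of_tendsto hlim (by filter_upwards [self_mem_nhdsWithin] with ε hε using key ε hε)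
  rw [mul_zero, add_zero, add_zero, mul_comm] at hle
  refine (ENNReal.ofReal_le_ofReal hle).trans (le_of_eq ?_)
  rw [ENNReal.ofReal_mul m.coe_nonneg, ENNReal.ofReal_coe_nnreal, ENNReal.ofReal_toReal hGt]

/-- The integral of a test function is Lipschitz along a Lipschitz curve. -/
theorem IsLipschitzCurve.exists_lipschitzWith_integral {Ω : Set (EuclideanSpace ℝ (Fin d))}
    {μ : ℝ → Measure (EuclideanSpace ℝ (Fin d))} (hpq : p.HolderConjugate q)
    (hμ : IsLipschitzCurve p Ω μ) {φ : EuclideanSpace ℝ (Fin d) → ℝ} (hφ : ContDiff ℝ 1 φ)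
    (hφc : HasCompactSupport φ) :
    ∃ K, LipschitzWith K fun t : ℝ => ∫ x, φ x ∂(μ (projIcc 0 1 zero_le_one t : ℝ)) := by
  obtain ⟨A, hA⟩ := hφ.lipschitzWith_of_hasCompactSupport hφc one_ne_zero
  obtain ⟨L, hL⟩ := hμ.2
  refine ⟨A * L, LipschitzWith.of_dist_le_mul fun s t => ?_⟩
  set s' := projIcc (0 : ℝ) 1 zero_le_one s
  set t' := projIcc (0 : ℝ) 1 zero_le_one t
  have := hμ.isProbabilityMeasure s'.2
  have := hμ.isProbabilityMeasure t'.2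
  refine le_of_forall_pos_le_add fun ε hε => ?_
  have hlt : Wp p (μ t') (μ s') < ENNReal.ofReal (L * dist s t + ε / (A + 1)) := by
    refine (hL _ t'.2 _ s'.2).trans_lt ?_
    rw [edist_dist, ← ENNReal.ofReal_coe_nnreal, ← ENNReal.ofReal_mul L.coe_nonneg]
    refine (ENNReal.ofReal_lt_ofReal_iff (by positivity)).2 ?_
    have h1 : dist (t' : ℝ) s' ≤ dist s t := by
      rw [dist_comm, Real.dist_eq, Real.dist_eq]
      exact abs_projIcc_sub_projIcc zero_le_one
    have h2 : 0 < ε / ((A : ℝ) + 1) := by positivity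
    have h3 := mul_le_mul_of_nonneg_left h1 L.coe_nonneg
    linarith
  have h1 := abs_integral_sub_le_of_Wp_lt hpq hφ hφc hA hlt
  rw [Real.dist_eq]
  refine h1.trans ?_
  have h2 : (A : ℝ) * (ε / (A + 1)) ≤ ε := by
    rw [mul_div_assoc', div_le_iff₀ (by positivity)]
    nlinarith [A.coe_nonneg]
  rw [NNReal.coe_mul, mul_add, ← mul_assoc]
  linarith

end TestFunctions

/-! ### Extension of functionals and representation by densities. -/

section Representation

/-- The Hahn-Banach theorem for a functional known on the image of a linear map. -/
theorem exists_linearMap_comp_eq_of_le {A V : Type*} [AddCommGroup A] [Module ℝ A]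
    [AddCommGroup V] [Module ℝ V] (l : A →ₗ[ℝ] ℝ) (G : A →ₗ[ℝ] V) (N : V → ℝ)
    (N_hom : ∀ c : ℝ, 0 < c → ∀ x, N (c • x) = c * N x) (N_add : ∀ x y, N (x + y) ≤ N x + N y)
    (hle : ∀ a, l a ≤ N (G a)) :
    ∃ Λ : V →ₗ[ℝ] ℝ, (∀ a, Λ (G a) = l a) ∧ ∀ x, Λ x ≤ N x := by
  have N_0 : N 0 = 0 := by
    have := N_hom 2 (by norm_num) 0
    rw [smul_zero] at this
    linarith
  -- The bound applied to `a` and `-a` shows that `l` depends only on `G a`, hence descends to the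
  -- range of `G`.
  have hk : LinearMap.ker G ≤ LinearMap.ker l := fun a ha => by
    rw [LinearMap.mem_ker] at ha ⊢
    have h1 := hle a
    have h2 := hle (-a)
    rw [ha, N_0] at h1
    rw [map_neg, map_neg, ha, neg_zero, N_0] at h2
    linarith
  let f : LinearMap.range G →ₗ[ℝ] ℝ :=
    (LinearMap.ker G).liftQ l hk ∘ₗ G.quotKerEquivRange.symm.toLinearMap
  have hf : ∀ a (h : G a ∈ LinearMap.range G), f ⟨G a, h⟩ = l a := fun a h => by
    simp only [f, LinearMap.comp_apply, LinearEquiv.coe_coe]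
    rw [LinearMap.quotKerEquivRange_symm_apply_image G a h]
    simp
  obtain ⟨Λ, h1, h2⟩ := exists_extension_of_le_sublinear ⟨LinearMap.range G, f⟩ N N_hom N_add (by
    rintro ⟨_, a, rfl⟩
    exact (hf a _).trans_le (hle a))
  exact ⟨Λ, fun a => (h1 ⟨G a, a, rfl⟩).trans (hf a _), h2⟩

/-- The space of bounded measurable functions. -/
def boundedMeasurable (X E : Type*) [MeasurableSpace X] [NormedAddCommGroup E] [NormedSpace ℝ E]
    [MeasurableSpace E] [BorelSpace E] [SecondCountableTopology E] : Submodule ℝ (X → E) where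
  carrier := {f | Measurable f ∧ ∃ C, ∀ x, ‖f x‖ ≤ C}
  add_mem' := by
    rintro f g ⟨hf, C, hC⟩ ⟨hg, C', hC'⟩
    exact ⟨hf.add hg, C + C', fun x => (norm_add_le _ _).trans (add_le_add (hC x) (hC' x))⟩
  zero_mem' := ⟨measurable_const, 0, fun x => by simp⟩
  smul_mem' := by
    rintro c f ⟨hf, C, hC⟩
    refine ⟨hf.const_smul c, ‖c‖ * C, fun x => ?_⟩
    rw [Pi.smul_apply, norm_smul]
    exact mul_le_mul_of_nonneg_left (hC x) (norm_nonneg c)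

variable {X E : Type*} [MeasurableSpace X] [NormedAddCommGroup E] [NormedSpace ℝ E]
    [MeasurableSpace E] [BorelSpace E] [SecondCountableTopology E] {M : Measure X}
    [IsFiniteMeasure M] {q : ℝ} {K : ℝ≥0∞}

/-- A linear functional on bounded measurable functions, bounded for an `L^q` seminorm, is
continuous for dominated pointwise convergence. -/
theorem tendsto_of_dominated (hq : 0 < q) (hK : K ≠ ∞) (Λ : boundedMeasurable X E →ₗ[ℝ] ℝ)
    (hΛ : ∀ f : boundedMeasurable X E,
      ‖Λ f‖ₑ ≤ K * (∫⁻ x, ‖(f : X → E) x‖ₑ ^ q ∂M) ^ (1 / q))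
    {ι : Type*} {l : Filter ι} [l.IsCountablyGenerated] {F : ι → boundedMeasurable X E}
    {f : boundedMeasurable X E} {C : ℝ≥0} (hC : ∀ i x, ‖(F i : X → E) x - (f : X → E) x‖ₑ ≤ C)
    (h : ∀ x, Tendsto (fun i => (F i : X → E) x) l (𝓝 ((f : X → E) x))) :
    Tendsto (fun i => Λ (F i)) l (𝓝 (Λ f)) := by
  have h1 : Tendsto (fun i => ∫⁻ x, ‖(F i : X → E) x - (f : X → E) x‖ₑ ^ q ∂M) l
      (𝓝 (∫⁻ _, 0 ∂M)) := by
    refine tendsto_lintegral_filter_of_dominated_convergence (fun _ => (C : ℝ≥0∞) ^ q)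
      (Eventually.of_forall fun i => ((F i).2.1.sub f.2.1).enorm.pow_const q)
      (Eventually.of_forall fun i => ae_of_all _ fun x => ENNReal.rpow_le_rpow (hC i x) hq.le)
      ?_ (ae_of_all _ fun x => ?_)
    · rw [lintegral_const]
      exact ENNReal.mul_ne_top (ENNReal.rpow_ne_top_of_nonneg hq.le ENNReal.coe_ne_top)
        (measure_ne_top _ _)
    · have h2 : Tendsto (fun i => ‖(F i : X → E) x - (f : X → E) x‖ₑ) l (𝓝 0) := by
        have := ((h x).sub_const ((f : X → E) x)).enorm
        simpa using this
      have := (ENNReal.continuous_rpow_const (y := q)).tendsto 0 |>.comp h2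
      rwa [ENNReal.zero_rpow_of_pos hq] at this
  rw [lintegral_zero] at h1
  have h2 : Tendsto (fun i => K * (∫⁻ x, ‖(F i : X → E) x - (f : X → E) x‖ₑ ^ q ∂M) ^ (1 / q)) l
      (𝓝 0) := by
    have h3 := (ENNReal.continuous_rpow_const (y := 1 / q)).tendsto 0 |>.comp h1
    rw [ENNReal.zero_rpow_of_pos (by positivity)] at h3
    have := ENNReal.Tendsto.const_mul h3 (Or.inr hK)
    rwa [mul_zero] at this
  rw [tendsto_iff_edist_tendsto_0]
  refine tendsto_of_tendsto_of_tendsto_of_le_of_le tendsto_const_nhds h2 (fun _ => zero_le)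
    fun i => ?_
  rw [edist_eq_enorm_sub, ← map_sub]
  exact hΛ (F i - f)

/-- The indicator function of a measurable set as a bounded measurable function. -/
noncomputable def boundedIndicator (s : Set X) (hs : MeasurableSet s) : boundedMeasurable X ℝ :=
  ⟨s.indicator 1, measurable_one.indicator hs, 1, fun x =>
    (norm_indicator_le_norm_self _ _).trans (by simp)⟩

/-- Radon-Nikodym for `A ↦ Λ 1_A`: dominated continuity gives countable additivity and the `L^q`
bound gives absolute continuity. Only integrability of the density is claimed; its sharp fiberwise
`L^p` bound is obtained later. -/
theorem exists_density_real (hq : 0 < q) (hK : K ≠ ∞) (Λ : boundedMeasurable X ℝ →ₗ[ℝ] ℝ)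
    (hΛ : ∀ f : boundedMeasurable X ℝ,
      ‖Λ f‖ₑ ≤ K * (∫⁻ x, ‖(f : X → ℝ) x‖ₑ ^ q ∂M) ^ (1 / q)) :
    ∃ h : X → ℝ, Measurable h ∧ Integrable h M ∧
      ∀ f : boundedMeasurable X ℝ, Λ f = ∫ x, (f : X → ℝ) x * h x ∂M := by
  classical
  let s : SignedMeasure X :=
    { measureOf' := fun A => if hA : MeasurableSet A then Λ (boundedIndicator A hA) else 0
      empty' := by
        rw [dif_pos MeasurableSet.empty]
        have : boundedIndicator (∅ : Set X) MeasurableSet.empty = 0 := by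
          ext x
          simp [boundedIndicator]
        rw [this, map_zero]
      not_measurable' := fun A hA => dif_neg hA
      m_iUnion' := fun A hA hd => by
        simp only [hA, MeasurableSet.iUnion hA, dif_pos]
        have h1 : ∀ F : Finset ℕ, ∑ i ∈ F, Λ (boundedIndicator (A i) (hA i)) =
            Λ (boundedIndicator (⋃ i ∈ F, A i) (F.measurableSet_biUnion fun i _ => hA i)) := by
          intro F
          rw [← map_sum]
          congr 1
          ext x
          simp only [boundedIndicator, AddSubmonoidClass.coe_finsetSum, Finset.sum_apply]
          rw [Finset.indicator_biUnion_apply F A fun i _ j _ hij => hd hij]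
        -- Partial sums are values at indicators of finite unions, so summability is dominated
        -- convergence along the filter of finite sets of indices.
        refine Tendsto.congr (fun F => (h1 F).symm) ?_
        refine tendsto_of_dominated hq hK Λ hΛ (C := 1) (fun F x => ?_) fun x => ?_
        · simp only [boundedIndicator]
          by_cases hx : x ∈ ⋃ i ∈ F, A i
          · have : x ∈ ⋃ i, A i := by
              simp only [mem_iUnion] at hx ⊢
              exact ⟨_, hx.choose_spec.choose_spec⟩
            simp [indicator_of_mem hx, indicator_of_mem this]
          · rw [indicator_of_notMem hx, zero_sub, enorm_neg]
            exact (enorm_indicator_le_enorm_self _ _).trans (by simp)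
        · exact (tendsto_indicator_biUnion_finset A 1 x).mono_right (pure_le_nhds _) }
  have hs : ∀ A (hA : MeasurableSet A), s A = Λ (boundedIndicator A hA) := fun A hA => dif_pos hA
  have hac : s ≪ᵥ M.toENNRealVectorMeasure := by
    refine VectorMeasure.AbsolutelyContinuous.mk fun A hA h0 => ?_
    rw [Measure.toENNRealVectorMeasure_apply_measurable hA] at h0
    have h1 := hΛ (boundedIndicator A hA)
    have h2 : ∫⁻ x, ‖(boundedIndicator A hA : X → ℝ) x‖ₑ ^ q ∂M = 0 := by
      refine (lintegral_congr_ae ?_).trans lintegral_zero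
      have : ∀ᵐ x ∂M, x ∉ A := measure_eq_zero_iff_ae_notMem.1 h0
      filter_upwards [this] with x hx
      simp [boundedIndicator, hx, hq]
    rw [h2, ENNReal.zero_rpow_of_pos (by positivity), mul_zero] at h1
    rw [hs A hA]
    simpa using h1
  have hrn := SignedMeasure.withDensityᵥ_rnDeriv_eq s M hac
  have hint : Integrable (s.rnDeriv M) M := SignedMeasure.integrable_rnDeriv s M
  have hA : ∀ A (hA : MeasurableSet A),
      Λ (boundedIndicator A hA) = ∫ x in A, s.rnDeriv M x ∂M := fun A hA => by
    rw [← hs A hA]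
    conv_lhs => rw [← hrn]
    exact withDensityᵥ_apply hint hA
  refine ⟨s.rnDeriv M, SignedMeasure.measurable_rnDeriv s M, hint, fun f => ?_⟩
  have hmem : ∀ g : SimpleFunc X ℝ, (g : X → ℝ) ∈ boundedMeasurable X ℝ := fun g =>
    ⟨g.measurable, g.exists_forall_norm_le⟩
  have hsimple : ∀ g : SimpleFunc X ℝ,
      Λ ⟨g, hmem g⟩ = ∫ x, g x * s.rnDeriv M x ∂M := by
    intro g
    induction g using SimpleFunc.induction with
    | const c hA' =>
      rename_i A
      have e : (⟨_, hmem (SimpleFunc.piecewise A hA' (SimpleFunc.const X c)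
          (SimpleFunc.const X 0))⟩ : boundedMeasurable X ℝ) = c • boundedIndicator A hA' := by
        ext x
        by_cases hx : x ∈ A <;> simp [boundedIndicator, hx]
      rw [e, map_smul, hA A hA', smul_eq_mul, ← integral_const_mul, ← integral_indicator hA']
      congr 1
      ext x
      by_cases hx : x ∈ A <;> simp [hx]
    | add hd hf hg =>
      rename_i f g
      have e : (⟨_, hmem (f + g)⟩ : boundedMeasurable X ℝ) = ⟨f, hmem f⟩ + ⟨g, hmem g⟩ := by
        ext x; rfl
      have hfi : ∀ f : SimpleFunc X ℝ, Integrable (fun x => f x * s.rnDeriv M x) M := fun f => by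
        obtain ⟨C, hC⟩ := f.exists_forall_norm_le
        exact hint.bdd_mul f.measurable.aestronglyMeasurable (ae_of_all _ hC)
      rw [e, map_add, hf, hg, ← integral_add (hfi f) (hfi g)]
      congr 1
      ext x
      simp [add_mul]
  obtain ⟨hfm, C, hC⟩ := id f.2
  let g : ℕ → SimpleFunc X ℝ := hfm.stronglyMeasurable.approxBounded C
  have hC0 : ∀ x, 0 ≤ C := fun x => (norm_nonneg _).trans (hC x)
  have hgt : ∀ x, Tendsto (fun n => g n x) atTop (𝓝 ((f : X → ℝ) x)) := fun x =>
    hfm.stronglyMeasurable.tendsto_approxBounded_of_norm_le (hC x)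
  have hgb : ∀ n x, ‖g n x‖ ≤ C := fun n x =>
    hfm.stronglyMeasurable.norm_approxBounded_le (hC0 x) n x
  have t1 : Tendsto (fun n => Λ ⟨g n, hmem (g n)⟩) atTop (𝓝 (Λ f)) := by
    refine tendsto_of_dominated hq hK Λ hΛ (C := (C + C).toNNReal) (fun n x => ?_) hgt
    rw [← ofReal_norm]
    exact ENNReal.ofReal_le_ofReal ((norm_sub_le _ _).trans (add_le_add (hgb n x) (hC x)))
  have t2 : Tendsto (fun n => ∫ x, g n x * s.rnDeriv M x ∂M) atTop
      (𝓝 (∫ x, (f : X → ℝ) x * s.rnDeriv M x ∂M)) := by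
    refine tendsto_integral_of_dominated_convergence (fun x => C * ‖s.rnDeriv M x‖)
      (fun n => (g n).measurable.aestronglyMeasurable.mul hint.aestronglyMeasurable)
      (hint.norm.const_mul C) (fun n => ae_of_all _ fun x => ?_) (ae_of_all _ fun x => ?_)
    · rw [norm_mul]
      exact mul_le_mul_of_nonneg_right (hgb n x) (norm_nonneg _)
    · exact (hgt x).mul_const _
  refine tendsto_nhds_unique t1 (t2.congr fun n => (hsimple (g n)).symm)

/-- A linear functional on bounded measurable vector fields which is bounded for an `L^q` seminorm
is given by an integrable density. -/
theorem exists_density {d : ℕ} (hq : 0 < q) (hK : K ≠ ∞)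
    (Λ : boundedMeasurable X (EuclideanSpace ℝ (Fin d)) →ₗ[ℝ] ℝ)
    (hΛ : ∀ f : boundedMeasurable X (EuclideanSpace ℝ (Fin d)),
      ‖Λ f‖ₑ ≤ K * (∫⁻ x, ‖(f : X → EuclideanSpace ℝ (Fin d)) x‖ₑ ^ q ∂M) ^ (1 / q)) :
    ∃ v : X → EuclideanSpace ℝ (Fin d), Measurable v ∧ Integrable v M ∧
      ∀ f : boundedMeasurable X (EuclideanSpace ℝ (Fin d)),
        Λ f = ∫ x, inner ℝ ((f : X → EuclideanSpace ℝ (Fin d)) x) (v x) ∂M := by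
  let e : Fin d → EuclideanSpace ℝ (Fin d) := fun i => EuclideanSpace.single i 1
  have he : ∀ i, ‖e i‖ = 1 := fun i => by simp [e]
  let J : Fin d → boundedMeasurable X ℝ →ₗ[ℝ] boundedMeasurable X (EuclideanSpace ℝ (Fin d)) :=
    fun i =>
    { toFun := fun g => ⟨fun x => (g : X → ℝ) x • e i, g.2.1.smul_const _, by
        obtain ⟨C, hC⟩ := g.2.2
        exact ⟨C, fun x => by rw [norm_smul, he, mul_one]; exact hC x⟩⟩
      map_add' := fun g g' => by ext1; funext x; exact add_smul _ _ _
      map_smul' := fun c g => by ext1; funext x; exact mul_smul c ((g : X → ℝ) x) (e i) }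
  have hJ : ∀ i, ∃ h : X → ℝ, Measurable h ∧ Integrable h M ∧
      ∀ g : boundedMeasurable X ℝ, (Λ ∘ₗ J i) g = ∫ x, (g : X → ℝ) x * h x ∂M := fun i =>
    exists_density_real hq hK (Λ ∘ₗ J i) fun g => by
      refine (hΛ (J i g)).trans (le_of_eq ?_)
      congr 3
      funext x
      have : ‖(g : X → ℝ) x • e i‖ₑ = ‖(g : X → ℝ) x‖ₑ := by
        rw [enorm_smul, ← ofReal_norm (e i), he, ENNReal.ofReal_one, mul_one]
      exact congrArg (· ^ q) this
  choose h hm hi hrep using hJ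
  refine ⟨fun x => ∑ i, h i x • e i, ?_, ?_, fun f => ?_⟩
  · exact Finset.measurable_sum _ fun i _ => (hm i).smul_const _
  · exact integrable_finsetSum _ fun i _ => (hi i).smul_const _
  · obtain ⟨hfm, C, hC⟩ := id f.2
    let c : Fin d → boundedMeasurable X ℝ := fun i =>
      ⟨fun x => (f : X → EuclideanSpace ℝ (Fin d)) x i, by fun_prop, C, fun x =>
        (PiLp.norm_apply_le _ i).trans (hC x)⟩
    have hf : f = ∑ i, J i (c i) := by
      ext1
      funext x
      rw [AddSubmonoidClass.coe_finsetSum, Finset.sum_apply]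
      ext j
      simp [J, c, e, Finset.sum_apply, Pi.single_apply]
    have hci : ∀ i, Integrable (fun x => (c i : X → ℝ) x * h i x) M := fun i => by
      obtain ⟨C', hC'⟩ := (c i).2.2
      exact (hi i).bdd_mul (c i).2.1.aestronglyMeasurable (ae_of_all _ hC')
    conv_lhs => rw [hf, map_sum]
    have h1 : ∀ i, Λ (J i (c i)) = ∫ x, (c i : X → ℝ) x * h i x ∂M := fun i => hrep i (c i)
    simp_rw [h1]
    rw [← integral_finsetSum _ fun i _ => hci i]
    congr 1
    funext x
    rw [inner_sum]
    refine Finset.sum_congr rfl fun i _ => ?_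
    rw [inner_smul_right, EuclideanSpace.inner_single_right]
    simp [c, mul_comm]

end Representation

/-! ### The weighted mixed norm: `L¹` in time of `L^q` norms in space. -/

section FiberNorm

open ProbabilityTheory

variable {T X F : Type*} [MeasurableSpace T] [MeasurableSpace X] [NormedAddCommGroup F]
  [MeasurableSpace F] [BorelSpace F]
  {ρ : Measure T} {κ : Kernel T X} {m : T → ℝ≥0∞} {p q : ℝ} {L : ℝ≥0∞}

/-- The integral in time, with weight `m`, of the `L^q` norms on the fibers of a function. -/
noncomputable def fiberNorm (ρ : Measure T) (κ : Kernel T X) (m : T → ℝ≥0∞) (q : ℝ)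
    (f : T × X → F) : ℝ≥0∞ :=
  ∫⁻ t, m t * (∫⁻ x, ‖f (t, x)‖ₑ ^ q ∂(κ t)) ^ (1 / q) ∂ρ

theorem measurable_lintegral_enorm_rpow [IsSFiniteKernel κ] {f : T × X → F} (hf : Measurable f) :
    Measurable fun t => ∫⁻ x, ‖f (t, x)‖ₑ ^ q ∂(κ t) :=
  Measurable.lintegral_kernel_prod_right' (f := fun z => ‖f z‖ₑ ^ q) (hf.enorm.pow_const q)

theorem fiberNorm_add_le [IsSFiniteKernel κ] (hm : Measurable m) (hq : 1 ≤ q) {f g : T × X → F}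
    (hf : Measurable f) (hg : Measurable g) :
    fiberNorm ρ κ m q (f + g) ≤ fiberNorm ρ κ m q f + fiberNorm ρ κ m q g := by
  unfold fiberNorm
  have hmf : Measurable fun t => m t * (∫⁻ x, ‖f (t, x)‖ₑ ^ q ∂(κ t)) ^ (1 / q) :=
    hm.mul ((measurable_lintegral_enorm_rpow hf).pow_const _)
  rw [← lintegral_add_left hmf]
  refine lintegral_mono fun t => ?_
  rw [← mul_add]
  refine mul_le_mul_right ?_ _
  refine le_trans ?_ (ENNReal.lintegral_Lp_add_le (μ := κ t) (f := fun x => ‖f (t, x)‖ₑ)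
    (g := fun x => ‖g (t, x)‖ₑ) (by fun_prop) (by fun_prop) hq)
  gcongr with x
  exact enorm_add_le _ _

theorem fiberNorm_smul [NormedSpace ℝ F] [IsSFiniteKernel κ] (hm : Measurable m) (hq : 0 < q) (c : ℝ)
    {f : T × X → F} (hf : Measurable f) :
    fiberNorm ρ κ m q (c • f) = ‖c‖ₑ * fiberNorm ρ κ m q f := by
  unfold fiberNorm
  have hmf : Measurable fun t => m t * (∫⁻ x, ‖f (t, x)‖ₑ ^ q ∂(κ t)) ^ (1 / q) :=
    hm.mul ((measurable_lintegral_enorm_rpow hf).pow_const _)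
  rw [← lintegral_const_mul _ hmf]
  refine lintegral_congr fun t => ?_
  have h1 : ∫⁻ x, ‖(c • f) (t, x)‖ₑ ^ q ∂(κ t) = ‖c‖ₑ ^ q * ∫⁻ x, ‖f (t, x)‖ₑ ^ q ∂(κ t) := by
    rw [← lintegral_const_mul _ (by fun_prop)]
    refine lintegral_congr fun x => ?_
    rw [Pi.smul_apply, enorm_smul, ENNReal.mul_rpow_of_nonneg _ _ hq.le]
  rw [h1, ENNReal.mul_rpow_of_nonneg _ _ (by positivity), ← ENNReal.rpow_mul,
    mul_one_div_cancel hq.ne', ENNReal.rpow_one]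
  ring

/-- Hölder in time against the constant `1`. It provides the plain `L^q` bound that the
representation by a density requires. -/
theorem fiberNorm_le [IsProbabilityMeasure ρ] [IsSFiniteKernel κ]
    (hL : ∀ t, m t ≤ L) (hpq : p.HolderConjugate q) {f : T × X → F} (hf : Measurable f) :
    fiberNorm ρ κ m q f ≤ L * (∫⁻ z, ‖f z‖ₑ ^ q ∂(ρ ⊗ₘ κ)) ^ (1 / q) := by
  have hq := hpq.symm.pos
  have hmeas := measurable_lintegral_enorm_rpow (κ := κ) (q := q) hf
  unfold fiberNorm
  rw [Measure.lintegral_compProd (hf.enorm.pow_const q)]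
  refine (lintegral_mono fun t => mul_le_mul_left (hL t) _).trans ?_
  rw [lintegral_const_mul _ (hmeas.pow_const _)]
  refine mul_le_mul_right ?_ _
  have := ENNReal.lintegral_mul_le_Lp_mul_Lq ρ hpq.symm
    (f := fun t => (∫⁻ x, ‖f (t, x)‖ₑ ^ q ∂(κ t)) ^ (1 / q)) (g := fun _ => 1)
    (hmeas.pow_const _).aemeasurable aemeasurable_const
  refine le_trans (le_of_eq ?_) (this.trans (le_of_eq ?_))
  · simp
  · have h1 : ∀ a : ℝ≥0∞, (a ^ (1 / q)) ^ q = a := fun a => by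
      rw [← ENNReal.rpow_mul, one_div_mul_cancel hq.ne', ENNReal.rpow_one]
    simp_rw [h1]
    simp

end FiberNorm

/-! ### The representing field and its fiberwise bound. -/

section Density

open ProbabilityTheory

variable {d : ℕ} {T X : Type*} [MeasurableSpace T] [MeasurableSpace X]
  {ρ : Measure T} [IsProbabilityMeasure ρ] {κ : Kernel T X} [IsMarkovKernel κ] {m : T → ℝ≥0∞}
  {p q : ℝ} {L : ℝ≥0∞}

/-- The dual bound on a density, from testing it against `|v|^(p-2) v`, truncated. -/
theorem ae_eLpNorm_le_of_fiberNorm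
    (hpq : p.HolderConjugate q) {v : T × X → EuclideanSpace ℝ (Fin d)} (hv : Measurable v)
    (h : ∀ f : boundedMeasurable (T × X) (EuclideanSpace ℝ (Fin d)),
      ENNReal.ofReal (∫ z, inner ℝ ((f : T × X → EuclideanSpace ℝ (Fin d)) z) (v z) ∂(ρ ⊗ₘ κ)) ≤
        fiberNorm ρ κ m q (f : T × X → EuclideanSpace ℝ (Fin d))) :
    ∀ᵐ t ∂ρ, eLpNorm (fun x => v (t, x)) (ENNReal.ofReal p) (κ t) ≤ m t := by
  have hp := hpq.pos
  have hq := hpq.symm.pos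
  have hp1 := hpq.lt
  let B : ℕ → Set (T × X) := fun n => {z | ‖v z‖ ≤ n}
  have hB : ∀ n, MeasurableSet (B n) := fun n => measurableSet_le hv.norm measurable_const
  let g : ℕ → T × X → ℝ≥0∞ := fun n => (B n).indicator fun z => ‖v z‖ₑ ^ p
  have hg : ∀ n, Measurable (g n) := fun n => (hv.enorm.pow_const p).indicator (hB n)
  let a : ℕ → T → ℝ≥0∞ := fun n t => ∫⁻ x, g n (t, x) ∂(κ t)
  have ha : ∀ n, Measurable (a n) := fun n => Measurable.lintegral_kernel_prod_right' (hg n)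
  have hgle : ∀ n z, g n z ≤ ENNReal.ofReal ((n : ℝ) ^ p) := fun n z => by
    by_cases hz : z ∈ B n
    · simp only [g, indicator_of_mem hz]
      rw [← ofReal_norm, ENNReal.ofReal_rpow_of_nonneg (norm_nonneg _) hp.le]
      exact ENNReal.ofReal_le_ofReal (Real.rpow_le_rpow (norm_nonneg _) hz hp.le)
    · simp [g, indicator_of_notMem hz]
  have hatop : ∀ n t, a n t ≠ ∞ := fun n t => by
    refine ne_top_of_le_ne_top (b := ENNReal.ofReal ((n : ℝ) ^ p)) ENNReal.ofReal_ne_top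
      ((lintegral_mono fun x => hgle n _).trans (le_of_eq ?_))
    rw [lintegral_const, measure_univ, mul_one]
  have key : ∀ n, ∀ᵐ t ∂ρ, a n t ≤ m t * a n t ^ (1 / q) := fun n => by
    -- Localizing the test field to an arbitrary set `A` of times turns the integrated bound into
    -- one at almost every time.
    refine ae_le_of_forall_setLIntegral_le_of_sigmaFinite₀ (ha n).aemeasurable fun A hA _ => ?_
    let S : Set (T × X) := (Prod.fst ⁻¹' A) ∩ B n
    have hS : MeasurableSet S := (measurable_fst hA).inter (hB n)
    have hnorm : ∀ w : EuclideanSpace ℝ (Fin d), ‖‖w‖ ^ (p - 2) • w‖ = ‖w‖ ^ (p - 1) := fun w => by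
      rcases eq_or_ne w 0 with rfl | hw
      · simp [Real.zero_rpow (by linarith : p - 1 ≠ 0)]
      · have hw' : 0 < ‖w‖ := norm_pos_iff.2 hw
        rw [norm_smul, Real.norm_of_nonneg (by positivity), ← Real.rpow_add_one hw'.ne']
        congr 1
        ring
    -- The extremal field of Hölder's inequality, truncated to be bounded. Its pairing with `v` is
    -- `|v|^p`, and so is its norm to the power `q`, because `(p - 1) q = p`.
    let f : boundedMeasurable (T × X) (EuclideanSpace ℝ (Fin d)) :=
      ⟨S.indicator fun z => ‖v z‖ ^ (p - 2) • v z,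
        ((hv.norm.pow_const _).smul hv).indicator hS, (n : ℝ) ^ (p - 1), fun z => by
          by_cases hz : z ∈ S
          · rw [indicator_of_mem hz, hnorm]
            exact Real.rpow_le_rpow (norm_nonneg _) hz.2 (by linarith)
          · rw [indicator_of_notMem hz, norm_zero]
            positivity⟩
    have h1 : ∀ z, inner ℝ ((f : T × X → EuclideanSpace ℝ (Fin d)) z) (v z) =
        (S.indicator (fun z => ‖v z‖ₑ ^ p) z).toReal := fun z => by
      by_cases hz : z ∈ S
      · simp only [f, indicator_of_mem hz]
        rw [inner_smul_left, real_inner_self_eq_norm_sq, ← ENNReal.toReal_rpow, toReal_enorm]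
        rcases eq_or_ne (v z) 0 with h0 | h0
        · simp [h0, Real.zero_rpow hp.ne']
        · have h0' : 0 < ‖v z‖ := norm_pos_iff.2 h0
          rw [RCLike.conj_to_real, ← Real.rpow_natCast, ← Real.rpow_add h0']
          congr 1
          push_cast
          ring
      · simp [f, indicator_of_notMem hz]
    have h2 : ∀ t x, S.indicator (fun z => ‖v z‖ₑ ^ p) (t, x) =
        A.indicator (fun t => g n (t, x)) t := fun t x => by
      by_cases ht : t ∈ A <;> by_cases hz : (t, x) ∈ B n <;>
        simp [S, g, ht, hz]
    have h3 : ENNReal.ofReal (∫ z, inner ℝ ((f : T × X → EuclideanSpace ℝ (Fin d)) z) (v z)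
        ∂(ρ ⊗ₘ κ)) = ∫⁻ t in A, a n t ∂ρ := by
      simp_rw [h1]
      have hmS : Measurable (S.indicator fun z => ‖v z‖ₑ ^ p) :=
        (hv.enorm.pow_const p).indicator hS
      have hle : ∀ z, S.indicator (fun z => ‖v z‖ₑ ^ p) z ≤ ENNReal.ofReal ((n : ℝ) ^ p) := fun z =>
        (indicator_le_indicator_of_subset inter_subset_right (fun _ => zero_le) z).trans (hgle n z)
      rw [integral_toReal hmS.aemeasurable
        (ae_of_all _ fun z => (hle z).trans_lt ENNReal.ofReal_lt_top), ENNReal.ofReal_toReal]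
      · rw [Measure.lintegral_compProd hmS, ← lintegral_indicator hA]
        refine lintegral_congr fun t => ?_
        simp_rw [h2]
        by_cases ht : t ∈ A <;> simp [ht, a]
      · refine ne_top_of_le_ne_top (b := ENNReal.ofReal ((n : ℝ) ^ p)) ENNReal.ofReal_ne_top
          ((lintegral_mono hle).trans (le_of_eq ?_))
        rw [lintegral_const, measure_univ, mul_one]
    have h4 : fiberNorm ρ κ m q (f : T × X → EuclideanSpace ℝ (Fin d)) =
        ∫⁻ t in A, m t * a n t ^ (1 / q) ∂ρ := by
      rw [fiberNorm, ← lintegral_indicator hA]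
      refine lintegral_congr fun t => ?_
      have h5 : ∀ x, ‖(f : T × X → EuclideanSpace ℝ (Fin d)) (t, x)‖ₑ ^ q =
          A.indicator (fun t => g n (t, x)) t := fun x => by
        rw [← h2]
        by_cases hz : (t, x) ∈ S
        · simp only [f, indicator_of_mem hz]
          rw [← ofReal_norm, hnorm, ← ofReal_norm (v (t, x)),
            ENNReal.ofReal_rpow_of_nonneg (by positivity) hq.le, ← Real.rpow_mul (norm_nonneg _),
            ENNReal.ofReal_rpow_of_nonneg (norm_nonneg _) hp.le, hpq.sub_one_mul_conj]
        · simp [f, indicator_of_notMem hz, hq]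
      simp_rw [h5]
      by_cases ht : t ∈ A
      · simp [ht, a]
      · simp [ht, hq]
    rw [← h3, ← h4]
    exact h f
  filter_upwards [ae_all_iff.2 key] with t ht
  -- Cancelling `a^(1/q)` in `a ≤ m a^(1/q)` leaves `a^(1/p) ≤ m`. The truncation makes `a n t`
  -- finite, which the cancellation needs.
  have hbound : ∀ n, a n t ≤ m t ^ p := fun n => by
    rcases eq_or_ne (a n t) 0 with h0 | h0
    · rw [h0]; exact zero_le
    · have e : a n t = a n t ^ (1 / p) * a n t ^ (1 / q) := by
        rw [← ENNReal.rpow_add _ _ h0 (hatop n t), one_div, one_div, hpq.inv_add_inv_eq_one,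
          ENNReal.rpow_one]
      have h1 := ht n
      conv_lhs at h1 => rw [e]
      have h2 : a n t ^ (1 / p) ≤ m t := by
        refine (ENNReal.mul_le_mul_iff_left ?_ ?_).1 h1
        · simp [ENNReal.rpow_eq_zero_iff, h0, hatop n t]
        · exact ENNReal.rpow_ne_top_of_nonneg (by positivity) (hatop n t)
      have h3 := ENNReal.rpow_le_rpow h2 hp.le
      rwa [← ENNReal.rpow_mul, one_div_mul_cancel hp.ne', ENNReal.rpow_one] at h3
  have hlim : Tendsto (fun n => a n t) atTop (𝓝 (∫⁻ x, ‖v (t, x)‖ₑ ^ p ∂(κ t))) := by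
    refine lintegral_tendsto_of_tendsto_of_monotone
      (fun n => ((hg n).comp measurable_prodMk_left).aemeasurable)
      (ae_of_all _ fun x i j hij => ?_) (ae_of_all _ fun x => ?_)
    · refine indicator_le_indicator_of_subset (fun z hz => ?_) (fun _ => zero_le) _
      exact (show ‖v z‖ ≤ (i : ℝ) from hz).trans (Nat.cast_le.2 hij)
    · refine tendsto_const_nhds.congr' ?_
      obtain ⟨N, hN⟩ := exists_nat_ge ‖v (t, x)‖
      filter_upwards [eventually_ge_atTop N] with n hn
      have : (t, x) ∈ B n := hN.trans (Nat.cast_le.2 hn)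
      simp [g, this]
  rw [eLpNorm_eq_lintegral_rpow_enorm_toReal (by simpa using hp) ENNReal.ofReal_ne_top,
    ENNReal.toReal_ofReal hp.le]
  have := ENNReal.rpow_le_rpow (le_of_tendsto' hlim hbound) (z := 1 / p) (by positivity)
  rwa [← ENNReal.rpow_mul, mul_one_div_cancel hp.ne', ENNReal.rpow_one] at this

/-- Extension of a functional bounded by `fiberNorm`, and representation by a vector field. -/
theorem exists_field_of_le_fiberNorm (hm : Measurable m) (hL : ∀ t, m t ≤ L) (hL' : L ≠ ∞)
    (hpq : p.HolderConjugate q) {A : Type*} [AddCommGroup A] [Module ℝ A] (l : A →ₗ[ℝ] ℝ)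
    (G : A →ₗ[ℝ] boundedMeasurable (T × X) (EuclideanSpace ℝ (Fin d)))
    (hle : ∀ a, ENNReal.ofReal (l a) ≤
      fiberNorm ρ κ m q (G a : T × X → EuclideanSpace ℝ (Fin d))) :
    ∃ v : T × X → EuclideanSpace ℝ (Fin d), Measurable v ∧ Integrable v (ρ ⊗ₘ κ) ∧
      (∀ a, l a = ∫ z, inner ℝ ((G a : T × X → EuclideanSpace ℝ (Fin d)) z) (v z) ∂(ρ ⊗ₘ κ)) ∧
      ∀ᵐ t ∂ρ, eLpNorm (fun x => v (t, x)) (ENNReal.ofReal p) (κ t) ≤ m t := by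
  have hq := hpq.symm.pos
  have hfin : ∀ f : boundedMeasurable (T × X) (EuclideanSpace ℝ (Fin d)),
      fiberNorm ρ κ m q (f : T × X → EuclideanSpace ℝ (Fin d)) ≠ ∞ := fun f => by
    refine ne_top_of_le_ne_top ?_ (fiberNorm_le hL hpq f.2.1)
    refine ENNReal.mul_ne_top hL' (ENNReal.rpow_ne_top_of_nonneg (by positivity) ?_)
    obtain ⟨C, hC⟩ := f.2.2
    refine ne_top_of_le_ne_top (b := ENNReal.ofReal C ^ q)
      (ENNReal.rpow_ne_top_of_nonneg hq.le ENNReal.ofReal_ne_top)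
      ((lintegral_mono fun z => ENNReal.rpow_le_rpow (z := q) ?_ hq.le).trans
        (le_of_eq (by rw [lintegral_const, measure_univ, mul_one])))
    rw [← ofReal_norm]
    exact ENNReal.ofReal_le_ofReal (hC z)
  obtain ⟨Λ, hΛ1, hΛ2⟩ := exists_linearMap_comp_eq_of_le l G
    (fun f => (fiberNorm ρ κ m q (f : T × X → EuclideanSpace ℝ (Fin d))).toReal)
    (fun c hc f => by
      rw [Submodule.coe_smul, fiberNorm_smul hm hq c f.2.1, ENNReal.toReal_mul, toReal_enorm,
        Real.norm_of_nonneg hc.le])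
    (fun f g => by
      rw [← ENNReal.toReal_add (hfin f) (hfin g)]
      exact ENNReal.toReal_mono (ENNReal.add_ne_top.2 ⟨hfin f, hfin g⟩)
        (fiberNorm_add_le hm hpq.symm.lt.le f.2.1 g.2.1))
    (fun a => (ENNReal.ofReal_le_iff_le_toReal (hfin _)).1 (hle a))
  have hΛ3 : ∀ f, ENNReal.ofReal (Λ f) ≤
      fiberNorm ρ κ m q (f : T × X → EuclideanSpace ℝ (Fin d)) := fun f =>
    (ENNReal.ofReal_le_iff_le_toReal (hfin f)).2 (hΛ2 f)
  have hneg : ∀ f : boundedMeasurable (T × X) (EuclideanSpace ℝ (Fin d)),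
      fiberNorm ρ κ m q ((-f : boundedMeasurable (T × X) (EuclideanSpace ℝ (Fin d))) :
        T × X → EuclideanSpace ℝ (Fin d)) =
      fiberNorm ρ κ m q (f : T × X → EuclideanSpace ℝ (Fin d)) := fun f => by
    simp [fiberNorm]
  obtain ⟨v, hv, hvi, hvΛ⟩ := exists_density (M := ρ ⊗ₘ κ) hq hL' Λ fun f => by
    refine le_trans ?_ (fiberNorm_le hL hpq f.2.1)
    rw [← ofReal_norm, Real.norm_eq_abs]
    rcases abs_cases (Λ f) with ⟨h, -⟩ | ⟨h, -⟩
    · rw [h]; exact hΛ3 f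
    · rw [h, ← map_neg, ← hneg]; exact hΛ3 (-f)
  refine ⟨v, hv, hvi, fun a => by rw [← hΛ1, hvΛ], ae_eLpNorm_le_of_fiberNorm hpq hv fun f => ?_⟩
  rw [← hvΛ]
  exact hΛ3 f

end Density

/-! ### Existence of the minimal velocity field. -/

section Existence

open ProbabilityTheory

variable {d : ℕ} {p q : ℝ} {Ω : Set (EuclideanSpace ℝ (Fin d))}
  {μ : ℝ → Measure (EuclideanSpace ℝ (Fin d))}

theorem continuous_gradient {φ : EuclideanSpace ℝ (Fin d) → ℝ} (hφ : ContDiff ℝ 1 φ) :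
    Continuous (gradient φ) :=
  (InnerProductSpace.toDual ℝ (EuclideanSpace ℝ (Fin d))).symm.continuous.comp
    (hφ.continuous_fderiv one_ne_zero)

theorem exists_norm_gradient_le {φ : EuclideanSpace ℝ (Fin d) → ℝ} (hφ : ContDiff ℝ 1 φ)
    (hφc : HasCompactSupport φ) : ∃ C, ∀ x, ‖gradient φ x‖ ≤ C := by
  obtain ⟨A, hA⟩ := hφ.lipschitzWith_of_hasCompactSupport hφc one_ne_zero
  refine ⟨A, fun x => ?_⟩
  rw [gradient, LinearIsometryEquiv.norm_map]
  exact norm_fderiv_le_of_lipschitz ℝ hA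

/-- Pairs of a measurable set of times and a test function in space. -/
abbrev TestPair (d : ℕ) : Type :=
  {A : Set ℝ // MeasurableSet A} ×
    {φ : EuclideanSpace ℝ (Fin d) → ℝ // ContDiff ℝ 1 φ ∧ HasCompactSupport φ}

/-- The vector field `1_A(t) ∇φ(x)`. -/
noncomputable def TestPair.field (i : TestPair d) :
    boundedMeasurable (ℝ × EuclideanSpace ℝ (Fin d)) (EuclideanSpace ℝ (Fin d)) :=
  ⟨fun z => i.1.1.indicator (fun _ => (1 : ℝ)) z.1 • gradient i.2.1 z.2,
    ((measurable_const.indicator i.1.2).comp measurable_fst).fun_smul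
      ((continuous_gradient i.2.2.1).measurable.comp measurable_snd), by
    obtain ⟨C, hC⟩ := exists_norm_gradient_le i.2.2.1 i.2.2.2
    refine ⟨C, fun z => ?_⟩
    by_cases hz : z.1 ∈ i.1.1
    · simpa [hz] using hC z.2
    · simpa [hz] using (norm_nonneg _).trans (hC z.2)⟩

theorem TestPair.field_apply (i : TestPair d) (z : ℝ × EuclideanSpace ℝ (Fin d)) :
    (i.field : ℝ × EuclideanSpace ℝ (Fin d) → EuclideanSpace ℝ (Fin d)) z =
      i.1.1.indicator (fun _ => (1 : ℝ)) z.1 • gradient i.2.1 z.2 := rfl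

/-- The bound on derivatives of integrals of test functions, for finite combinations. -/
theorem enorm_sum_deriv_integral_le (hpq : p.HolderConjugate q) (hμ : IsLipschitzCurve p Ω μ)
    {t : ℝ} (ht : t ∈ Ico (0 : ℝ) 1) {m : ℝ≥0} (hm : HasMetricDerivAt p μ t m)
    (s : Finset (TestPair d)) (c : TestPair d → ℝ)
    (hd : ∀ i ∈ s, DifferentiableAt ℝ
      (fun r : ℝ => ∫ x, i.2.1 x ∂(μ (projIcc 0 1 zero_le_one r : ℝ))) t) :
    ‖∑ i ∈ s, c i * deriv (fun r : ℝ => ∫ x, i.2.1 x ∂(μ (projIcc 0 1 zero_le_one r : ℝ))) t‖ₑ ≤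
      m * (∫⁻ x, ‖∑ i ∈ s, c i • gradient i.2.1 x‖ₑ ^ q ∂(μ t)) ^ (1 / q) := by
  -- At a fixed time the coefficients are constants, so the combination is a single test function.
  let φ : EuclideanSpace ℝ (Fin d) → ℝ := ∑ i ∈ s, c i • i.2.1
  have hφ : ContDiff ℝ 1 φ ∧ HasCompactSupport φ := by
    refine Finset.sum_induction _ (fun φ : EuclideanSpace ℝ (Fin d) → ℝ =>
      ContDiff ℝ 1 φ ∧ HasCompactSupport φ) (fun f g hf hg => ⟨hf.1.add hg.1, hf.2.add hg.2⟩)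
      ⟨contDiff_const, HasCompactSupport.zero⟩ fun i _ => ⟨i.2.2.1.const_smul (c i), ?_⟩
    exact i.2.2.2.smul_left (f := fun _ => c i)
  have hgrad : ∀ x, gradient φ x = ∑ i ∈ s, c i • gradient i.2.1 x := fun x => by
    have h1 : HasFDerivAt φ (∑ i ∈ s, c i • fderiv ℝ i.2.1 x) x :=
      HasFDerivAt.sum fun i _ =>
        ((i.2.2.1.differentiable one_ne_zero x).hasFDerivAt).const_smul (c i)
    rw [gradient, h1.fderiv, map_sum]
    refine Finset.sum_congr rfl fun i _ => ?_
    rw [gradient, LinearIsometryEquiv.map_smulₛₗ]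
    simp
  have hf := HasDerivAt.fun_sum fun i hi => (hd i hi).hasDerivAt.const_mul (c i)
  have := abs_deriv_integral_le hpq hμ hφ.1 hφ.2 ht hm hf fun r hr => by
    have := hμ.isProbabilityMeasure hr
    simp only [φ, projIcc_of_mem zero_le_one hr, Finset.sum_apply, Pi.smul_apply, smul_eq_mul]
    rw [integral_finsetSum _ fun i _ =>
      (integrable_of_contDiff i.2.2.1 i.2.2.2).const_mul (c i)]
    simp_rw [integral_const_mul]
  simp_rw [hgrad] at this
  rwa [← ofReal_norm, Real.norm_eq_abs]

/-- A Lipschitz curve has a velocity field of minimal norm. -/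
theorem IsLipschitzCurve.exists_isMinimalVelocityField (hp : 1 < p)
    (hμ : IsLipschitzCurve p Ω μ) :
    ∃ v : ℝ → EuclideanSpace ℝ (Fin d) → EuclideanSpace ℝ (Fin d),
      IsMinimalVelocityField p μ v := by
  have hpq : p.HolderConjugate p.conjExponent := Real.HolderConjugate.conjExponent hp
  set q := p.conjExponent
  have hprob : ∀ t ∈ Icc (0 : ℝ) 1, IsProbabilityMeasure (μ t) := fun t ht =>
    hμ.isProbabilityMeasure ht
  let π : ℝ → ℝ := fun t => (projIcc 0 1 zero_le_one t : ℝ)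
  have hπ : ∀ t ∈ Icc (0 : ℝ) 1, π t = t := fun t ht => by
    simp only [π, projIcc_of_mem zero_le_one ht]
  let F : (EuclideanSpace ℝ (Fin d) → ℝ) → ℝ → ℝ := fun φ t => ∫ x, φ x ∂(μ (π t))
  have hF : ∀ φ : EuclideanSpace ℝ (Fin d) → ℝ, ContDiff ℝ 1 φ → HasCompactSupport φ →
      ∃ K, LipschitzWith K (F φ) := fun φ h1 h2 => hμ.exists_lipschitzWith_integral hpq h1 h2
  have hmeas : Measurable fun t : ℝ => μ (π t) :=
    measurable_projIcc_of_continuousOn hprob fun φ h1 h2 => by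
      obtain ⟨K, hK⟩ := hF φ h1 h2
      refine hK.continuous.continuousOn.congr fun t ht => ?_
      simp only [F, hπ t ht]
  let κ : Kernel ℝ (EuclideanSpace ℝ (Fin d)) := ⟨fun t => μ (π t), hmeas⟩
  have hκ : ∀ t, κ t = μ (π t) := fun t => rfl
  have : IsMarkovKernel κ := ⟨fun t => hprob _ (projIcc 0 1 zero_le_one t).2⟩
  let ρ : Measure ℝ := volume.restrict (Icc (0 : ℝ) 1)
  have : IsProbabilityMeasure ρ := ⟨by simp [ρ]⟩
  obtain ⟨m, L, hm, hm0, hmL, hmd⟩ := hμ.exists_hasMetricDerivAt hp.le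
  have hderiv : ∀ i : TestPair d, Integrable (deriv (F i.2.1)) ρ := fun i => by
    obtain ⟨K, hK⟩ := hF _ i.2.2.1 i.2.2.2
    exact Integrable.of_bound (measurable_deriv _).aestronglyMeasurable K
      (ae_of_all _ fun t => norm_deriv_le_of_lipschitz hK)
  -- Formal combinations of pairs avoid choosing a representation of each field; that equal fields
  -- have equal values follows from the bound in the Hahn-Banach lemma.
  let l : (TestPair d →₀ ℝ) →ₗ[ℝ] ℝ :=
    Finsupp.linearCombination ℝ fun i => ∫ t in i.1.1, deriv (F i.2.1) t ∂ρ
  let G : (TestPair d →₀ ℝ) →ₗ[ℝ]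
      boundedMeasurable (ℝ × EuclideanSpace ℝ (Fin d)) (EuclideanSpace ℝ (Fin d)) :=
    Finsupp.linearCombination ℝ TestPair.field
  have hG : ∀ a z, (G a : ℝ × EuclideanSpace ℝ (Fin d) → EuclideanSpace ℝ (Fin d)) z =
      ∑ i ∈ a.support, (a i * i.1.1.indicator (fun _ => (1 : ℝ)) z.1) • gradient i.2.1 z.2 := by
    intro a z
    simp only [G, Finsupp.linearCombination_apply, Finsupp.sum, AddSubmonoidClass.coe_finsetSum,
      Finset.sum_apply, Submodule.coe_smul, Pi.smul_apply, TestPair.field_apply, smul_smul]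
  obtain ⟨v, hv, hvi, hlv, hvm⟩ := exists_field_of_le_fiberNorm (ρ := ρ) (κ := κ)
    (m := fun t => ((m t).toNNReal : ℝ≥0∞)) (L := L) hm.real_toNNReal.coe_nnreal_ennreal
    (fun t => ENNReal.coe_le_coe.2 (Real.toNNReal_le_iff_le_coe.2 (hmL t))) ENNReal.coe_ne_top
    hpq l G fun a => by
      -- All terms are gathered under one time integral before estimating: a bound term by term
      -- would miss the cancellations between gradients.
      have h1 : l a = ∫ t, ∑ i ∈ a.support,
          (a i * i.1.1.indicator (fun _ => (1 : ℝ)) t) * deriv (F i.2.1) t ∂ρ := by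
        have e : ∀ (i : TestPair d) (t : ℝ),
            (a i * i.1.1.indicator (fun _ => (1 : ℝ)) t) * deriv (F i.2.1) t =
              a i * i.1.1.indicator (deriv (F i.2.1)) t := fun i t => by
          by_cases ht : t ∈ i.1.1 <;> simp [ht]
        simp_rw [e]
        rw [integral_finsetSum _ fun i _ => ((hderiv i).indicator i.1.2).const_mul (a i)]
        simp only [l, Finsupp.linearCombination_apply, Finsupp.sum, smul_eq_mul]
        refine Finset.sum_congr rfl fun i _ => ?_
        rw [integral_const_mul, integral_indicator i.1.2]
      have h2 : ∀ᵐ t ∂ρ, ∀ i ∈ a.support, DifferentiableAt ℝ (F i.2.1) t := by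
        rw [Finset.eventually_all]
        intro i _
        obtain ⟨K, hK⟩ := hF _ i.2.2.1 i.2.2.2
        exact ae_restrict_of_ae hK.ae_differentiableAt_real
      have h3 : ∀ᵐ t ∂ρ, t ∈ Ico (0 : ℝ) 1 := by
        have h4 : ∀ᵐ t : ℝ, t ≠ 1 := by simp [ae_iff]
        filter_upwards [ae_restrict_mem measurableSet_Icc, ae_restrict_of_ae h4] with t ht ht'
        exact ⟨ht.1, lt_of_le_of_ne ht.2 ht'⟩
      rw [h1]
      have h5 : ∀ x : ℝ, ENNReal.ofReal x ≤ ‖x‖ₑ := fun x => by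
        rw [← ofReal_norm, Real.norm_eq_abs]
        exact ENNReal.ofReal_le_ofReal (le_abs_self _)
      refine (h5 _).trans ((enorm_integral_le_lintegral_enorm _).trans (lintegral_mono_ae ?_))
      · filter_upwards [hmd, h2, h3] with t ht1 ht2 ht3
        simp_rw [hG, hκ, hπ t ⟨ht3.1, ht3.2.le⟩]
        exact enorm_sum_deriv_integral_le hpq hμ ht3 ht1 _ _ ht2
  have hκμ : ∀ t ∈ Icc (0 : ℝ) 1, κ t = μ t := fun t ht => by rw [hκ, hπ t ht]
  have hlt : ∀ᵐ t ∂ρ, eLpNorm (fun x => v (t, x)) (ENNReal.ofReal p) (μ t) ≤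
      ((m t).toNNReal : ℝ≥0∞) := by
    filter_upwards [hvm, ae_restrict_mem measurableSet_Icc] with t ht ht'
    rwa [hκμ t ht'] at ht
  refine ⟨fun t x => v (t, x), ⟨hv, ?_, fun φ hφ hφc => ?_⟩, ?_⟩
  · filter_upwards [hlt] with t ht
    exact ⟨(hv.comp measurable_prodMk_left).aestronglyMeasurable,
      ht.trans_lt ENNReal.coe_lt_top⟩
  · obtain ⟨C, hC⟩ := exists_norm_gradient_le hφ hφc
    have hgm : Measurable fun z : ℝ × EuclideanSpace ℝ (Fin d) => gradient φ z.2 :=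
      (continuous_gradient hφ).measurable.comp measurable_snd
    have hi : Integrable (fun z : ℝ × EuclideanSpace ℝ (Fin d) =>
        (inner ℝ (gradient φ z.2) (v z) : ℝ)) (ρ ⊗ₘ κ) := by
      refine (hvi.norm.const_mul C).mono' (hgm.inner hv).aestronglyMeasurable
        (ae_of_all _ fun z => ?_)
      exact (norm_inner_le_norm _ _).trans (mul_le_mul_of_nonneg_right (hC _) (norm_nonneg _))
    constructor
    · rw [intervalIntegrable_iff_integrableOn_Icc_of_le zero_le_one]
      have h1 : Integrable (fun t => ∫ x, (inner ℝ (gradient φ x) (v (t, x)) : ℝ) ∂(κ t)) ρ :=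
        Integrable.integral_compProd (κ := Kernel.const Unit ρ) (η := Kernel.prodMkLeft Unit κ)
          (a := ()) hi
      refine h1.congr ?_
      filter_upwards [ae_restrict_mem measurableSet_Icc] with t ht
      rw [hκμ t ht]
    · intro t₁ ht₁ t₂ ht₂ h12
      have hsub : Ioc t₁ t₂ ⊆ Icc (0 : ℝ) 1 := fun t ht => ⟨ht₁.1.trans ht.1.le, ht.2.trans ht₂.2⟩
      -- The pair of the interval `(t₁, t₂]` and `φ` gives the continuity equation, by the
      -- fundamental theorem of calculus for the Lipschitz function `F φ`.
      have h1 := hlv (Finsupp.single (⟨Ioc t₁ t₂, measurableSet_Ioc⟩, ⟨φ, hφ, hφc⟩) 1)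
      simp only [l, G, Finsupp.linearCombination_single, one_smul, TestPair.field_apply] at h1
      obtain ⟨K, hK⟩ := hF φ hφ hφc
      have hres : ρ.restrict (Ioc t₁ t₂) = volume.restrict (Ioc t₁ t₂) := by
        rw [Measure.restrict_restrict measurableSet_Ioc, inter_eq_left.2 hsub]
      have h2 : ∫ t in Ioc t₁ t₂, deriv (F φ) t ∂ρ = F φ t₂ - F φ t₁ := by
        rw [hres, ← intervalIntegral.integral_of_le h12.le, hK.integral_deriv_eq_sub]
      have h3 : ∀ z : ℝ × EuclideanSpace ℝ (Fin d),
          (inner ℝ ((Ioc t₁ t₂).indicator (fun _ => (1 : ℝ)) z.1 • gradient φ z.2) (v z) : ℝ) =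
          (Ioc t₁ t₂ ×ˢ univ).indicator (fun z => (inner ℝ (gradient φ z.2) (v z) : ℝ)) z := by
        intro z
        by_cases hz : z.1 ∈ Ioc t₁ t₂ <;> simp [indicator, hz]
      rw [h2] at h1
      simp_rw [h3] at h1
      rw [integral_indicator (measurableSet_Ioc.prod MeasurableSet.univ),
        Measure.setIntegral_compProd measurableSet_Ioc MeasurableSet.univ hi.integrableOn,
        hres] at h1
      simp only [F, hπ t₁ ht₁, hπ t₂ ht₂] at h1
      rw [h1, intervalIntegral.integral_of_le h12.le]
      refine setIntegral_congr_fun measurableSet_Ioc fun t ht => ?_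
      simp only [Measure.restrict_univ]
      rw [hκμ t (hsub ht)]
  · filter_upwards [hmd, hlt] with t h1 h2
    exact ⟨_, h1, h2⟩

end Existence

/-! ### Uniqueness by strict convexity. -/

section Uniqueness

variable {d : ℕ} {p : ℝ} {Ω : Set (EuclideanSpace ℝ (Fin d))}
  {μ : ℝ → Measure (EuclideanSpace ℝ (Fin d))}
  {v w : ℝ → EuclideanSpace ℝ (Fin d) → EuclideanSpace ℝ (Fin d)}

/-- Strict convexity of `‖·‖^p` has two sources: that of `r ↦ r^p` when the norms differ, that of
the inner product norm when they agree. -/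
theorem norm_midpoint_rpow_le {E : Type*} [NormedAddCommGroup E] [InnerProductSpace ℝ E]
    (hp : 1 < p) (a b : E) :
    ‖(1 / 2 : ℝ) • (a + b)‖ ^ p ≤ (‖a‖ ^ p + ‖b‖ ^ p) / 2 ∧
      (‖(1 / 2 : ℝ) • (a + b)‖ ^ p = (‖a‖ ^ p + ‖b‖ ^ p) / 2 → a = b) := by
  have hp0 : 0 < p := by linarith
  have h1 : ‖(1 / 2 : ℝ) • (a + b)‖ ≤ (‖a‖ + ‖b‖) / 2 := by
    rw [norm_smul]
    have := norm_add_le a b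
    norm_num
    linarith
  by_cases hab : ‖a‖ = ‖b‖
  · rw [← hab] at h1 ⊢
    rw [add_self_div_two] at h1 ⊢
    refine ⟨Real.rpow_le_rpow (norm_nonneg _) h1 hp0.le, fun h => ?_⟩
    by_contra hne
    have := Real.rpow_lt_rpow (norm_nonneg _) ((norm_midpoint_lt_iff hab).2 hne) hp0
    exact this.ne h
  · have h2 := (strictConvexOn_rpow hp).2 (norm_nonneg a) (norm_nonneg b) hab
      (by norm_num : (0 : ℝ) < 1 / 2) (by norm_num : (0 : ℝ) < 1 / 2) (by norm_num)
    simp only [smul_eq_mul] at h2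
    have h3 : (1 / 2 : ℝ) * ‖a‖ + 1 / 2 * ‖b‖ = (‖a‖ + ‖b‖) / 2 := by ring
    rw [h3] at h2
    have h4 := Real.rpow_le_rpow (norm_nonneg _) h1 hp0.le
    exact ⟨by linarith, fun h => by linarith⟩

/-- The convexity gap at the midpoint is nonnegative with zero integral, so equality holds almost
everywhere in the pointwise inequality. -/
theorem ae_eq_of_eLpNorm_le_midpoint {ν : Measure (EuclideanSpace ℝ (Fin d))}
    {f g : EuclideanSpace ℝ (Fin d) → EuclideanSpace ℝ (Fin d)} (hp : 1 < p)
    (hf : MemLp f (ENNReal.ofReal p) ν) (hg : MemLp g (ENNReal.ofReal p) ν)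
    (hfu : eLpNorm f (ENNReal.ofReal p) ν ≤
      eLpNorm ((1 / 2 : ℝ) • (f + g)) (ENNReal.ofReal p) ν)
    (hgu : eLpNorm g (ENNReal.ofReal p) ν ≤
      eLpNorm ((1 / 2 : ℝ) • (f + g)) (ENNReal.ofReal p) ν) : f =ᵐ[ν] g := by
  have hp0 : 0 < p := by linarith
  have hu : MemLp ((1 / 2 : ℝ) • (f + g)) (ENNReal.ofReal p) ν := (hf.add hg).const_smul _
  have key : ∀ {k : EuclideanSpace ℝ (Fin d) → EuclideanSpace ℝ (Fin d)},
      MemLp k (ENNReal.ofReal p) ν → eLpNorm k (ENNReal.ofReal p) ν ≤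
        eLpNorm ((1 / 2 : ℝ) • (f + g)) (ENNReal.ofReal p) ν →
      ∫ x, ‖k x‖ ^ p ∂ν ≤ ∫ x, ‖((1 / 2 : ℝ) • (f + g)) x‖ ^ p ∂ν := fun {k} hk hle => by
    have h0 : ∀ k : EuclideanSpace ℝ (Fin d) → EuclideanSpace ℝ (Fin d),
        0 ≤ ∫ x, ‖k x‖ ^ p ∂ν := fun k => integral_nonneg fun _ => by positivity
    rw [eLpNorm_ofReal_eq hp0 hk, eLpNorm_ofReal_eq hp0 hu,
      ENNReal.ofReal_le_ofReal_iff (Real.rpow_nonneg (h0 _) _)] at hle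
    exact (Real.rpow_le_rpow_iff (h0 _) (h0 _) (inv_pos.2 hp0)).1 hle
  have i1 := integrable_norm_rpow hp0 hf
  have i2 := integrable_norm_rpow hp0 hg
  have i3 := integrable_norm_rpow hp0 hu
  have i12 : Integrable (fun x => (‖f x‖ ^ p + ‖g x‖ ^ p) / 2) ν := (i1.add i2).div_const 2
  have hnn : 0 ≤ᵐ[ν] fun x => (‖f x‖ ^ p + ‖g x‖ ^ p) / 2 - ‖((1 / 2 : ℝ) • (f + g)) x‖ ^ p :=
    ae_of_all _ fun x => sub_nonneg.2 (norm_midpoint_rpow_le hp (f x) (g x)).1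
  have hint : ∫ x, ((‖f x‖ ^ p + ‖g x‖ ^ p) / 2 - ‖((1 / 2 : ℝ) • (f + g)) x‖ ^ p) ∂ν = 0 := by
    refine le_antisymm ?_ (integral_nonneg_of_ae hnn)
    rw [integral_sub i12 i3, integral_div, integral_add i1 i2]
    linarith [key hf hfu, key hg hgu]
  have hz := (integral_eq_zero_iff_of_nonneg_ae hnn (i12.sub i3)).1 hint
  filter_upwards [hz] with x hx
  exact (norm_midpoint_rpow_le hp (f x) (g x)).2 (sub_eq_zero.1 hx).symm

theorem integrable_inner_gradient {ν : Measure (EuclideanSpace ℝ (Fin d))} [IsProbabilityMeasure ν]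
    {f : EuclideanSpace ℝ (Fin d) → EuclideanSpace ℝ (Fin d)} (hp : 1 ≤ p)
    (hf : MemLp f (ENNReal.ofReal p) ν) {φ : EuclideanSpace ℝ (Fin d) → ℝ} (hφ : ContDiff ℝ 1 φ)
    (hφc : HasCompactSupport φ) :
    Integrable (fun x => (inner ℝ (gradient φ x) (f x) : ℝ)) ν := by
  obtain ⟨C, hC⟩ := exists_norm_gradient_le hφ hφc
  have hi : Integrable f ν := hf.integrable (by simpa using ENNReal.ofReal_le_ofReal hp)
  refine (hi.norm.const_mul C).mono'
    ((continuous_gradient hφ).aestronglyMeasurable.inner hi.aestronglyMeasurable)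
    (ae_of_all _ fun x => ?_)
  exact (norm_inner_le_norm _ _).trans (mul_le_mul_of_nonneg_right (hC _) (norm_nonneg _))

/-- The midpoint of two velocity fields is a velocity field. -/
theorem IsVelocityField.midpoint (hp : 1 ≤ p)
    (hprob : ∀ t ∈ Icc (0 : ℝ) 1, IsProbabilityMeasure (μ t)) (hv : IsVelocityField p μ v)
    (hw : IsVelocityField p μ w) :
    IsVelocityField p μ fun t => (1 / 2 : ℝ) • (v t + w t) := by
  refine ⟨(hv.measurable.add hw.measurable).const_smul (1 / 2 : ℝ), ?_, fun φ hφ hφc => ?_⟩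
  · filter_upwards [hv.memLp, hw.memLp] with t h1 h2
    exact (h1.add h2).const_smul _
  · obtain ⟨iv, ev⟩ := hv.continuityEquation φ hφ hφc
    obtain ⟨iw, ew⟩ := hw.continuityEquation φ hφ hφc
    have heq : ∀ᵐ t ∂(volume.restrict (Icc (0 : ℝ) 1)),
        (1 / 2 : ℝ) * (∫ x, inner ℝ (gradient φ x) (v t x) ∂(μ t) +
          ∫ x, inner ℝ (gradient φ x) (w t x) ∂(μ t)) =
        ∫ x, inner ℝ (gradient φ x) (((1 / 2 : ℝ) • (v t + w t)) x) ∂(μ t) := by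
      filter_upwards [hv.memLp, hw.memLp, ae_restrict_mem measurableSet_Icc] with t h1 h2 ht
      have := hprob t ht
      rw [← integral_add (integrable_inner_gradient hp h1 hφ hφc)
        (integrable_inner_gradient hp h2 hφ hφc), ← integral_const_mul]
      refine integral_congr_ae (ae_of_all _ fun x => ?_)
      simp only [Pi.smul_apply, Pi.add_apply, inner_smul_right, inner_add_right]
    refine ⟨?_, fun t₁ ht₁ t₂ ht₂ h12 => ?_⟩
    · have h1 := (iv.add iw).const_mul (1 / 2 : ℝ)
      rw [intervalIntegrable_iff_integrableOn_Icc_of_le zero_le_one] at h1 ⊢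
      exact Integrable.congr h1 heq
    · have hsub : uIcc t₁ t₂ ⊆ uIcc (0 : ℝ) 1 := by
        rw [uIcc_of_le zero_le_one, uIcc_of_le h12.le]
        exact Icc_subset_Icc ht₁.1 ht₂.2
      have hsub' : Ioc t₁ t₂ ⊆ Icc (0 : ℝ) 1 :=
        Ioc_subset_Icc_self.trans (Icc_subset_Icc ht₁.1 ht₂.2)
      have h1 : ∫ s in t₁..t₂, ∫ x, inner ℝ (gradient φ x) (((1 / 2 : ℝ) • (v s + w s)) x) ∂(μ s) =
          ∫ s in t₁..t₂, (1 / 2 : ℝ) * (∫ x, inner ℝ (gradient φ x) (v s x) ∂(μ s) +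
            ∫ x, inner ℝ (gradient φ x) (w s x) ∂(μ s)) := by
        rw [intervalIntegral.integral_of_le h12.le, intervalIntegral.integral_of_le h12.le]
        refine integral_congr_ae ?_
        filter_upwards [ae_restrict_of_ae_restrict_of_subset hsub' heq] with t ht
        exact ht.symm
      rw [h1, intervalIntegral.integral_const_mul,
        intervalIntegral.integral_add (iv.mono_set hsub) (iw.mono_set hsub),
        ← ev t₁ ht₁ t₂ ht₂ h12, ← ew t₁ ht₁ t₂ ht₂ h12]
      ring

theorem HasMetricDerivAt.le_of_lipschitz {L : ℝ≥0}
    (hL : ∀ s ∈ Icc (0 : ℝ) 1, ∀ t ∈ Icc (0 : ℝ) 1, Wp p (μ s) (μ t) ≤ L * edist s t) {t : ℝ}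
    (ht : t ∈ Ico (0 : ℝ) 1) {m : ℝ≥0} (hm : HasMetricDerivAt p μ t m) : m ≤ L := by
  have hne : (𝓝[Icc (0 : ℝ) 1 \ {t}] t).NeBot := by
    have h1 : 𝓝[Ioo t 1] t ≤ 𝓝[Icc (0 : ℝ) 1 \ {t}] t :=
      nhdsWithin_mono t fun s hs => ⟨⟨ht.1.trans hs.1.le, hs.2.le⟩, hs.1.ne'⟩
    rw [nhdsWithin_Ioo_eq_nhdsGT ht.2] at h1
    exact NeBot.mono inferInstance h1
  refine ENNReal.coe_le_coe.1 (le_of_tendsto hm ?_)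
  filter_upwards [self_mem_nhdsWithin] with s hs
  refine ENNReal.div_le_of_le_mul ?_
  exact hL s hs.1 t ⟨ht.1, ht.2.le⟩

/-- Provides the uniform bound under which the converse direction applies to the midpoint of two
minimal fields. -/
theorem IsMinimalVelocityField.exists_eLpNorm_le (hμ : IsLipschitzCurve p Ω μ)
    (hv : IsMinimalVelocityField p μ v) :
    ∃ L : ℝ≥0, ∀ᵐ t ∂(volume.restrict (Icc (0 : ℝ) 1)),
      eLpNorm (v t) (ENNReal.ofReal p) (μ t) ≤ L := by
  obtain ⟨L, hL⟩ := hμ.2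
  have h1 : ∀ᵐ t : ℝ, t ≠ 1 := by simp [ae_iff]
  refine ⟨L, ?_⟩
  filter_upwards [hv.2, ae_restrict_mem measurableSet_Icc, ae_restrict_of_ae h1]
    with t ⟨m, hm, hle⟩ ht ht'
  exact hle.trans (ENNReal.coe_le_coe.2
    (hm.le_of_lipschitz hL ⟨ht.1, lt_of_le_of_ne ht.2 ht'⟩))

/-- The velocity field of minimal norm is unique. -/
theorem IsMinimalVelocityField.ae_eq (hp : 1 < p) (hμ : IsLipschitzCurve p Ω μ)
    (hv : IsMinimalVelocityField p μ v) (hw : IsMinimalVelocityField p μ w) :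
    ∀ᵐ t ∂(volume.restrict (Icc (0 : ℝ) 1)), v t =ᵐ[μ t] w t := by
  have hprob : ∀ t ∈ Icc (0 : ℝ) 1, IsProbabilityMeasure (μ t) := fun t ht =>
    hμ.isProbabilityMeasure ht
  obtain ⟨L, hL⟩ := hv.exists_eLpNorm_le hμ
  obtain ⟨L', hL'⟩ := hw.exists_eLpNorm_le hμ
  have h1p : (1 : ℝ≥0∞) ≤ ENNReal.ofReal p := by simpa using ENNReal.ofReal_le_ofReal hp.le
  have hu := hv.1.midpoint hp.le hprob hw.1
  have hC : ∀ᵐ t ∂(volume.restrict (Icc (0 : ℝ) 1)),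
      eLpNorm ((1 / 2 : ℝ) • (v t + w t)) (ENNReal.ofReal p) (μ t) ≤ ↑(L + L') := by
    filter_upwards [hL, hL', hv.1.memLp, hw.1.memLp] with t h1 h2 h3 h4
    refine eLpNorm_const_smul_le.trans ?_
    have h5 : ‖(1 / 2 : ℝ)‖ₑ ≤ 1 := by
      rw [← ofReal_norm]
      norm_num
    refine (mul_le_of_le_one_left zero_le h5).trans ?_
    rw [ENNReal.coe_add]
    exact (eLpNorm_add_le h3.1 h4.1 h1p).trans (add_le_add h1 h2)
  -- The converse gives `|μ'|(t) ≤ ‖(v_t + w_t) / 2‖`, while minimality bounds `‖v_t‖` and `‖w_t‖`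
  -- by `|μ'|(t)`.
  filter_upwards [hv.2, hw.2, hv.1.memLp, hw.1.memLp, hasMetricDerivAt_le_eLpNorm hp hprob hu hC]
    with t ⟨m, hm, hle⟩ ⟨m', hm', hle'⟩ h3 h4 h5
  exact ae_eq_of_eLpNorm_le_midpoint hp h3 h4 (hle.trans (h5 m hm)) (hle'.trans (h5 m' hm'))

end Uniqueness

end Wasserstein

theorem mainTheorem9 {d : ℕ} (Ω : Set (EuclideanSpace ℝ (Fin d))) (hΩ : MeasurableSet Ω)
    (p : ℝ) (hp : 1 < p) :
    (∀ μ : ℝ → Measure (EuclideanSpace ℝ (Fin d)), Wasserstein.IsLipschitzCurve p Ω μ →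
      ∃ v : ℝ → EuclideanSpace ℝ (Fin d) → EuclideanSpace ℝ (Fin d),
        Wasserstein.IsMinimalVelocityField p μ v ∧
        ∀ w : ℝ → EuclideanSpace ℝ (Fin d) → EuclideanSpace ℝ (Fin d),
          Wasserstein.IsMinimalVelocityField p μ w →
          ∀ᵐ t ∂(volume.restrict (Icc (0 : ℝ) 1)), w t =ᵐ[μ t] v t) ∧
    (∀ (μ : ℝ → Measure (EuclideanSpace ℝ (Fin d)))
        (v : ℝ → EuclideanSpace ℝ (Fin d) → EuclideanSpace ℝ (Fin d)) (C : ℝ≥0),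
      (∀ t ∈ Icc (0 : ℝ) 1, μ t ∈ Wasserstein.probOn Ω) →
      μ 0 ∈ Wasserstein.space p Ω →
      Wasserstein.IsVelocityField p μ v →
      (∀ᵐ t ∂(volume.restrict (Icc (0 : ℝ) 1)),
        eLpNorm (v t) (ENNReal.ofReal p) (μ t) ≤ C) →
      Wasserstein.IsLipschitzCurve p Ω μ ∧
      ∀ᵐ t ∂(volume.restrict (Icc (0 : ℝ) 1)),
        ∃ m : ℝ≥0, Wasserstein.HasMetricDerivAt p μ t m ∧
          (m : ℝ≥0∞) ≤ eLpNorm (v t) (ENNReal.ofReal p) (μ t)) := by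
  refine ⟨fun μ hμ => ?_, fun μ v C hμ h0 hv hC => ?_⟩
  · obtain ⟨v, hv⟩ := hμ.exists_isMinimalVelocityField hp
    exact ⟨v, hv, fun w hw => hw.ae_eq hp hμ hv⟩
  · have hlip := Wasserstein.isLipschitzCurve_of_isVelocityField hp hμ h0 hv hC
    obtain ⟨m, L, -, -, -, hm⟩ := hlip.exists_hasMetricDerivAt hp.le
    refine ⟨hlip, ?_⟩
    filter_upwards [hm, Wasserstein.hasMetricDerivAt_le_eLpNorm hp (fun t ht => (hμ t ht).1) hv hC]
      with t h1 h2
    exact ⟨_, h1, h2 _ h1⟩
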